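/- **Theorem (homotopy transfer for $L_\infty[1]$ algebras).** Let $\mathbb K$ be a field of characteristic zero. For a $\mathbb Z$-graded vector space $V$ let $S(V)=\bigoplus_{n\ge 0}V^{\odot n}$ be the graded symmetric algebra, with the unshuffle coproduct $\Delta$ (the algebra morphism into the graded tensor product with $\Delta x=x\otimes 1+1\otimes x$ for $x\in V$), and let $p:S(V)\to V$ be the natural projection. The Taylor coefficients of a linear map $F:S(V)\to S(W)$ are $f_n(x_1,\dots,x_n)=pF(x_1\odot\cdots\odot x_n)$. An $L_\infty[1]$ algebra structure on $V$ is a coderivation $Q$ of $S(V)$ of degree $1$ with $Q(\mathbf 1)=0$ and $Q^2=0$; an $L_\infty[1]$ morphism is a morphism of DG coalgebras (degree $0$, counital, $\mathbf 1\mapsto\mathbf 1$). A contraction $(\sigma,\tau,h)$ of a complex $(A,d_A)$ onto $(B,d_B)$ consists of maps of complexes $\sigma:A\to B$, $\tau:B\to A$ and a map $h:A\to A$ of degree $-1$ with $\sigma\tau=\mathrm{id}$, $hd_A+d_Ah=\tau\sigma-\mathrm{id}$, $\sigma h=0$, $h\tau=0$, $h^2=0$. Let $(g,f,h)$ be a contraction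 of a complex $(U,d_U)$ onto a complex $(V,d_V)$, and let $Q$ be an $L_\infty[1]$ algebra structure on $U$ with linear part $q_1=d_U$ and Taylor coefficients $q_k$. Let $\widetilde{d_U},\widetilde{d_V}$ be the linear coderivations extending $d_U,d_V$, let $Q_+=Q-\widetilde{d_U}$, and let $\widehat h(\mathbf 1)=0$, $$\widehat h(x_1\odot\cdots\odot x_n)=\frac1{n!}\sum_{\sigma\in S_n}\sum_{j=1}^n\pm_K\, fg(x_{\sigma(1)})\odot\cdots\odot fg(x_{\sigma(j-1)})\odot h(x_{\sigma(j)})\odot x_{\sigma(j+1)}\odot\cdots\odot x_{\sigma(n)},$$ where $\pm_K$ denotes Koszul signs. Put $$R=\widetilde{d_V}+\sum_{n\ge0}S(g)Q_+(\widehat hQ_+)^nS(f),\quad G=\sum_{n\ge0}S(g)(Q_+\widehat h)^n,\quad F=\sum_{n\ge0}(\widehat hQ_+)^nS(f),\quad H=\sum_{n\ge0}(\widehat hQ_+)^n\widehat h.$$ Then: 1. $(S(g),S(f),\widehat h)$ is a contraction of $(S(U),\widetilde{d_U})$ onto $(S(V),\widetilde{d_V})$, and it is semifull with respect to both structures. For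 the products: $\widetilde{d_U}$ is a derivation and $\widetilde{d_U}(\mathbf 1)=0$, $\widetilde{d_V}(\mathbf 1)=0$; writing $\sigma=S(g)$, $\tau=S(f)$, one has $\widehat h(\widehat h(a)\widehat h(b))=\widehat h(\widehat h(a)\tau(x))=\widehat h(\tau(x)\tau(y))=\widehat h(\mathbf 1)=0$, $\sigma(\widehat h(a)\widehat h(b))=\sigma(\widehat h(a)\tau(x))=0$, $\sigma(\tau(x)\tau(y))=xy$, $\sigma(\mathbf 1)=\mathbf 1$. For the coproducts: $\widetilde{d_U}$ is a coderivation; $\widetilde{d_U},\widetilde{d_V},\widehat h$ vanish on $\mathbf 1$ and compose to zero with the counit; $\sigma,\tau$ preserve $\mathbf 1$ and the counit; and $(\widehat h\otimes\widehat h)\Delta\widehat h=(\widehat h\otimes\sigma)\Delta\widehat h=(\sigma\otimes\sigma)\Delta\widehat h=0$, $(\widehat h\otimes\widehat h)\Delta\tau=(\widehat h\otimes\sigma)\Delta\tau=0$, $(\sigma\otimes\sigma)\Delta\tau=\Delta$. 2. $\widehat hQ_+$ and $Q_+\widehat h$ are locally nilpotent, so that the four series above are finite sums on each element, and $(G,F,H)$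 is a contraction of $(S(U),Q)$ onto $(S(V),R)$. 3. $R$ is an $L_\infty[1]$ algebra structure on $V$, with linear part $d_V$. 4. $G:(U,Q)\to(V,R)$ and $F:(V,R)\to(U,Q)$ are $L_\infty[1]$ morphisms, with linear parts $g$ and $f$. 5. The Taylor coefficients of $F$ are determined by $f_1=f$ and, for $n\ge2$ and homogeneous $x_1,\dots,x_n\in V$, $$f_n(x_1,\dots,x_n)=\sum_{\substack{k\ge2,\ i_1,\dots,i_k\ge1\\ i_1+\cdots+i_k=n}}\ \sum_{\sigma\in S(i_1,\dots,i_k)}\pm_K\frac1{k!}\,h\,q_k\bigl(f_{i_1}(x_{\sigma(1)},\dots),\dots,f_{i_k}(\dots,x_{\sigma(n)})\bigr),$$ where $S(i_1,\dots,i_k)$ is the set of $(i_1,\dots,i_k)$-unshuffles. -/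

import Mathlib

open DirectSum TensorProduct

noncomputable section

namespace HomotopyTransfer

/-! ### Graded modules and Koszul signs -/

section Graded

variable {K : Type*} [Field K] {A B : Type*} [AddCommGroup A] [Module K A]
  [AddCommGroup B] [Module K B]

/-- `f` is homogeneous of degree `k`: it maps `𝒜 i` into `ℬ (i + k)`. -/
def HasDegree (𝒜 : ℤ → Submodule K A) (ℬ : ℤ → Submodule K B) (k : ℤ) (f : A →ₗ[K] B) : Prop :=
  ∀ (i : ℤ) (x : A), x ∈ 𝒜 i → f x ∈ ℬ (i + k)

/-- The operator `a ↦ (-1)^(k|a|) a`. -/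
def signOp (𝒜 : ℤ → Submodule K A) [DirectSum.Decomposition 𝒜] (k : ℤ) : A →ₗ[K] A :=
  DirectSum.toModule K ℤ A (fun i => ((-1 : ℤˣ) ^ (k * i)) • (𝒜 i).subtype) ∘ₗ
    (DirectSum.decomposeLinearEquiv 𝒜).toLinearMap

theorem signOp_apply (𝒜 : ℤ → Submodule K A) [DirectSum.Decomposition 𝒜] (k : ℤ) {i : ℤ} {x : A}
    (hx : x ∈ 𝒜 i) : signOp 𝒜 k x = ((-1 : ℤˣ) ^ (k * i)) • x := by
  lift x to 𝒜 i using hx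
  simp [signOp, DirectSum.toModule_lof]

/-- The tensor product `f ⊗ g` of graded maps, with the Koszul sign:
`(f ⊗ g) (a ⊗ b) = (-1)^(k|a|) f a ⊗ g b`, where `k` is the degree of `g`. -/
def koszulTensor {A' B' : Type*} [AddCommGroup A'] [Module K A'] [AddCommGroup B'] [Module K B']
    (𝒜 : ℤ → Submodule K A) [DirectSum.Decomposition 𝒜] (k : ℤ)
    (f : A →ₗ[K] A') (g : B →ₗ[K] B') : A ⊗[K] B →ₗ[K] A' ⊗[K] B' :=
  TensorProduct.map (f ∘ₗ signOp 𝒜 k) g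

/-- The Koszul sign of the permutation `x₁, …, xₙ ↦ x_{σ 1}, …, x_{σ n}` of homogeneous elements
of degrees `p₁, …, pₙ`: each inversion of `σ` contributes `(-1)^(|x||y|)`. -/
def koszulSign {n : ℕ} (p : Fin n → ℤ) (σ : Equiv.Perm (Fin n)) : ℤˣ :=
  ∏ i, ∏ j, if i < j ∧ σ j < σ i then (-1 : ℤˣ) ^ (p (σ i) * p (σ j)) else 1

end Graded

/-! ### The cocycle property of the Koszul sign -/

section KoszulSign

theorem prod_pairs_perm {n : ℕ} (F : Fin n → Fin n → ℤˣ) (hF : ∀ i j, F i j = F j i)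
    (σ : Equiv.Perm (Fin n)) :
    (∏ i, ∏ j, if i < j then F (σ i) (σ j) else 1) = ∏ i, ∏ j, if i < j then F i j else 1 := by
  have key : ∀ s : Equiv.Perm (Fin n),
      (∏ i, ∏ j, if s i < s j then F i j else 1) = ∏ i, ∏ j, if i < j then F i j else 1 := by
    intro s
    have h1 : (∏ i, ∏ j, if s i < s j then F i j else 1) =
        (∏ i, ∏ j, if i < j then (if s i < s j then F i j else 1) else 1) *
        ∏ i, ∏ j, if j < i then (if s i < s j then F i j else 1) else 1 := by
      rw [← Finset.prod_mul_distrib]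
      refine Finset.prod_congr rfl fun i _ => ?_
      rw [← Finset.prod_mul_distrib]
      refine Finset.prod_congr rfl fun j _ => ?_
      rcases lt_trichotomy i j with h | h | h
      · simp [h, h.asymm]
      · simp [h]
      · simp [h, h.asymm]
    rw [h1, Finset.prod_comm (f := fun i j => if j < i then (if s i < s j then F i j else 1) else 1),
      ← Finset.prod_mul_distrib]
    refine Finset.prod_congr rfl fun i _ => ?_
    rw [← Finset.prod_mul_distrib]
    refine Finset.prod_congr rfl fun j _ => ?_
    by_cases h : i < j
    · have hne : s i ≠ s j := fun e => h.ne (s.injective e)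
      rcases lt_or_gt_of_ne hne with h' | h'
      · simp [h, h', h'.asymm]
      · simp [h, h', h'.asymm, hF j i]
    · simp [h]
  rw [← key σ⁻¹, ← Equiv.prod_comp σ (fun i => ∏ j, if σ⁻¹ i < σ⁻¹ j then F i j else 1)]
  refine Finset.prod_congr rfl fun i _ => ?_
  rw [← Equiv.prod_comp σ (fun j => if σ⁻¹ (σ i) < σ⁻¹ j then F (σ i) j else 1)]
  simp

theorem koszulSign_mul {n : ℕ} (p : Fin n → ℤ) (τ σ : Equiv.Perm (Fin n)) :
    koszulSign p (τ * σ) = koszulSign p τ * koszulSign (fun i => p (τ i)) σ := by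
  have h2 : koszulSign p τ = ∏ i, ∏ j, if i < j then
      (if (σ i < σ j ∧ τ (σ j) < τ (σ i)) ∨ (σ j < σ i ∧ τ (σ i) < τ (σ j)) then
        (-1 : ℤˣ) ^ (p (τ (σ i)) * p (τ (σ j))) else 1) else 1 := by
    rw [prod_pairs_perm (fun a b => if (a < b ∧ τ b < τ a) ∨ (b < a ∧ τ a < τ b) then
        (-1 : ℤˣ) ^ (p (τ a) * p (τ b)) else 1)
        (by intro a b; rw [mul_comm (p (τ a))]; simp only [or_comm]) σ]
    refine Finset.prod_congr rfl fun i _ => Finset.prod_congr rfl fun j _ => ?_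
    by_cases h : i < j
    · simp [h, h.asymm]
    · simp [h]
  rw [h2, koszulSign, koszulSign, ← Finset.prod_mul_distrib]
  refine Finset.prod_congr rfl fun i _ => ?_
  rw [← Finset.prod_mul_distrib]
  refine Finset.prod_congr rfl fun j _ => ?_
  by_cases h : i < j
  · have hne : σ i ≠ σ j := fun e => h.ne (σ.injective e)
    have hne' : τ (σ i) ≠ τ (σ j) := fun e => hne (τ.injective e)
    rcases lt_or_gt_of_ne hne with h' | h' <;> rcases lt_or_gt_of_ne hne' with h'' | h'' <;>
      simp [h, h', h'', h'.asymm, h''.asymm, Int.units_mul_self]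
  · simp [h]

theorem koszulSign_swap {n : ℕ} (p : Fin n → ℤ) (a b : Fin n) (hab : (a : ℕ) + 1 = b) :
    koszulSign p (Equiv.swap a b) = (-1 : ℤˣ) ^ (p a * p b) := by
  have hlt : a < b := by rw [Fin.lt_def]; omega
  rw [koszulSign, Finset.prod_eq_single a, Finset.prod_eq_single b]
  · simp [hlt, mul_comm]
  · intro j _ hj
    rw [if_neg]
    rintro ⟨h1, h2⟩
    rw [Equiv.swap_apply_left, Equiv.swap_apply_of_ne_of_ne h1.ne' hj, Fin.lt_def] at h2
    rw [Fin.lt_def] at h1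
    omega
  · simp
  · intro i _ hi
    refine Finset.prod_eq_one fun j _ => ?_
    rw [if_neg]
    rintro ⟨h1, h2⟩
    by_cases hib : i = b
    · subst hib
      have hja : j ≠ a := by rintro rfl; exact h1.asymm hlt
      rw [Equiv.swap_apply_right, Equiv.swap_apply_of_ne_of_ne hja h1.ne'] at h2
      exact absurd (h2.trans hlt) h1.asymm
    · rw [Equiv.swap_apply_of_ne_of_ne hi hib] at h2
      by_cases hja : j = a
      · subst hja
        rw [Equiv.swap_apply_left, Fin.lt_def] at h2
        rw [Fin.lt_def] at h1
        omega
      · by_cases hjb : j = b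
        · subst hjb
          rw [Equiv.swap_apply_right, Fin.lt_def] at h2
          rw [Fin.lt_def] at h1
          have : (i : ℕ) ≠ a := fun e => hi (Fin.ext e)
          omega
        · rw [Equiv.swap_apply_of_ne_of_ne hja hjb] at h2
          exact h1.asymm h2
  · simp

end KoszulSign

/-! ### The symmetric algebra of a graded module -/

section GSym

variable {K : Type*} [Field K] {V : Type*} [AddCommGroup V] [Module K V]

/-- Graded commutativity of the generators: `x y = (-1)^(|x||y|) y x`. -/
inductive GSym.Rel (𝒱 : ℤ → Submodule K V) : TensorAlgebra K V → TensorAlgebra K V → Prop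
  | swap {i j : ℤ} {x y : V} (hx : x ∈ 𝒱 i) (hy : y ∈ 𝒱 j) :
    GSym.Rel 𝒱 (TensorAlgebra.ι K x * TensorAlgebra.ι K y)
      (((-1 : ℤˣ) ^ (i * j)) • (TensorAlgebra.ι K y * TensorAlgebra.ι K x))

/-- The graded symmetric algebra `S(V) = ⨁ₙ V^{⊙n}` of a graded module `V`: the quotient of the
tensor algebra by the two-sided ideal generated by `x ⊗ y - (-1)^(|x||y|) y ⊗ x`. -/
def GSym (𝒱 : ℤ → Submodule K V) : Type _ := RingQuot (GSym.Rel 𝒱)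

namespace GSym

instance instRing (𝒱 : ℤ → Submodule K V) : Ring (GSym 𝒱) :=
  inferInstanceAs (Ring (RingQuot (GSym.Rel 𝒱)))

instance instAlgebra (𝒱 : ℤ → Submodule K V) : Algebra K (GSym 𝒱) :=
  inferInstanceAs (Algebra K (RingQuot (GSym.Rel 𝒱)))

/-- The projection of the tensor algebra onto the symmetric algebra. -/
def mk (𝒱 : ℤ → Submodule K V) : TensorAlgebra K V →ₐ[K] GSym 𝒱 :=
  RingQuot.mkAlgHom K (GSym.Rel 𝒱)

theorem mk_surjective (𝒱 : ℤ → Submodule K V) : Function.Surjective (mk 𝒱) :=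
  RingQuot.mkAlgHom_surjective K (GSym.Rel 𝒱)

/-- The inclusion `V → S(V)`. -/
def ι (𝒱 : ℤ → Submodule K V) : V →ₗ[K] GSym 𝒱 :=
  (mk 𝒱).toLinearMap ∘ₗ TensorAlgebra.ι K

/-- The monomial `x₁ ⊙ ⋯ ⊙ xₙ`. -/
def monomial (𝒱 : ℤ → Submodule K V) {n : ℕ} (x : Fin n → V) : GSym 𝒱 :=
  (List.ofFn fun i => ι 𝒱 (x i)).prod

theorem mk_ι (𝒱 : ℤ → Submodule K V) (x : V) : mk 𝒱 (TensorAlgebra.ι K x) = ι 𝒱 x := rfl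

theorem ι_mul_ι (𝒱 : ℤ → Submodule K V) {i j : ℤ} {x y : V} (hx : x ∈ 𝒱 i) (hy : y ∈ 𝒱 j) :
    ι 𝒱 x * ι 𝒱 y = ((-1 : ℤˣ) ^ (i * j)) • (ι 𝒱 y * ι 𝒱 x) := by
  have h := RingQuot.mkAlgHom_rel K (Rel.swap hx hy)
  rw [map_mul, Units.smul_def, map_zsmul, map_mul, ← Units.smul_def] at h
  exact h

/-- The universal property of the graded symmetric algebra. -/
def lift (𝒱 : ℤ → Submodule K V) {C : Type*} [Ring C] [Algebra K C] (φ : V →ₗ[K] C)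
    (hφ : ∀ ⦃i j : ℤ⦄ ⦃x y : V⦄, x ∈ 𝒱 i → y ∈ 𝒱 j →
      φ x * φ y = ((-1 : ℤˣ) ^ (i * j)) • (φ y * φ x)) : GSym 𝒱 →ₐ[K] C :=
  RingQuot.liftAlgHom K ⟨TensorAlgebra.lift K φ, by
    rintro _ _ ⟨hx, hy⟩
    rw [map_mul, Units.smul_def, map_zsmul, map_mul, ← Units.smul_def]
    simpa using hφ hx hy⟩

@[simp]
theorem lift_ι (𝒱 : ℤ → Submodule K V) {C : Type*} [Ring C] [Algebra K C] (φ : V →ₗ[K] C)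
    (hφ : ∀ ⦃i j : ℤ⦄ ⦃x y : V⦄, x ∈ 𝒱 i → y ∈ 𝒱 j →
      φ x * φ y = ((-1 : ℤˣ) ^ (i * j)) • (φ y * φ x)) (x : V) :
    lift 𝒱 φ hφ (ι 𝒱 x) = φ x := by
  have h := RingQuot.liftAlgHom_mkAlgHom_apply (S := K) (TensorAlgebra.lift K φ) (s := Rel 𝒱) (by
    rintro _ _ ⟨hx, hy⟩
    rw [map_mul, Units.smul_def, map_zsmul, map_mul, ← Units.smul_def]
    simpa using hφ hx hy) (TensorAlgebra.ι K x)
  rw [TensorAlgebra.lift_ι_apply] at h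
  exact h

theorem algHom_ext {𝒱 : ℤ → Submodule K V} {C : Type*} [Ring C] [Algebra K C]
    {φ ψ : GSym 𝒱 →ₐ[K] C} (h : ∀ x, φ (ι 𝒱 x) = ψ (ι 𝒱 x)) : φ = ψ := by
  refine RingQuot.ringQuot_ext' K _ _ ?_
  refine TensorAlgebra.hom_ext ?_
  ext x
  exact h x

/-- The counit `S(V) → K`, with kernel `⨁_{n ≥ 1} V^{⊙n}`. -/
def counit (𝒱 : ℤ → Submodule K V) : GSym 𝒱 →ₐ[K] K :=
  lift 𝒱 0 (by simp)

/-- The natural projection `p : S(V) → V`, which vanishes on `V^{⊙n}` for `n ≠ 1`. It is the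
second component of the algebra morphism `S(V) → K ⊕ V` to the square-zero extension. -/
def proj (𝒱 : ℤ → Submodule K V) : GSym 𝒱 →ₗ[K] V :=
  letI : Module Kᵐᵒᵖ V := Module.compHom _ ((RingHom.id K).fromOpposite mul_comm)
  haveI : IsCentralScalar K V := ⟨fun _ _ => rfl⟩
  TrivSqZeroExt.sndHom K V ∘ₗ
    (lift 𝒱 (TrivSqZeroExt.inrHom K V) (by simp)).toLinearMap

/-- The elements of degree `k` of `S(V)`: spanned by the products `x₁ ⊙ ⋯ ⊙ xₙ` of homogeneous
elements with `|x₁| + ⋯ + |xₙ| = k`. -/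
def degree (𝒱 : ℤ → Submodule K V) (k : ℤ) : Submodule K (GSym 𝒱) :=
  Submodule.span K {a | ∃ l : List (Σ i, 𝒱 i),
    (l.map Sigma.fst).sum = k ∧ (l.map fun x => ι 𝒱 (x.2 : V)).prod = a}

theorem ι_mem_degree (𝒱 : ℤ → Submodule K V) {i : ℤ} {x : V} (hx : x ∈ 𝒱 i) :
    ι 𝒱 x ∈ degree 𝒱 i :=
  Submodule.subset_span ⟨[⟨i, ⟨x, hx⟩⟩], by simp, by simp⟩

instance instGradedMonoid (𝒱 : ℤ → Submodule K V) : SetLike.GradedMonoid (degree 𝒱) where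
  one_mem := Submodule.subset_span ⟨[], by simp, by simp⟩
  mul_mem := by
    intro i j a b ha hb
    have h : degree 𝒱 i * degree 𝒱 j ≤ degree 𝒱 (i + j) := by
      rw [degree, degree, Submodule.span_mul_span, Submodule.span_le]
      rintro _ ⟨_, ⟨l, rfl, rfl⟩, _, ⟨m, rfl, rfl⟩, rfl⟩
      exact Submodule.subset_span ⟨l ++ m, by simp, by simp⟩
    exact h (Submodule.mul_mem_mul ha hb)

/-- The inclusion `V → S(V)`, with values in the direct sum of the homogeneous components. -/
def decomposeι (𝒱 : ℤ → Submodule K V) [DirectSum.Decomposition 𝒱] :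
    V →ₗ[K] ⨁ i, degree 𝒱 i :=
  DirectSum.toModule K ℤ _ (fun i => DirectSum.lof K ℤ (fun i => degree 𝒱 i) i ∘ₗ
    ((ι 𝒱) ∘ₗ (𝒱 i).subtype).codRestrict (degree 𝒱 i) (fun x => ι_mem_degree 𝒱 x.2)) ∘ₗ
    (DirectSum.decomposeLinearEquiv 𝒱).toLinearMap

theorem decomposeι_apply (𝒱 : ℤ → Submodule K V) [DirectSum.Decomposition 𝒱] {i : ℤ} {x : V}
    (hx : x ∈ 𝒱 i) : decomposeι 𝒱 x =
      DirectSum.of (fun i => degree 𝒱 i) i ⟨ι 𝒱 x, ι_mem_degree 𝒱 hx⟩ := by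
  lift x to 𝒱 i using hx
  simp only [decomposeι, LinearMap.comp_apply, LinearEquiv.coe_coe,
    DirectSum.decomposeLinearEquiv_apply, DirectSum.decompose_coe]
  rw [← DirectSum.lof_eq_of K, DirectSum.toModule_lof]
  rfl

theorem of_eq_of {𝒱 : ℤ → Submodule K V} {i j : ℤ} (hij : i = j) {a : degree 𝒱 i}
    {b : degree 𝒱 j} (hab : (a : GSym 𝒱) = b) :
    DirectSum.of (fun i => degree 𝒱 i) i a = DirectSum.of (fun i => degree 𝒱 i) j b := by
  subst hij
  rw [Subtype.ext hab]

/-- The decomposition of `S(V)` into homogeneous components, as an algebra morphism. -/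
def decomposeHom (𝒱 : ℤ → Submodule K V) [DirectSum.Decomposition 𝒱] :
    GSym 𝒱 →ₐ[K] ⨁ i, degree 𝒱 i :=
  lift 𝒱 (C := ⨁ i, degree 𝒱 i) (decomposeι 𝒱) (by
    intro i j x y hx hy
    rw [decomposeι_apply 𝒱 hx, decomposeι_apply 𝒱 hy, DirectSum.of_mul_of, DirectSum.of_mul_of,
      Units.smul_def]
    refine Eq.trans ?_ (map_zsmul (DirectSum.of (fun i => degree 𝒱 i) (j + i)) _ _)
    refine of_eq_of (add_comm _ _) ?_
    have h := ι_mul_ι 𝒱 hx hy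
    rw [Units.smul_def] at h
    exact h)

theorem decomposeHom_apply (𝒱 : ℤ → Submodule K V) [DirectSum.Decomposition 𝒱] (i : ℤ)
    (a : degree 𝒱 i) : decomposeHom 𝒱 a = DirectSum.of (fun i => degree 𝒱 i) i a := by
  obtain ⟨a, ha⟩ := a
  have key : ∀ l : List (Σ i, 𝒱 i), ∀ h,
      decomposeHom 𝒱 ((l.map fun x => ι 𝒱 (x.2 : V)).prod) =
      DirectSum.of (fun i => degree 𝒱 i) (l.map Sigma.fst).sum
        ⟨(l.map fun x => ι 𝒱 (x.2 : V)).prod, h⟩ := by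
    intro l
    induction l with
    | nil => intro h; simp only [List.map_nil, List.prod_nil, map_one]; rfl
    | cons x l ih =>
      intro h
      have hl : (l.map fun x => ι 𝒱 (x.2 : V)).prod ∈ degree 𝒱 (l.map Sigma.fst).sum :=
        Submodule.subset_span ⟨l, rfl, rfl⟩
      simp only [List.map_cons, List.prod_cons, map_mul, ih hl]
      rw [decomposeHom, lift_ι, decomposeι_apply 𝒱 x.2.2, DirectSum.of_mul_of]
      exact of_eq_of rfl rfl
  induction ha using Submodule.span_induction with
  | mem a h => obtain ⟨l, rfl, rfl⟩ := h; exact key l _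
  | zero => rw [map_zero]; exact (map_zero _).symm
  | add a b ha hb iha ihb =>
    simp only at iha ihb ⊢
    rw [map_add, iha, ihb, ← map_add]; rfl
  | smul c a ha iha =>
    simp only at iha ⊢
    rw [map_smul, iha, ← DirectSum.lof_eq_of K, ← map_smul]; rfl

instance instGradedAlgebra (𝒱 : ℤ → Submodule K V) [DirectSum.Decomposition 𝒱] :
    GradedAlgebra (degree 𝒱) :=
  GradedAlgebra.ofAlgHom _ (decomposeHom 𝒱)
    (by
      refine algHom_ext fun x => ?_
      induction x using DirectSum.Decomposition.inductionOn 𝒱 with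
      | zero => simp
      | add _ _ h1 h2 => rw [map_add, map_add, map_add, h1, h2]
      | homogeneous x =>
        rw [AlgHom.comp_apply, decomposeHom, lift_ι, decomposeι_apply 𝒱 x.2,
          DirectSum.coeAlgHom_of]
        rfl)
    (decomposeHom_apply 𝒱)

/-- The comultiplication as an algebra morphism to the graded tensor product `S(V) ⊗ S(V)`
(with product `(a ⊗ b)(a' ⊗ b') = (-1)^(|b||a'|) aa' ⊗ bb'`), with `Δ x = x ⊗ 1 + 1 ⊗ x` for
`x ∈ V`. -/
def comulHom (𝒱 : ℤ → Submodule K V) [DirectSum.Decomposition 𝒱] :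
    GSym 𝒱 →ₐ[K] GradedTensorProduct K (degree 𝒱) (degree 𝒱) :=
  lift 𝒱 ((GradedTensorProduct.includeLeft (R := K) (degree 𝒱) (degree 𝒱)).toLinearMap ∘ₗ ι 𝒱 +
      (GradedTensorProduct.includeRight (R := K) (degree 𝒱) (degree 𝒱)).toLinearMap ∘ₗ ι 𝒱) (by
    intro i j x y hx hy
    have hsq : ((-1 : ℤˣ) ^ (i * j)) * ((-1 : ℤˣ) ^ (j * i)) = 1 := by
      rw [mul_comm j i]; exact Int.units_mul_self _
    have e1 : ∀ {i j : ℤ} {x y : V}, x ∈ 𝒱 i → y ∈ 𝒱 j →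
        GradedTensorProduct.includeRight (R := K) (degree 𝒱) (degree 𝒱) (ι 𝒱 x) *
          GradedTensorProduct.includeLeft (R := K) (degree 𝒱) (degree 𝒱) (ι 𝒱 y) =
        ((-1 : ℤˣ) ^ (i * j)) •
          (GradedTensorProduct.includeLeft (R := K) (degree 𝒱) (degree 𝒱) (ι 𝒱 y) *
          GradedTensorProduct.includeRight (R := K) (degree 𝒱) (degree 𝒱) (ι 𝒱 x)) := by
      intro i j x y hx hy
      have := GradedTensorProduct.tmul_coe_mul_coe_tmul (R := K) (degree 𝒱) (degree 𝒱) 1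
        ⟨ι 𝒱 x, ι_mem_degree 𝒱 hx⟩ ⟨ι 𝒱 y, ι_mem_degree 𝒱 hy⟩ 1
      have h2 := GradedTensorProduct.tmul_one_mul_one_tmul (R := K) (degree 𝒱) (degree 𝒱)
        (ι 𝒱 y) (ι 𝒱 x)
      simp only [one_mul, mul_one] at this
      simp only [GradedTensorProduct.includeLeft_apply, GradedTensorProduct.includeRight_apply]
      rw [h2]
      exact this
    simp only [LinearMap.add_apply, LinearMap.comp_apply, AlgHom.toLinearMap_apply, mul_add,
      add_mul, ← map_mul, smul_add]
    rw [e1 hx hy, e1 hy hx, ι_mul_ι 𝒱 hx hy, smul_smul, hsq, one_smul]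
    simp only [Units.smul_def, map_zsmul]
    abel)

/-- The unshuffle coproduct `Δ : S(V) → S(V) ⊗ S(V)`. -/
def comul (𝒱 : ℤ → Submodule K V) [DirectSum.Decomposition 𝒱] :
    GSym 𝒱 →ₗ[K] GSym 𝒱 ⊗[K] GSym 𝒱 :=
  (GradedTensorProduct.of K (degree 𝒱) (degree 𝒱)).symm.toLinearMap ∘ₗ
    (comulHom 𝒱).toLinearMap

/-! #### Linear maps out of `S(V)` given by graded symmetric multilinear maps -/

section Multilinear

variable {W : Type*} [AddCommGroup W] [Module K W]

/-- The linear map on the tensor algebra given by a family of multilinear maps. -/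
def tensorLift (M : ∀ n : ℕ, MultilinearMap K (fun _ : Fin n => V) W) :
    TensorAlgebra K V →ₗ[K] W :=
  DirectSum.toModule K ℕ W (fun n => PiTensorProduct.lift (M n)) ∘ₗ
    (TensorAlgebra.toDirectSum (R := K) (M := V)).toLinearMap

theorem tensorLift_ofFn (M : ∀ n : ℕ, MultilinearMap K (fun _ : Fin n => V) W) {n : ℕ}
    (x : Fin n → V) :
    tensorLift M (List.ofFn fun i => TensorAlgebra.ι K (x i)).prod = M n x := by
  rw [← TensorAlgebra.tprod_apply, tensorLift, LinearMap.comp_apply, AlgHom.toLinearMap_apply,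
    TensorAlgebra.toDirectSum_tensorPower_tprod, ← DirectSum.lof_eq_of K, DirectSum.toModule_lof,
    PiTensorProduct.lift.tprod]

theorem span_homogeneous (𝒱 : ℤ → Submodule K V) [DirectSum.Decomposition 𝒱] :
    Submodule.span K {a : TensorAlgebra K V | ∃ l : List (Σ i, 𝒱 i),
      (l.map fun x => TensorAlgebra.ι K (x.2 : V)).prod = a} = ⊤ := by
  rw [Submodule.eq_top_iff']
  intro a
  have hmul : ∀ a b : TensorAlgebra K V,
      a ∈ Submodule.span K {a : TensorAlgebra K V | ∃ l : List (Σ i, 𝒱 i),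
        (l.map fun x => TensorAlgebra.ι K (x.2 : V)).prod = a} →
      b ∈ Submodule.span K {a : TensorAlgebra K V | ∃ l : List (Σ i, 𝒱 i),
        (l.map fun x => TensorAlgebra.ι K (x.2 : V)).prod = a} →
      a * b ∈ Submodule.span K {a : TensorAlgebra K V | ∃ l : List (Σ i, 𝒱 i),
        (l.map fun x => TensorAlgebra.ι K (x.2 : V)).prod = a} := by
    intro a b ha hb
    have h := Submodule.mul_mem_mul ha hb
    rw [Submodule.span_mul_span] at h
    refine Submodule.span_mono ?_ h
    rintro _ ⟨_, ⟨l, rfl⟩, _, ⟨m, rfl⟩, rfl⟩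
    exact ⟨l ++ m, by simp⟩
  induction a using TensorAlgebra.induction with
  | algebraMap r =>
    rw [Algebra.algebraMap_eq_smul_one]
    exact Submodule.smul_mem _ _ (Submodule.subset_span ⟨[], by simp⟩)
  | ι x =>
    induction x using DirectSum.Decomposition.inductionOn 𝒱 with
    | zero => rw [map_zero]; exact Submodule.zero_mem _
    | add _ _ h1 h2 => rw [map_add]; exact Submodule.add_mem _ h1 h2
    | @homogeneous i x => exact Submodule.subset_span ⟨[⟨i, x⟩], by simp⟩
  | mul a b ha hb => exact hmul a b ha hb
  | add a b ha hb => exact Submodule.add_mem _ ha hb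

/-- Graded symmetry of a family of multilinear maps, under transpositions of neighbours. -/
def IsGradedSymmetric (𝒱 : ℤ → Submodule K V)
    (M : ∀ n : ℕ, MultilinearMap K (fun _ : Fin n => V) W) : Prop :=
  ∀ (n : ℕ) (p : Fin n → ℤ) (x : Fin n → V), (∀ i, x i ∈ 𝒱 (p i)) →
    ∀ a b : Fin n, (a : ℕ) + 1 = b →
      M n (fun i => x (Equiv.swap a b i)) = ((-1 : ℤˣ) ^ (p a * p b)) • M n x

theorem tensorLift_swap (𝒱 : ℤ → Submodule K V)
    (M : ∀ n : ℕ, MultilinearMap K (fun _ : Fin n => V) W) (hM : IsGradedSymmetric 𝒱 M)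
    (l m : List (Σ i, 𝒱 i)) (x y : Σ i, 𝒱 i) :
    tensorLift M (((l ++ x :: y :: m).map fun x => TensorAlgebra.ι K (x.2 : V)).prod) =
    ((-1 : ℤˣ) ^ (x.1 * y.1)) •
      tensorLift M (((l ++ y :: x :: m).map fun x => TensorAlgebra.ι K (x.2 : V)).prod) := by
  set L := l ++ y :: x :: m with hL
  have hlen : L.length = l.length + (m.length + 2) := by simp [hL]
  let a : Fin L.length := ⟨l.length, by omega⟩
  let b : Fin L.length := ⟨l.length + 1, by omega⟩
  have hLa : L.get a = y := by simp [hL, a]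
  have hLb : L.get b = x := by simp [hL, b]
  have h1 : (L.map fun x => TensorAlgebra.ι K (x.2 : V)) =
      List.ofFn fun i => TensorAlgebra.ι K ((L.get i).2 : V) := by
    refine List.ext_getElem (by simp) fun i h h' => by simp
  have h2 : ((l ++ x :: y :: m).map fun x => TensorAlgebra.ι K (x.2 : V)) =
      List.ofFn fun i => TensorAlgebra.ι K ((L.get (Equiv.swap a b i)).2 : V) := by
    refine List.ext_getElem (by simp [hL]; omega) fun i h h' => ?_
    have hi : i < L.length := by simpa using h'
    rw [List.getElem_map, List.getElem_ofFn]
    have hi' : i < (l ++ x :: y :: m).length := by simpa using h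
    suffices key : (l ++ x :: y :: m)[i] = L.get (Equiv.swap a b ⟨i, hi⟩) by rw [key]
    by_cases hia : i = l.length
    · have : (⟨i, hi⟩ : Fin L.length) = a := Fin.ext hia
      rw [this, Equiv.swap_apply_left, hLb]
      subst hia
      simp
    · by_cases hib : i = l.length + 1
      · have : (⟨i, hi⟩ : Fin L.length) = b := Fin.ext hib
        rw [this, Equiv.swap_apply_right, hLa]
        subst hib
        simp
      · rw [Equiv.swap_apply_of_ne_of_ne (fun e => hia (congrArg Fin.val e))
          (fun e => hib (congrArg Fin.val e)), List.get_eq_getElem]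
        simp only [hL]
        rcases lt_or_ge i l.length with hlt | hge
        · rw [List.getElem_append_left hlt, List.getElem_append_left hlt]
        · rw [List.getElem_append_right hge, List.getElem_append_right hge]
          obtain ⟨k, rfl⟩ : ∃ k, i = l.length + (k + 2) := ⟨i - l.length - 2, by omega⟩
          simp
  rw [h1, h2, tensorLift_ofFn, tensorLift_ofFn,
    hM _ (fun i => (L.get i).1) (fun i => ((L.get i).2 : V)) (fun i => (L.get i).2.2) a b rfl]
  rw [hLa, hLb, mul_comm]

theorem tensorLift_rel (𝒱 : ℤ → Submodule K V) [DirectSum.Decomposition 𝒱]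
    (M : ∀ n : ℕ, MultilinearMap K (fun _ : Fin n => V) W) (hM : IsGradedSymmetric 𝒱 M)
    {a b : TensorAlgebra K V} (h : RingQuot.Rel (Rel 𝒱) a b) :
    ∀ c d : TensorAlgebra K V, tensorLift M (c * a * d) = tensorLift M (c * b * d) := by
  induction h with
  | of h =>
    obtain ⟨hx, hy⟩ := h
    rename_i i j x y
    intro c d
    have hc : c ∈ (⊤ : Submodule K (TensorAlgebra K V)) := trivial
    have hd : d ∈ (⊤ : Submodule K (TensorAlgebra K V)) := trivial
    rw [← span_homogeneous 𝒱] at hc hd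
    induction hc using Submodule.span_induction with
    | zero => simp
    | add c c' _ _ h h' => rw [add_mul, add_mul, add_mul, add_mul, map_add, map_add, h, h']
    | smul r c _ h => rw [smul_mul_assoc, smul_mul_assoc, smul_mul_assoc, smul_mul_assoc, map_smul,
        map_smul, h]
    | mem c hc =>
      obtain ⟨l, rfl⟩ := hc
      induction hd using Submodule.span_induction with
      | zero => simp
      | add d d' _ _ h h' => rw [mul_add, mul_add, map_add, map_add, h, h']
      | smul r d _ h => rw [mul_smul_comm, mul_smul_comm, map_smul, map_smul, h]
      | mem d hd =>
        obtain ⟨m, rfl⟩ := hd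
        have h := tensorLift_swap 𝒱 M hM l m ⟨i, ⟨x, hx⟩⟩ ⟨j, ⟨y, hy⟩⟩
        rw [Units.smul_def, ← map_zsmul] at h
        rw [Units.smul_def, mul_smul_comm, smul_mul_assoc]
        simpa [mul_assoc] using h
  | add_left _ ih => intro c d; simp only [mul_add, add_mul, map_add, ih]
  | mul_left _ ih => intro c d; simpa only [mul_assoc] using ih c (_ * d)
  | mul_right _ ih => intro c d; simpa only [mul_assoc] using ih (c * _) d

/-- The linear map out of `S(V)` determined by graded symmetric multilinear maps. -/
def liftMultilinear (𝒱 : ℤ → Submodule K V) [DirectSum.Decomposition 𝒱]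
    (M : ∀ n : ℕ, MultilinearMap K (fun _ : Fin n => V) W) (hM : IsGradedSymmetric 𝒱 M) :
    GSym 𝒱 →ₗ[K] W :=
  letI F : GSym 𝒱 → W := fun a => Quot.lift (tensorLift M)
    (fun a b h => by simpa using tensorLift_rel 𝒱 M hM h 1 1) (RingQuot.toQuot a)
  haveI hF : ∀ a, F (mk 𝒱 a) = tensorLift M a := by
    intro a
    simp only [F, mk, RingQuot.mkAlgHom, RingQuot.mkRingHom]
    rfl
  { toFun := F
    map_add' := by
      intro a b
      obtain ⟨a, rfl⟩ := mk_surjective 𝒱 a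
      obtain ⟨b, rfl⟩ := mk_surjective 𝒱 b
      rw [← map_add, hF, hF, hF, map_add]
    map_smul' := by
      intro r a
      obtain ⟨a, rfl⟩ := mk_surjective 𝒱 a
      rw [← map_smul, hF, hF, map_smul]; rfl }

theorem liftMultilinear_mk (𝒱 : ℤ → Submodule K V) [DirectSum.Decomposition 𝒱]
    (M : ∀ n : ℕ, MultilinearMap K (fun _ : Fin n => V) W) (hM : IsGradedSymmetric 𝒱 M)
    (a : TensorAlgebra K V) : liftMultilinear 𝒱 M hM (mk 𝒱 a) = tensorLift M a := by
  simp only [liftMultilinear, mk, RingQuot.mkAlgHom, RingQuot.mkRingHom]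
  rfl

theorem liftMultilinear_monomial (𝒱 : ℤ → Submodule K V) [DirectSum.Decomposition 𝒱]
    (M : ∀ n : ℕ, MultilinearMap K (fun _ : Fin n => V) W) (hM : IsGradedSymmetric 𝒱 M)
    {n : ℕ} (x : Fin n → V) : liftMultilinear 𝒱 M hM (monomial 𝒱 x) = M n x := by
  rw [← tensorLift_ofFn, ← liftMultilinear_mk 𝒱 M hM, map_list_prod, List.map_ofFn]
  rfl

end Multilinear

/-! #### Extensions of maps from `V` to `S(V)` -/

/-- The morphism `S(f) : S(U) → S(V)`, `x₁ ⊙ ⋯ ⊙ xₙ ↦ f x₁ ⊙ ⋯ ⊙ f xₙ`, for `f` of degree 0. -/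
def map {U : Type*} [AddCommGroup U] [Module K U] {𝒰 : ℤ → Submodule K U}
    {𝒱 : ℤ → Submodule K V} (f : U →ₗ[K] V) (hf : HasDegree 𝒰 𝒱 0 f) : GSym 𝒰 →ₐ[K] GSym 𝒱 :=
  lift 𝒰 (ι 𝒱 ∘ₗ f) (by
    intro i j x y hx hy
    have h1 := hf i x hx
    have h2 := hf j y hy
    rw [add_zero] at h1 h2
    exact ι_mul_ι 𝒱 h1 h2)

theorem map_ι {U : Type*} [AddCommGroup U] [Module K U] {𝒰 : ℤ → Submodule K U}
    {𝒱 : ℤ → Submodule K V} (f : U →ₗ[K] V) (hf : HasDegree 𝒰 𝒱 0 f) (x : U) :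
    map f hf (ι 𝒰 x) = ι 𝒱 (f x) := by
  simp [map]

/-- The linear map `x ↦ ((-1)^|x| x, d x; 0, x)` from `V` to upper triangular matrices. -/
def derivMatrix (𝒱 : ℤ → Submodule K V) [DirectSum.Decomposition 𝒱] (d : V →ₗ[K] V) :
    V →ₗ[K] Matrix (Fin 2) (Fin 2) (GSym 𝒱) where
  toFun x := !![ι 𝒱 (signOp 𝒱 1 x), ι 𝒱 (d x); 0, ι 𝒱 x]
  map_add' x y := by ext i j; fin_cases i <;> fin_cases j <;> simp
  map_smul' r x := by ext i j; fin_cases i <;> fin_cases j <;> simp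

/-- The algebra morphism `a ↦ ((-1)^|a| a, D a; 0, a)`, where `D` is the derivation of degree 1
extending `d`. -/
def derivHom (𝒱 : ℤ → Submodule K V) [DirectSum.Decomposition 𝒱] (d : V →ₗ[K] V)
    (hd : HasDegree 𝒱 𝒱 1 d) : GSym 𝒱 →ₐ[K] Matrix (Fin 2) (Fin 2) (GSym 𝒱) :=
  lift 𝒱 (derivMatrix 𝒱 d) (by
    intro i j x y hx hy
    have e1 := ι_mul_ι 𝒱 hx hy
    have e2 := ι_mul_ι 𝒱 hx (hd j y hy)
    have e3 := ι_mul_ι 𝒱 (hd i x hx) hy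
    have s1 : ((-1 : ℤˣ) ^ (1 * i)) * ((-1 : ℤˣ) ^ (i * (j + 1))) = (-1 : ℤˣ) ^ (i * j) := by
      rw [one_mul, mul_add, mul_one, zpow_add, mul_comm, mul_assoc, Int.units_mul_self, mul_one]
    have s2 : (-1 : ℤˣ) ^ ((i + 1) * j) = ((-1 : ℤˣ) ^ (i * j)) * ((-1 : ℤˣ) ^ (1 * j)) := by
      rw [add_mul, zpow_add]
    have m1 : signOp 𝒱 1 x ∈ 𝒱 i := by
      rw [signOp_apply 𝒱 1 hx, Units.smul_def]; exact zsmul_mem hx _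
    have m2 : signOp 𝒱 1 y ∈ 𝒱 j := by
      rw [signOp_apply 𝒱 1 hy, Units.smul_def]; exact zsmul_mem hy _
    have e0 := ι_mul_ι 𝒱 m1 m2
    have e4 : ι 𝒱 (signOp 𝒱 1 x) * ι 𝒱 (d y) + ι 𝒱 (d x) * ι 𝒱 y = ((-1 : ℤˣ) ^ (i * j)) •
        (ι 𝒱 (signOp 𝒱 1 y) * ι 𝒱 (d x) + ι 𝒱 (d y) * ι 𝒱 x) := by
      have t1 : ι 𝒱 (signOp 𝒱 1 x) = ((-1 : ℤˣ) ^ (1 * i)) • ι 𝒱 x := by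
        rw [signOp_apply 𝒱 1 hx, Units.smul_def, map_zsmul, Units.smul_def]
      have t2 : ι 𝒱 (signOp 𝒱 1 y) = ((-1 : ℤˣ) ^ (1 * j)) • ι 𝒱 y := by
        rw [signOp_apply 𝒱 1 hy, Units.smul_def, map_zsmul, Units.smul_def]
      rw [t1, t2, smul_mul_assoc, smul_mul_assoc, e2, e3, smul_smul, s1, s2, smul_add, smul_smul,
        add_comm]
    ext a b
    rw [Units.smul_def] at e0 e1 e4 ⊢
    fin_cases a <;> fin_cases b
    · simpa [derivMatrix, Matrix.mul_apply] using e0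
    · simpa [derivMatrix, Matrix.mul_apply] using e4
    · simp [derivMatrix]
    · simpa [derivMatrix, Matrix.mul_apply] using e1)

/-- The linear coderivation of `S(V)` extending a map `d` of degree 1:
`x₁ ⊙ ⋯ ⊙ xₙ ↦ ∑ⱼ (-1)^(|x₁| + ⋯ + |x_{j-1}|) x₁ ⊙ ⋯ ⊙ d xⱼ ⊙ ⋯ ⊙ xₙ`. -/
def linearExt (𝒱 : ℤ → Submodule K V) [DirectSum.Decomposition 𝒱] (d : V →ₗ[K] V)
    (hd : HasDegree 𝒱 𝒱 1 d) : GSym 𝒱 →ₗ[K] GSym 𝒱 :=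
  Matrix.entryLinearMap K (GSym 𝒱) (0 : Fin 2) (1 : Fin 2) ∘ₗ (derivHom 𝒱 d hd).toLinearMap

theorem derivHom_lower (𝒱 : ℤ → Submodule K V) [DirectSum.Decomposition 𝒱] (d : V →ₗ[K] V)
    (hd : HasDegree 𝒱 𝒱 1 d) {k : ℤ} {a : GSym 𝒱} (ha : a ∈ degree 𝒱 k) :
    derivHom 𝒱 d hd a 0 0 = signOp (degree 𝒱) 1 a ∧ derivHom 𝒱 d hd a 1 0 = 0 ∧
      derivHom 𝒱 d hd a 1 1 = a := by
  rw [signOp_apply (degree 𝒱) 1 ha]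
  induction ha using Submodule.span_induction with
  | mem a h =>
    obtain ⟨l, rfl, rfl⟩ := h
    induction l with
    | nil => simp
    | cons x l ih =>
      obtain ⟨h1, h2, h3⟩ := ih
      have hx : ι 𝒱 (signOp 𝒱 1 (x.2 : V)) = ((-1 : ℤˣ) ^ x.1) • ι 𝒱 (x.2 : V) := by
        rw [signOp_apply 𝒱 1 x.2.2, Units.smul_def, map_zsmul, Units.smul_def, one_mul]
      simp only [List.map_cons, List.prod_cons, List.sum_cons, map_mul, Matrix.mul_apply,
        Fin.sum_univ_two, h1, h2, h3]
      simp [derivHom, derivMatrix, hx, zpow_add, smul_mul_assoc, mul_smul_comm, smul_smul, mul_comm]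
  | zero => simp
  | add a b _ _ iha ihb =>
    rw [map_add, Matrix.add_apply, Matrix.add_apply, Matrix.add_apply, iha.1, ihb.1, iha.2.1,
      ihb.2.1, iha.2.2, ihb.2.2, smul_add]
    simp
  | smul c a _ iha =>
    rw [map_smul, Matrix.smul_apply, Matrix.smul_apply, Matrix.smul_apply, iha.1, iha.2.1, iha.2.2,
      smul_comm]
    simp

theorem linearExt_ι (𝒱 : ℤ → Submodule K V) [DirectSum.Decomposition 𝒱] (d : V →ₗ[K] V)
    (hd : HasDegree 𝒱 𝒱 1 d) (x : V) : linearExt 𝒱 d hd (ι 𝒱 x) = ι 𝒱 (d x) := by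
  simp [linearExt, derivHom, derivMatrix]

theorem linearExt_mul (𝒱 : ℤ → Submodule K V) [DirectSum.Decomposition 𝒱] (d : V →ₗ[K] V)
    (hd : HasDegree 𝒱 𝒱 1 d) (a b : GSym 𝒱) : linearExt 𝒱 d hd (a * b) =
      linearExt 𝒱 d hd a * b + signOp (degree 𝒱) 1 a * linearExt 𝒱 d hd b := by
  induction a using DirectSum.Decomposition.inductionOn (degree 𝒱) with
  | zero => simp
  | add a a' h h' => rw [add_mul, map_add, map_add, map_add, h, h', add_mul, add_mul]; abel
  | homogeneous a =>
    induction b using DirectSum.Decomposition.inductionOn (degree 𝒱) with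
    | zero => simp
    | add b b' h h' => rw [mul_add, map_add, map_add, h, h', mul_add, mul_add]; abel
    | homogeneous b =>
      have ha := derivHom_lower 𝒱 d hd a.2
      have hb := derivHom_lower 𝒱 d hd b.2
      simp only [linearExt, LinearMap.comp_apply, AlgHom.toLinearMap_apply,
        Matrix.entryLinearMap_apply, map_mul, Matrix.mul_apply, Fin.sum_univ_two, ha.1, hb.2.2]
      rw [add_comm]

/-- The factor number `i` in the summand number `j` of the symmetrized tensor trick: `φ` before
position `j`, `h` at position `j`, the identity after position `j`. -/
def trickFactor {n : ℕ} (φ h : V →ₗ[K] V) (j i : Fin n) : V →ₗ[K] V :=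
  if i < j then φ else if i = j then h else LinearMap.id

/-- The symmetrized tensor trick on tensors of length `n`. -/
def trickMultilinear (𝒱 : ℤ → Submodule K V) [DirectSum.Decomposition 𝒱] (φ h : V →ₗ[K] V)
    (n : ℕ) : MultilinearMap K (fun _ : Fin n => V) (GSym 𝒱) :=
  (MultilinearMap.fromDirectSumEquiv (ι := Fin n) (κ := fun _ => ℤ) (R := K)
    (M := fun _ i => 𝒱 i) (fun p =>
      ((Nat.factorial n : K)⁻¹) • ∑ σ : Equiv.Perm (Fin n), ∑ j : Fin n,
        (koszulSign p σ * (-1 : ℤˣ) ^ (∑ i with i < j, p (σ i))) •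
          (((MultilinearMap.mkPiAlgebraFin K n (GSym 𝒱)).compLinearMap
            (fun i => ι 𝒱 ∘ₗ trickFactor φ h j i)).domDomCongr σ).compLinearMap
            (fun i => (𝒱 (p i)).subtype))).compLinearMap
    (fun _ => (DirectSum.decomposeLinearEquiv 𝒱).toLinearMap)

theorem trickMultilinear_apply (𝒱 : ℤ → Submodule K V) [DirectSum.Decomposition 𝒱]
    (φ h : V →ₗ[K] V) {n : ℕ} (p : Fin n → ℤ) (x : Fin n → V) (hx : ∀ i, x i ∈ 𝒱 (p i)) :
    trickMultilinear 𝒱 φ h n x =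
      ((Nat.factorial n : K)⁻¹) • ∑ σ : Equiv.Perm (Fin n), ∑ j : Fin n,
        (koszulSign p σ * (-1 : ℤˣ) ^ (∑ i with i < j, p (σ i))) •
          monomial 𝒱 (fun i => trickFactor φ h j i (x (σ i))) := by
  lift x to ∀ i, 𝒱 (p i) using hx
  rw [trickMultilinear, MultilinearMap.compLinearMap_apply]
  simp only [LinearEquiv.coe_coe, DirectSum.decomposeLinearEquiv_apply, DirectSum.decompose_coe]
  simp only [← DirectSum.lof_eq_of K]
  rw [MultilinearMap.fromDirectSumEquiv_lof]
  simp only [Units.smul_def]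
  simp [monomial]

theorem trickMultilinear_symm (𝒱 : ℤ → Submodule K V) [DirectSum.Decomposition 𝒱]
    (φ h : V →ₗ[K] V) : IsGradedSymmetric 𝒱 (trickMultilinear 𝒱 φ h) := by
  intro n p x hx a b hab
  rw [trickMultilinear_apply 𝒱 φ h (fun i => p (Equiv.swap a b i)) _ (fun i => hx _),
    trickMultilinear_apply 𝒱 φ h p x hx, ← Equiv.sum_comp (Equiv.mulLeft (Equiv.swap a b))
      (fun σ => ∑ j : Fin n, (koszulSign p σ * (-1 : ℤˣ) ^ (∑ i with i < j, p (σ i))) •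
          monomial 𝒱 (fun i => trickFactor φ h j i (x (σ i)))), smul_comm]
  congr 1
  rw [Finset.smul_sum]
  refine Finset.sum_congr rfl fun σ _ => ?_
  rw [Finset.smul_sum]
  refine Finset.sum_congr rfl fun j _ => ?_
  simp only [Equiv.coe_mulLeft, koszulSign_mul, koszulSign_swap p a b hab, smul_smul,
    Equiv.Perm.mul_apply]
  congr 1
  rw [← mul_assoc, ← mul_assoc, Int.units_mul_self, one_mul]

/-- The homotopy given by the symmetrized tensor trick, where `φ` has degree 0 and `h` has degree
`-1`; it vanishes on the unit. See `symTrick_monomial` for the explicit formula. -/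
def symTrick (𝒱 : ℤ → Submodule K V) [DirectSum.Decomposition 𝒱] (φ h : V →ₗ[K] V) :
    GSym 𝒱 →ₗ[K] GSym 𝒱 :=
  liftMultilinear 𝒱 (trickMultilinear 𝒱 φ h) (trickMultilinear_symm 𝒱 φ h)

theorem symTrick_monomial (𝒱 : ℤ → Submodule K V) [DirectSum.Decomposition 𝒱]
    (φ h : V →ₗ[K] V) {n : ℕ} (p : Fin n → ℤ) (x : Fin n → V) (hx : ∀ i, x i ∈ 𝒱 (p i)) :
    symTrick 𝒱 φ h (monomial 𝒱 x) =
      ((Nat.factorial n : K)⁻¹) • ∑ σ : Equiv.Perm (Fin n), ∑ j : Fin n,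
        (koszulSign p σ * (-1 : ℤˣ) ^ (∑ i with i < j, p (σ i))) •
          monomial 𝒱 (fun i => trickFactor φ h j i (x (σ i))) := by
  rw [symTrick, liftMultilinear_monomial, trickMultilinear_apply 𝒱 φ h p x hx]

end GSym

end GSym

/-! ### Contractions and the perturbation formulas -/

section Contraction

variable {K : Type*} [Field K] {A B : Type*} [AddCommGroup A] [Module K A]
  [AddCommGroup B] [Module K B]

/-- `(σ, τ, h)` is a contraction of the complex `(A, dA)` onto the complex `(B, dB)`. -/
structure IsContraction (𝒜 : ℤ → Submodule K A) (ℬ : ℤ → Submodule K B)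
    (dA : A →ₗ[K] A) (dB : B →ₗ[K] B) (σ : A →ₗ[K] B) (τ : B →ₗ[K] A) (h : A →ₗ[K] A) :
    Prop where
  dA_deg : HasDegree 𝒜 𝒜 1 dA
  dA_sq : dA ∘ₗ dA = 0
  dB_deg : HasDegree ℬ ℬ 1 dB
  dB_sq : dB ∘ₗ dB = 0
  σ_deg : HasDegree 𝒜 ℬ 0 σ
  σ_comm : σ ∘ₗ dA = dB ∘ₗ σ
  τ_deg : HasDegree ℬ 𝒜 0 τ
  τ_comm : τ ∘ₗ dB = dA ∘ₗ τ
  h_deg : HasDegree 𝒜 𝒜 (-1) h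
  σ_τ : σ ∘ₗ τ = LinearMap.id
  homotopy : h ∘ₗ dA + dA ∘ₗ h = τ ∘ₗ σ - LinearMap.id
  σ_h : σ ∘ₗ h = 0
  h_τ : h ∘ₗ τ = 0
  h_h : h ∘ₗ h = 0

open Classical in
/-- The sum `∑ₙ uₙ` of a sequence of linear maps of which, at each element, only finitely many
terms are non-zero (and `0` for a sequence without this property). -/
def locallyFiniteSum (u : ℕ → (A →ₗ[K] B)) : A →ₗ[K] B :=
  if hu : ∀ a, (Function.support fun n => u n a).Finite then
    { toFun := fun a => ∑ᶠ n, u n a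
      map_add' := fun a b => by simp only [map_add]; exact finsum_add_distrib (hu a) (hu b)
      map_smul' := fun r a => by simp only [map_smul, RingHom.id_apply]; exact (smul_finsum' r (hu a)).symm }
  else 0

/-- The perturbed differential `dB + ∑_{n ≥ 0} σ δ (h δ)ⁿ τ`. -/
def perturbedDifferential (dB : B →ₗ[K] B) (σ : A →ₗ[K] B) (τ : B →ₗ[K] A) (h δ : A →ₗ[K] A) :
    B →ₗ[K] B :=
  dB + locallyFiniteSum fun n => σ ∘ₗ δ ∘ₗ ((h ∘ₗ δ) ^ n : Module.End K A) ∘ₗ τ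

/-- The perturbed projection `∑_{n ≥ 0} σ (δ h)ⁿ`. -/
def perturbedProjection (σ : A →ₗ[K] B) (h δ : A →ₗ[K] A) : A →ₗ[K] B :=
  locallyFiniteSum fun n => σ ∘ₗ ((δ ∘ₗ h) ^ n : Module.End K A)

/-- The perturbed inclusion `∑_{n ≥ 0} (h δ)ⁿ τ`. -/
def perturbedInclusion (τ : B →ₗ[K] A) (h δ : A →ₗ[K] A) : B →ₗ[K] A :=
  locallyFiniteSum fun n => ((h ∘ₗ δ) ^ n : Module.End K A) ∘ₗ τ

/-- The perturbed homotopy `∑_{n ≥ 0} (h δ)ⁿ h`. -/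
def perturbedHomotopy (h δ : A →ₗ[K] A) : A →ₗ[K] A :=
  locallyFiniteSum fun n => ((h ∘ₗ δ) ^ n : Module.End K A) ∘ₗ h

/-- The series of the perturbation formulas converge: `h δ` and `δ h` are locally nilpotent. -/
def PerturbationConverges (h δ : A →ₗ[K] A) : Prop :=
  ∀ a, ∃ N, ∀ n ≥ N, ((h ∘ₗ δ) ^ n : Module.End K A) a = 0 ∧
    ((δ ∘ₗ h) ^ n : Module.End K A) a = 0

end Contraction

/-- A semifull DG algebra contraction of graded algebras with differentials, where the
differential of the first one is a derivation. -/
structure IsSemifullDGAlgebraContraction {K : Type*} [Field K] {A B : Type*} [Ring A] [Algebra K A]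
    [Ring B] [Algebra K B] (𝒜 : ℤ → Submodule K A) [DirectSum.Decomposition 𝒜]
    (ℬ : ℤ → Submodule K B) (dA : A →ₗ[K] A) (dB : B →ₗ[K] B)
    (σ : A →ₗ[K] B) (τ : B →ₗ[K] A) (h : A →ₗ[K] A) : Prop extends
    IsContraction 𝒜 ℬ dA dB σ τ h where
  dA_one : dA 1 = 0
  dB_one : dB 1 = 0
  dA_mul : ∀ a b, dA (a * b) = dA a * b + signOp 𝒜 1 a * dA b
  h_h_mul_h : ∀ a b, h (h a * h b) = 0
  h_h_mul_τ : ∀ a x, h (h a * τ x) = 0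
  h_τ_mul_τ : ∀ x y, h (τ x * τ y) = 0
  h_one : h 1 = 0
  σ_h_mul_h : ∀ a b, σ (h a * h b) = 0
  σ_h_mul_τ : ∀ a x, σ (h a * τ x) = 0
  σ_τ_mul_τ : ∀ x y, σ (τ x * τ y) = x * y
  σ_one : σ 1 = 1

/-! ### Coderivations, coalgebra morphisms and `L∞[1]` algebras -/

section LInfty

open GSym

variable {K : Type*} [Field K] {U V : Type*} [AddCommGroup U] [Module K U]
  [AddCommGroup V] [Module K V]

/-- `Q` is a coderivation of degree `k` of the coalgebra `S(V)`:
`Δ Q = (Q ⊗ id + id ⊗ Q) Δ`. -/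
structure IsCoderivation (𝒱 : ℤ → Submodule K V) [DirectSum.Decomposition 𝒱] (k : ℤ)
    (Q : GSym 𝒱 →ₗ[K] GSym 𝒱) : Prop where
  deg : HasDegree (degree 𝒱) (degree 𝒱) k Q
  comul_comp : comul 𝒱 ∘ₗ Q =
    (koszulTensor (degree 𝒱) 0 Q LinearMap.id + koszulTensor (degree 𝒱) k LinearMap.id Q) ∘ₗ
      comul 𝒱

/-- `F` is a morphism of graded (counital, coaugmented) coalgebras. -/
structure IsCoalgebraMorphism (𝒰 : ℤ → Submodule K U) [DirectSum.Decomposition 𝒰]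
    (𝒱 : ℤ → Submodule K V) [DirectSum.Decomposition 𝒱] (F : GSym 𝒰 →ₗ[K] GSym 𝒱) : Prop where
  deg : HasDegree (degree 𝒰) (degree 𝒱) 0 F
  map_one : F 1 = 1
  counit_comp : (counit 𝒱).toLinearMap ∘ₗ F = (counit 𝒰).toLinearMap
  comul_comp : comul 𝒱 ∘ₗ F = koszulTensor (degree 𝒰) 0 F F ∘ₗ comul 𝒰

/-- A semifull DG coalgebra contraction of `S(U)` onto `S(V)`, where the differential of `S(U)` is
a coderivation. -/
structure IsSemifullDGCoalgebraContraction (𝒰 : ℤ → Submodule K U) [DirectSum.Decomposition 𝒰]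
    (𝒱 : ℤ → Submodule K V) [DirectSum.Decomposition 𝒱]
    (dC : GSym 𝒰 →ₗ[K] GSym 𝒰) (dD : GSym 𝒱 →ₗ[K] GSym 𝒱)
    (σ : GSym 𝒰 →ₗ[K] GSym 𝒱) (τ : GSym 𝒱 →ₗ[K] GSym 𝒰) (h : GSym 𝒰 →ₗ[K] GSym 𝒰) :
    Prop extends IsContraction (degree 𝒰) (degree 𝒱) dC dD σ τ h where
  dC_one : dC 1 = 0
  counit_dC : (counit 𝒰).toLinearMap ∘ₗ dC = 0
  dD_one : dD 1 = 0
  counit_dD : (counit 𝒱).toLinearMap ∘ₗ dD = 0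
  dC_coderivation : IsCoderivation 𝒰 1 dC
  σ_one : σ 1 = 1
  counit_σ : (counit 𝒱).toLinearMap ∘ₗ σ = (counit 𝒰).toLinearMap
  τ_one : τ 1 = 1
  counit_τ : (counit 𝒰).toLinearMap ∘ₗ τ = (counit 𝒱).toLinearMap
  h_one : h 1 = 0
  counit_h : (counit 𝒰).toLinearMap ∘ₗ h = 0
  h_h_comul_h : koszulTensor (degree 𝒰) (-1) h h ∘ₗ comul 𝒰 ∘ₗ h = 0
  h_σ_comul_h : koszulTensor (degree 𝒰) 0 h σ ∘ₗ comul 𝒰 ∘ₗ h = 0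
  σ_σ_comul_h : koszulTensor (degree 𝒰) 0 σ σ ∘ₗ comul 𝒰 ∘ₗ h = 0
  h_h_comul_τ : koszulTensor (degree 𝒰) (-1) h h ∘ₗ comul 𝒰 ∘ₗ τ = 0
  h_σ_comul_τ : koszulTensor (degree 𝒰) 0 h σ ∘ₗ comul 𝒰 ∘ₗ τ = 0
  σ_σ_comul_τ : koszulTensor (degree 𝒰) 0 σ σ ∘ₗ comul 𝒰 ∘ₗ τ = comul 𝒱

/-- `Q` is an `L∞[1]` algebra structure on `V`: a coderivation of `S(V)` of degree 1 with `Q 1 = 0`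
and `Q² = 0`. -/
structure IsLInftyStructure (𝒱 : ℤ → Submodule K V) [DirectSum.Decomposition 𝒱]
    (Q : GSym 𝒱 →ₗ[K] GSym 𝒱) : Prop where
  coderivation : IsCoderivation 𝒱 1 Q
  map_one : Q 1 = 0
  sq_zero : Q ∘ₗ Q = 0

/-- `F` is an `L∞[1]` morphism `(U, Q) → (V, R)`: a morphism of DG coalgebras
`(S(U), Q) → (S(V), R)`. -/
structure IsLInftyMorphism (𝒰 : ℤ → Submodule K U) [DirectSum.Decomposition 𝒰]
    (𝒱 : ℤ → Submodule K V) [DirectSum.Decomposition 𝒱]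
    (Q : GSym 𝒰 →ₗ[K] GSym 𝒰) (R : GSym 𝒱 →ₗ[K] GSym 𝒱) (F : GSym 𝒰 →ₗ[K] GSym 𝒱) : Prop where
  coalgebraMorphism : IsCoalgebraMorphism 𝒰 𝒱 F
  comm : F ∘ₗ Q = R ∘ₗ F

/-- The Taylor coefficient `fₙ(x₁, …, xₙ) = p F (x₁ ⊙ ⋯ ⊙ xₙ)` of a map `F : S(U) → S(V)`. -/
def taylor {𝒰 : ℤ → Submodule K U} {𝒱 : ℤ → Submodule K V} (F : GSym 𝒰 →ₗ[K] GSym 𝒱) {n : ℕ}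
    (x : Fin n → U) : V :=
  proj 𝒱 (F (monomial 𝒰 x))

/-- The unshuffles of type `(i₁, …, i_k)`, for a composition `n = i₁ + ⋯ + i_k`: the permutations
that are increasing on each of the `k` consecutive blocks of lengths `i₁, …, i_k`. -/
def unshuffles {n : ℕ} (c : Composition n) : Set (Equiv.Perm (Fin n)) :=
  {σ | ∀ j : Fin c.length, StrictMono fun l : Fin (c.blocksFun j) => σ (c.embedding j l)}

open Classical in
/-- The right-hand side of the recursion for the Taylor coefficients,
`∑ ± (1/k!) h q_k(f_{i₁}(x_{σ 1}, …), …, f_{i_k}(…, x_{σ n}))`, for homogeneous `x₁, …, xₙ` of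
degrees `p₁, …, pₙ`; the sum is over all `k ≥ 2`, all `i₁ + ⋯ + i_k = n` with `i_j ≥ 1`, and all
`(i₁, …, i_k)`-unshuffles `σ`. -/
def transferRecursion {𝒰 : ℤ → Submodule K U} {𝒱 : ℤ → Submodule K V} (h : U →ₗ[K] U)
    (Q : GSym 𝒰 →ₗ[K] GSym 𝒰) (F : GSym 𝒱 →ₗ[K] GSym 𝒰) {n : ℕ} (p : Fin n → ℤ)
    (x : Fin n → V) : U :=
  ∑ c : Composition n with 2 ≤ c.length, ∑ σ : Equiv.Perm (Fin n) with σ ∈ unshuffles c,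
    koszulSign p σ • (Nat.factorial c.length : K)⁻¹ •
      h (taylor Q fun j : Fin c.length => taylor F fun l => x (σ (c.embedding j l)))

end LInfty

end HomotopyTransfer

end

open HomotopyTransfer

/-! Write φ = fg, σ = S(g), τ = S(f), δ = Q₊, and let d̃ be the linear coderivation extending d_U.
Two operators on S(U) carry the argument: L, the derivation of degree -1 extending h, and N, the
derivation of degree 0 extending id - φ. Derivations that extend a map of generators are determined
by that map, are also coderivations because generators are primitive, and are closed under graded
commutators. Hence L² = 0, Ld̃ + d̃L = -N, and N commutes with L and d̃, each identity being checked
on U only.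

On a product of vectors that are fixed or killed by φ, N counts the killed factors. So N is
diagonalizable with eigenvalues in ℕ, and in characteristic zero it has a pseudo-inverse P with PN =
id - τσ. A count of permutations shows ĥ = PL (`symTrick_eq`), so that ĥd̃ + d̃ĥ = -PN = τσ - id.
The semifull identities follow from L being both a derivation and a coderivation, together with Lĥ =
ĥL = 0, Lτ = 0 and σL = 0.

The coderivation δ has no constant or linear Taylor coefficient, hence lowers the length by one
(`coderivation_mem_filt`), while ĥ does not raise it. This gives local nilpotence, and the
contraction (G, F, H) is then the homological perturbation lemma (`isContraction_perturbed`).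

Compatibility of G and F with Δ needs a separate argument. Put B = Lδ + δL, a coderivation of degree
0 that lowers the length. The relations ĥN = L = Nĥ give GN = GB and NF = BF. The defect X = ΔG - (G
⊗ G)Δ therefore satisfies XN = XB and Xτ = 0; since a = τσa + NPa, also X = XBP, and X = 0 because
BP is locally nilpotent. Dually, each value of ΔF - (F ⊗ F)Δ is fixed by the locally nilpotent
operator P₂B₂, where N₂ and B₂ are induced by N and B on S(U) ⊗ S(U) and P₂ is the pseudo-inverse of
N₂. Then R = GQF is a coderivation.

For the recursion, pĥ = hp turns F = τ + ĥδF into pF = fp + hpδF. A coalgebra morphism is the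
convolution exponential of its corestriction (`IsCoalgebraMorphism.eq_sum`); on a monomial the
convolution powers are sums over colorings of the factors (`multiConv_monomial`), and the surjective
colorings are the unshuffles (`sum_unshuffles`). -/

noncomputable section

namespace HomotopyTransfer

/-! ### Signs with values in the ground field -/

section Signs

variable (K : Type*) [Field K]

/-- The sign `(-1)^n` as an element of the field `K`. -/
def ksign (n : ℤ) : K := ((((-1 : ℤˣ) ^ n : ℤˣ) : ℤ) : K)

variable {K}

/-- With signs in the field, linear maps and tensors treat them as ordinary scalars. -/
theorem units_smul_eq_ksign {A : Type*} [AddCommGroup A] [Module K A] (n : ℤ) (a : A) :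
    ((-1 : ℤˣ) ^ n) • a = ksign K n • a := by
  rw [Units.smul_def, ksign, Int.cast_smul_eq_zsmul]

theorem ksign_add (m n : ℤ) : ksign K (m + n) = ksign K m * ksign K n := by
  simp [ksign, zpow_add]

theorem ksign_even {n : ℤ} (hn : Even n) : ksign K n = 1 := by
  simp [ksign, hn.neg_one_zpow]

theorem ksign_odd {n : ℤ} (hn : Odd n) : ksign K n = -1 := by
  rw [ksign]
  obtain ⟨m, rfl⟩ := hn
  rw [zpow_add, (even_two_mul m).neg_one_zpow]
  simp

@[simp] theorem ksign_zero : ksign K 0 = 1 := ksign_even (by simp)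

@[simp] theorem ksign_one : ksign K 1 = -1 := ksign_odd (by simp)

@[simp] theorem ksign_neg (n : ℤ) : ksign K (-n) = ksign K n := by
  rcases Int.even_or_odd n with h | h
  · rw [ksign_even h, ksign_even h.neg]
  · rw [ksign_odd h, ksign_odd h.neg]

@[simp] theorem ksign_mul_self (n : ℤ) : ksign K n * ksign K n = 1 := by
  rcases Int.even_or_odd n with h | h
  · rw [ksign_even h]; simp
  · rw [ksign_odd h]; simp

theorem ksign_congr {m n : ℤ} (h : Even (m - n)) : ksign K m = ksign K n := by
  have : m = n + (m - n) := by ring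
  rw [this, ksign_add, ksign_even h, mul_one]

end Signs

/-! ### Homogeneous linear maps -/

section Degree

variable {K : Type*} [Field K] {A B : Type*} [AddCommGroup A] [Module K A]
  [AddCommGroup B] [Module K B] {𝒜 : ℤ → Submodule K A} {ℬ : ℤ → Submodule K B}

theorem HasDegree.congr {f : A →ₗ[K] B} {k l : ℤ} (hf : HasDegree 𝒜 ℬ k f) (h : k = l) :
    HasDegree 𝒜 ℬ l f := h ▸ hf

theorem HasDegree.comp {C : Type*} [AddCommGroup C] [Module K C] {𝒞 : ℤ → Submodule K C}
    {k l : ℤ} {g : B →ₗ[K] C} {f : A →ₗ[K] B} (hg : HasDegree ℬ 𝒞 l g) (hf : HasDegree 𝒜 ℬ k f) :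
    HasDegree 𝒜 𝒞 (k + l) (g ∘ₗ f) := fun i x hx => by
  rw [← add_assoc]; exact hg _ _ (hf i x hx)

theorem HasDegree.add {k : ℤ} {f g : A →ₗ[K] B} (hf : HasDegree 𝒜 ℬ k f)
    (hg : HasDegree 𝒜 ℬ k g) : HasDegree 𝒜 ℬ k (f + g) := fun i x hx =>
  Submodule.add_mem _ (hf i x hx) (hg i x hx)

theorem HasDegree.sub {k : ℤ} {f g : A →ₗ[K] B} (hf : HasDegree 𝒜 ℬ k f)
    (hg : HasDegree 𝒜 ℬ k g) : HasDegree 𝒜 ℬ k (f - g) := fun i x hx =>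
  Submodule.sub_mem _ (hf i x hx) (hg i x hx)

theorem HasDegree.smul {k : ℤ} {f : A →ₗ[K] B} (hf : HasDegree 𝒜 ℬ k f) (c : K) :
    HasDegree 𝒜 ℬ k (c • f) := fun i x hx => Submodule.smul_mem _ _ (hf i x hx)

theorem hasDegree_zero_map (k : ℤ) : HasDegree 𝒜 ℬ k (0 : A →ₗ[K] B) := fun _ _ _ =>
  Submodule.zero_mem _

theorem hasDegree_id : HasDegree 𝒜 𝒜 0 (LinearMap.id : A →ₗ[K] A) := fun i x hx => by
  rw [add_zero]; exact hx

end Degree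

/-! ### Sign operators and their commutation with homogeneous maps -/

section SignOp

variable {K : Type*} [Field K] {A B : Type*} [AddCommGroup A] [Module K A]
  [AddCommGroup B] [Module K B]
variable (𝒜 : ℤ → Submodule K A) [DirectSum.Decomposition 𝒜]
variable (ℬ : ℤ → Submodule K B) [DirectSum.Decomposition ℬ]

/-- Linear maps that agree on homogeneous elements are equal. -/
theorem linearMap_ext_homogeneous {f g : A →ₗ[K] B} (h : ∀ i, ∀ x ∈ 𝒜 i, f x = g x) : f = g := by
  ext x
  induction x using DirectSum.Decomposition.inductionOn 𝒜 with
  | zero => simp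
  | homogeneous x => exact h _ _ x.2
  | add x y hx hy => rw [map_add, map_add, hx, hy]

theorem signOp_eq_ksign_smul (k : ℤ) {i : ℤ} {x : A} (hx : x ∈ 𝒜 i) :
    signOp 𝒜 k x = ksign K (k * i) • x := by
  rw [signOp_apply 𝒜 k hx, units_smul_eq_ksign (K := K)]

@[simp] theorem signOp_zero : signOp 𝒜 0 = LinearMap.id :=
  linearMap_ext_homogeneous 𝒜 fun i x hx => by simp [signOp_eq_ksign_smul 𝒜 0 hx]

theorem signOp_comp_signOp (k l : ℤ) : signOp 𝒜 k ∘ₗ signOp 𝒜 l = signOp 𝒜 (k + l) :=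
  linearMap_ext_homogeneous 𝒜 fun i x hx => by
    rw [LinearMap.comp_apply, signOp_eq_ksign_smul 𝒜 l hx, map_smul, signOp_eq_ksign_smul 𝒜 k hx,
      signOp_eq_ksign_smul 𝒜 _ hx, smul_smul, ← ksign_add, add_comm, add_mul]

variable {𝒜 ℬ}

/-- A map of degree `e` commutes with the sign operators up to a sign. -/
theorem HasDegree.signOp_comp {e : ℤ} {f : A →ₗ[K] B} (hf : HasDegree 𝒜 ℬ e f) (k : ℤ) :
    signOp ℬ k ∘ₗ f = ksign K (k * e) • (f ∘ₗ signOp 𝒜 k) :=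
  linearMap_ext_homogeneous 𝒜 fun i x hx => by
    rw [LinearMap.comp_apply, LinearMap.smul_apply, LinearMap.comp_apply,
      signOp_eq_ksign_smul ℬ k (hf i x hx), signOp_eq_ksign_smul 𝒜 k hx, map_smul, smul_smul,
      ← ksign_add, mul_add, add_comm]

theorem HasDegree.signOp_comm {f : A →ₗ[K] B} (hf : HasDegree 𝒜 ℬ 0 f) (k : ℤ) :
    signOp ℬ k ∘ₗ f = f ∘ₗ signOp 𝒜 k := by
  rw [hf.signOp_comp]; simp

end SignOp

/-! ### Coderivation operators on a tensor square -/

section TensorSquare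

variable {K : Type*} [Field K] {A B : Type*} [AddCommGroup A] [Module K A]
  [AddCommGroup B] [Module K B]
variable (𝒜 : ℤ → Submodule K A) [DirectSum.Decomposition 𝒜]
variable (ℬ : ℤ → Submodule K B) [DirectSum.Decomposition ℬ]

/-- The operator `D ⊗ id + id ⊗ D` on `A ⊗ A`, for `D` of degree `k`. -/
def tensorDeriv (k : ℤ) (D : A →ₗ[K] A) : A ⊗[K] A →ₗ[K] A ⊗[K] A :=
  koszulTensor 𝒜 0 D LinearMap.id + koszulTensor 𝒜 k LinearMap.id D

theorem koszulTensor_zero {A' B' : Type*} [AddCommGroup A'] [Module K A'] [AddCommGroup B']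
    [Module K B'] (f : A →ₗ[K] A') (g : B →ₗ[K] B') :
    koszulTensor 𝒜 0 f g = TensorProduct.map f g := by
  simp [koszulTensor]

theorem tensorDeriv_eq (k : ℤ) (D : A →ₗ[K] A) :
    tensorDeriv 𝒜 k D = TensorProduct.map D LinearMap.id + TensorProduct.map (signOp 𝒜 k) D := by
  simp [tensorDeriv, koszulTensor]

theorem tensorDeriv_tmul (k : ℤ) (D : A →ₗ[K] A) (a b : A) :
    tensorDeriv 𝒜 k D (a ⊗ₜ b) = D a ⊗ₜ b + signOp 𝒜 k a ⊗ₜ D b := by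
  simp [tensorDeriv_eq]

theorem tensorDeriv_sub (k : ℤ) (D E : A →ₗ[K] A) :
    tensorDeriv 𝒜 k (D - E) = tensorDeriv 𝒜 k D - tensorDeriv 𝒜 k E := by
  refine TensorProduct.ext' fun a b => ?_
  simp only [tensorDeriv_tmul, LinearMap.sub_apply, TensorProduct.sub_tmul, TensorProduct.tmul_sub]
  abel

/-- `D ↦ D ⊗ id + id ⊗ D` respects graded commutators. -/
theorem tensorDeriv_comm {k l : ℤ} {D E : A →ₗ[K] A} (hD : HasDegree 𝒜 𝒜 k D)
    (hE : HasDegree 𝒜 𝒜 l E) :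
    tensorDeriv 𝒜 k D ∘ₗ tensorDeriv 𝒜 l E -
      ksign K (k * l) • (tensorDeriv 𝒜 l E ∘ₗ tensorDeriv 𝒜 k D) =
    tensorDeriv 𝒜 (k + l) (D ∘ₗ E - ksign K (k * l) • (E ∘ₗ D)) := by
  refine TensorProduct.ext' fun a b => ?_
  have h1 : signOp 𝒜 k (E a) = ksign K (k * l) • E (signOp 𝒜 k a) :=
    congrArg (fun f => f a) (hE.signOp_comp k)
  have h2 : signOp 𝒜 l (D a) = ksign K (k * l) • D (signOp 𝒜 l a) := by
    rw [mul_comm]; exact congrArg (fun f => f a) (hD.signOp_comp l)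
  have h3 : signOp 𝒜 k (signOp 𝒜 l a) = signOp 𝒜 (k + l) a :=
    congrArg (fun f => f a) (signOp_comp_signOp 𝒜 k l)
  have h4 : signOp 𝒜 l (signOp 𝒜 k a) = signOp 𝒜 (k + l) a := by
    rw [add_comm]; exact congrArg (fun f => f a) (signOp_comp_signOp 𝒜 l k)
  simp only [LinearMap.sub_apply, LinearMap.smul_apply, LinearMap.comp_apply, tensorDeriv_tmul,
    map_add, h1, h2, h3, h4, TensorProduct.sub_tmul, TensorProduct.tmul_sub,
    TensorProduct.smul_tmul', TensorProduct.tmul_smul, smul_add, smul_smul, ksign_mul_self,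
    one_smul]
  abel

variable {𝒜 ℬ}

/-- Since `F` has degree 0 it passes the sign operators without a Koszul sign. -/
theorem HasDegree.tensor_comp_tensorDeriv {k : ℤ} {F : A →ₗ[K] B} (hF : HasDegree 𝒜 ℬ 0 F)
    {D : A →ₗ[K] A} {E : B →ₗ[K] B} (h : F ∘ₗ D = E ∘ₗ F) :
    TensorProduct.map F F ∘ₗ tensorDeriv 𝒜 k D = tensorDeriv ℬ k E ∘ₗ TensorProduct.map F F := by
  refine TensorProduct.ext' fun a b => ?_
  have h1 : signOp ℬ k (F a) = F (signOp 𝒜 k a) := congrArg (fun f => f a) (hF.signOp_comm k)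
  have h2 : ∀ a, F (D a) = E (F a) := fun a => congrArg (fun f => f a) h
  simp [tensorDeriv_tmul, h1, h2]

end TensorSquare

/-! ### Induction on the graded symmetric algebra -/

namespace GSym

section Induction

variable {K : Type*} [Field K] {V : Type*} [AddCommGroup V] [Module K V]
  {𝒱 : ℤ → Submodule K V} [DirectSum.Decomposition 𝒱]

/-- Products of homogeneous generators span, so adding one homogeneous factor on the left is the
only induction step. -/
theorem mem_of_ι_mul_mem {M : Submodule K (GSym 𝒱)} (h1 : 1 ∈ M)
    (hι : ∀ i, ∀ x ∈ 𝒱 i, ∀ b ∈ M, ι 𝒱 x * b ∈ M) (a : GSym 𝒱) : a ∈ M := by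
  obtain ⟨a, rfl⟩ := mk_surjective 𝒱 a
  suffices h : (⊤ : Submodule K (TensorAlgebra K V)) ≤ M.comap (mk 𝒱).toLinearMap from h trivial
  rw [← span_homogeneous 𝒱, Submodule.span_le]
  rintro _ ⟨l, rfl⟩
  induction l with
  | nil => simpa using h1
  | cons x l ih => simpa [mk_ι] using hι x.1 x.2 x.2.2 _ ih

/-- Linear maps out of `S(V)` that agree on `1`, and on `x ⊙ b` whenever they agree on `b`, are
equal. -/
theorem linearMap_ext {W : Type*} [AddCommGroup W] [Module K W] {A B : GSym 𝒱 →ₗ[K] W}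
    (h1 : A 1 = B 1)
    (hι : ∀ i, ∀ x ∈ 𝒱 i, ∀ b, A b = B b → A (ι 𝒱 x * b) = B (ι 𝒱 x * b)) : A = B := by
  ext a
  exact mem_of_ι_mul_mem (M := LinearMap.eqLocus A B) h1 hι a

omit [DirectSum.Decomposition 𝒱] in
/-- A criterion for a linear map out of `S(V)` to be homogeneous. -/
theorem hasDegree_of_ι_mul {W : Type*} [AddCommGroup W] [Module K W] {𝒲 : ℤ → Submodule K W}
    {k : ℤ} {A : GSym 𝒱 →ₗ[K] W} (h1 : A 1 ∈ 𝒲 k)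
    (hι : ∀ i, ∀ x ∈ 𝒱 i, ∀ j, ∀ b ∈ degree 𝒱 j, A b ∈ 𝒲 (j + k) →
      A (ι 𝒱 x * b) ∈ 𝒲 (i + j + k)) : HasDegree (degree 𝒱) 𝒲 k A := by
  intro j a ha
  refine (?_ : degree 𝒱 j ≤ (𝒲 (j + k)).comap A) ha
  clear ha a
  rw [degree, Submodule.span_le]
  rintro _ ⟨l, rfl, rfl⟩
  induction l with
  | nil => simpa using h1
  | cons x l ih =>
    have hl : (l.map fun x => ι 𝒱 (x.2 : V)).prod ∈ degree 𝒱 (l.map Sigma.fst).sum :=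
      Submodule.subset_span ⟨l, rfl, rfl⟩
    simpa using hι x.1 x.2 x.2.2 _ _ hl ih

end Induction

/-! ### Counit, projection to generators and coproduct -/

section Comul

variable {K : Type*} [Field K] {V : Type*} [AddCommGroup V] [Module K V]
  (𝒱 : ℤ → Submodule K V)

@[simp] theorem counit_ι (x : V) : counit 𝒱 (ι 𝒱 x) = 0 := by simp [counit]

theorem proj_one : proj 𝒱 1 = 0 := by
  -- The same right module structure as in the definition of `proj`, so that the `change` below
  -- holds by definition.
  let _ : Module Kᵐᵒᵖ V := Module.compHom _ ((RingHom.id K).fromOpposite mul_comm)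
  have : IsCentralScalar K V := ⟨fun _ _ => rfl⟩
  change (lift 𝒱 (TrivSqZeroExt.inrHom K V) (by simp) 1).snd = 0
  rw [map_one, TrivSqZeroExt.snd_one]

/-- In the square-zero extension (0, x)(c, y) = (0, cx), and the first component of the morphism
defining `proj` is the counit. -/
theorem proj_ι_mul (x : V) (a : GSym 𝒱) : proj 𝒱 (ι 𝒱 x * a) = counit 𝒱 a • x := by
  let _ : Module Kᵐᵒᵖ V := Module.compHom _ ((RingHom.id K).fromOpposite mul_comm)
  have : IsCentralScalar K V := ⟨fun _ _ => rfl⟩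
  have h : (TrivSqZeroExt.fstHom K K V).comp (lift 𝒱 (TrivSqZeroExt.inrHom K V) (by simp)) =
      counit 𝒱 := algHom_ext fun x => by simp
  simp only [proj, LinearMap.comp_apply, AlgHom.toLinearMap_apply, map_mul, lift_ι]
  rw [← h]
  simp

@[simp] theorem proj_ι (x : V) : proj 𝒱 (ι 𝒱 x) = x := by
  have := proj_ι_mul 𝒱 x 1
  simpa using this

theorem counit_eq_zero_of_mem_degree {i : ℤ} (hi : i ≠ 0) {a : GSym 𝒱} (ha : a ∈ degree 𝒱 i) :
    counit 𝒱 a = 0 := by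
  -- The field is graded with everything in degree 0, and the counit is a map of degree 0 into it.
  have h : HasDegree (degree 𝒱) (fun i => if i = 0 then (⊤ : Submodule K K) else ⊥) 0
      (counit 𝒱).toLinearMap := by
    refine hasDegree_of_ι_mul (by simp) fun i x _ j b _ _ => by simp
  simpa [hi] using h i a ha

variable [DirectSum.Decomposition 𝒱]

omit [DirectSum.Decomposition 𝒱] in
theorem hasDegree_proj : HasDegree (degree 𝒱) 𝒱 0 (proj 𝒱) := by
  refine hasDegree_of_ι_mul (by simp [proj_one]) fun i x hx j b hb _ => ?_
  rw [proj_ι_mul]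
  by_cases hj : j = 0
  · subst hj; simpa using Submodule.smul_mem _ _ hx
  · simp [counit_eq_zero_of_mem_degree 𝒱 hj hb]

omit [DirectSum.Decomposition 𝒱] in
theorem hasDegree_mulLeft_ι {i : ℤ} {x : V} (hx : x ∈ 𝒱 i) :
    HasDegree (degree 𝒱) (degree 𝒱) i (LinearMap.mulLeft K (ι 𝒱 x)) := fun j b hb => by
  rw [add_comm, LinearMap.mulLeft_apply]
  exact SetLike.mul_mem_graded (ι_mem_degree 𝒱 hx) hb

@[simp] theorem comul_one : comul 𝒱 1 = 1 ⊗ₜ 1 := by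
  simp only [comul, LinearMap.comp_apply, AlgHom.toLinearMap_apply, map_one]
  rfl

/-- The generators are primitive: multiplication by `x` is a coderivation. -/
theorem comul_ι_mul {i : ℤ} {x : V} (hx : x ∈ 𝒱 i) (b : GSym 𝒱) : comul 𝒱 (ι 𝒱 x * b) =
    tensorDeriv (degree 𝒱) i (LinearMap.mulLeft K (ι 𝒱 x)) (comul 𝒱 b) := by
  -- `comulHom` is multiplicative, so only the product of x ⊗ 1 + 1 ⊗ x with a tensor a ⊗ b is
  -- needed. Moving x past a gives the sign recorded by `signOp`.
  have key : ∀ u : GSym 𝒱 ⊗[K] GSym 𝒱,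
      (GradedTensorProduct.of K (degree 𝒱) (degree 𝒱)).symm (comulHom 𝒱 (ι 𝒱 x) *
        GradedTensorProduct.of K (degree 𝒱) (degree 𝒱) u) =
      tensorDeriv (degree 𝒱) i (LinearMap.mulLeft K (ι 𝒱 x)) u := by
    intro u
    induction u using TensorProduct.induction_on with
    | zero => simp
    | add u v hu hv => rw [map_add, mul_add, map_add, map_add, hu, hv]
    | tmul a b =>
      induction a using DirectSum.Decomposition.inductionOn (degree 𝒱) with
      | zero => simp
      | add a a' h h' => rw [TensorProduct.add_tmul, map_add, mul_add, map_add, map_add, h, h']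
      | @homogeneous j a =>
        have h1 := GradedTensorProduct.tmul_one_mul_coe_tmul (R := K) (degree 𝒱) (degree 𝒱)
          (ι 𝒱 x) a b
        have h2 := GradedTensorProduct.tmul_coe_mul_coe_tmul (R := K) (degree 𝒱) (degree 𝒱)
          1 ⟨ι 𝒱 x, ι_mem_degree 𝒱 hx⟩ a b
        rw [one_mul] at h2
        rw [comulHom, lift_ι, tensorDeriv_tmul, signOp_eq_ksign_smul _ _ a.2,
          ← units_smul_eq_ksign]
        simp only [LinearMap.add_apply, LinearMap.comp_apply, AlgHom.toLinearMap_apply,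
          GradedTensorProduct.includeLeft_apply, GradedTensorProduct.includeRight_apply, add_mul]
        refine (congrArg _ (congrArg₂ (· + ·) h1 h2)).trans ?_
        rw [map_add, Units.smul_def, map_zsmul, Units.smul_def, ← Int.cast_smul_eq_zsmul K,
          ← Int.cast_smul_eq_zsmul K, ← TensorProduct.smul_tmul']
        rfl
  rw [← key]
  simp only [comul, LinearMap.comp_apply, AlgHom.toLinearMap_apply, map_mul, LinearEquiv.coe_coe]
  rfl

end Comul

end GSym

namespace GSym

/-! ### Convolution -/

section Conv

variable {K : Type*} [Field K] {V W : Type*} [AddCommGroup V] [Module K V] [AddCommGroup W]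
  [Module K W] {𝒱 : ℤ → Submodule K V} [DirectSum.Decomposition 𝒱]
  {C : Type*} [Ring C] [Algebra K C]

/-- The convolution product of linear maps (without signs). -/
def conv (A B : GSym 𝒱 →ₗ[K] C) : GSym 𝒱 →ₗ[K] C :=
  LinearMap.mul' K C ∘ₗ TensorProduct.map A B ∘ₗ comul 𝒱

theorem conv_one (A B : GSym 𝒱 →ₗ[K] C) : conv A B 1 = A 1 * B 1 := by
  simp [conv]

/-- A primitive factor goes either into the left tensor factor or, with a sign for passing that one,
into the right. -/
theorem conv_ι_mul (A B : GSym 𝒱 →ₗ[K] C) {i : ℤ} {x : V} (hx : x ∈ 𝒱 i) (b : GSym 𝒱) :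
    conv A B (ι 𝒱 x * b) = conv (A ∘ₗ LinearMap.mulLeft K (ι 𝒱 x)) B b +
      conv (A ∘ₗ signOp (degree 𝒱) i) (B ∘ₗ LinearMap.mulLeft K (ι 𝒱 x)) b := by
  simp only [conv, LinearMap.comp_apply, comul_ι_mul 𝒱 hx]
  generalize comul 𝒱 b = u
  induction u using TensorProduct.induction_on with
  | zero => simp
  | add u v hu hv => simp only [map_add, hu, hv]; abel
  | tmul a b => simp [tensorDeriv_tmul]

/-- The counit only sees degree 0, where the sign is trivial. -/
theorem counit_signOp (k : ℤ) (a : GSym 𝒱) : counit 𝒱 (signOp (degree 𝒱) k a) = counit 𝒱 a := by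
  induction a using DirectSum.Decomposition.inductionOn (degree 𝒱) with
  | zero => simp
  | add a b ha hb => simp only [map_add, ha, hb]
  | @homogeneous i a =>
    rw [signOp_eq_ksign_smul _ _ a.2, map_smul]
    by_cases hi : i = 0
    · subst hi; simp
    · rw [counit_eq_zero_of_mem_degree 𝒱 hi a.2, smul_zero]

/-- The left counit axiom. -/
theorem counit_comul (a : GSym 𝒱) :
    TensorProduct.lid K _ (TensorProduct.map (counit 𝒱).toLinearMap LinearMap.id (comul 𝒱 a)) =
      a := by
  suffices h : (TensorProduct.lid K _).toLinearMap ∘ₗ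
      TensorProduct.map (counit 𝒱).toLinearMap LinearMap.id ∘ₗ comul 𝒱 = LinearMap.id from
    congrArg (fun f => f a) h
  refine linearMap_ext (by simp) fun i x hx b hb => ?_
  simp only [LinearMap.comp_apply, comul_ι_mul 𝒱 hx, LinearMap.id_apply] at hb ⊢
  conv_rhs => rw [← hb]
  generalize comul 𝒱 b = u
  induction u using TensorProduct.induction_on with
  | zero => simp
  | add u v hu hv => simp only [map_add, hu, hv, mul_add]
  | tmul a b => simp [tensorDeriv_tmul, counit_signOp]

/-- The right counit axiom. -/
theorem comul_counit (a : GSym 𝒱) :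
    TensorProduct.rid K _ (TensorProduct.map LinearMap.id (counit 𝒱).toLinearMap (comul 𝒱 a)) =
      a := by
  suffices h : (TensorProduct.rid K _).toLinearMap ∘ₗ
      TensorProduct.map LinearMap.id (counit 𝒱).toLinearMap ∘ₗ comul 𝒱 = LinearMap.id from
    congrArg (fun f => f a) h
  refine linearMap_ext (by simp) fun i x hx b hb => ?_
  simp only [LinearMap.comp_apply, comul_ι_mul 𝒱 hx, LinearMap.id_apply] at hb ⊢
  conv_rhs => rw [← hb]
  generalize comul 𝒱 b = u
  induction u using TensorProduct.induction_on with
  | zero => simp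
  | add u v hu hv => simp only [map_add, hu, hv, mul_add]
  | tmul a b => simp [tensorDeriv_tmul]

theorem conv_counit_smul (c : C) (B : GSym 𝒱 →ₗ[K] C) (b : GSym 𝒱) :
    conv ((counit 𝒱).toLinearMap.smulRight c) B b = c * B b := by
  conv_rhs => rw [← counit_comul b]
  simp only [conv, LinearMap.comp_apply]
  generalize comul 𝒱 b = u
  induction u using TensorProduct.induction_on with
  | zero => simp
  | add u v hu hv => simp only [map_add, hu, hv, mul_add]
  | tmul a b => simp

end Conv

/-! ### Derivations of S(V) extending maps of generators -/

section Derivation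

variable {K : Type*} [Field K] {V : Type*} [AddCommGroup V] [Module K V]
  {𝒱 : ℤ → Submodule K V}

theorem ι_mul_ι_ksign {i j : ℤ} {x y : V} (hx : x ∈ 𝒱 i) (hy : y ∈ 𝒱 j) :
    ι 𝒱 x * ι 𝒱 y = ksign K (i * j) • (ι 𝒱 y * ι 𝒱 x) := by
  rw [ι_mul_ι 𝒱 hx hy, units_smul_eq_ksign (K := K)]

variable (𝒱) in
/-- `D` is the derivation of `S(V)` extending the map `d : V → V` of degree `k`. -/
structure IsDerivationExtending (k : ℤ) (d : V →ₗ[K] V) (D : GSym 𝒱 →ₗ[K] GSym 𝒱) : Prop where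
  deg : HasDegree 𝒱 𝒱 k d
  map_one : D 1 = 0
  map_ι_mul : ∀ {i : ℤ} {x : V}, x ∈ 𝒱 i → ∀ b,
    D (ι 𝒱 x * b) = ι 𝒱 (d x) * b + ksign K (k * i) • (ι 𝒱 x * D b)

variable [DirectSum.Decomposition 𝒱]

variable (𝒱) in
/-- The linear map `x₁ ⊙ ⋯ ⊙ xₙ ↦ ∑ ± d xⱼ ⊙ x₁ ⊙ ⋯ ⊙ xₙ`. -/
def extend (d : V →ₗ[K] V) : GSym 𝒱 →ₗ[K] GSym 𝒱 :=
  conv (ι 𝒱 ∘ₗ d ∘ₗ proj 𝒱) LinearMap.id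

theorem proj_signOp (i : ℤ) (a : GSym 𝒱) :
    proj 𝒱 (signOp (degree 𝒱) i a) = signOp 𝒱 i (proj 𝒱 a) :=
  (congrArg (fun f => f a) ((hasDegree_proj 𝒱).signOp_comm i)).symm

/-- A factor x placed in the left tensor factor survives `proj` only next to a scalar, which leaves
d x times b by the counit axiom. Placed in the right one, it must be moved back past some d y. -/
theorem isDerivationExtending_extend {k : ℤ} {d : V →ₗ[K] V} (hd : HasDegree 𝒱 𝒱 k d) :
    IsDerivationExtending 𝒱 k d (extend 𝒱 d) where
  deg := hd
  map_one := by simp [extend, conv_one, proj_one]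
  map_ι_mul := by
    intro i x hx b
    have h1 : (ι 𝒱 ∘ₗ d ∘ₗ proj 𝒱) ∘ₗ LinearMap.mulLeft K (ι 𝒱 x) =
        (counit 𝒱).toLinearMap.smulRight (ι 𝒱 (d x)) := by
      ext a; simp [proj_ι_mul]
    rw [extend, conv_ι_mul _ _ hx, h1, conv_counit_smul]
    congr 1
    simp only [conv, LinearMap.comp_apply]
    generalize comul 𝒱 b = u
    induction u using TensorProduct.induction_on with
    | zero => simp
    | add u v hu hv => simp only [map_add, hu, hv, mul_add, smul_add]
    | tmul a b =>
      simp only [TensorProduct.map_tmul, LinearMap.comp_apply, LinearMap.mul'_apply,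
        LinearMap.id_apply, LinearMap.mulLeft_apply, proj_signOp]
      generalize proj 𝒱 a = y
      induction y using DirectSum.Decomposition.inductionOn 𝒱 with
      | zero => simp
      | add y z hy hz => simp only [map_add, hy, hz, mul_add, add_mul, smul_add]
      | @homogeneous j y =>
        rw [signOp_eq_ksign_smul _ _ y.2, map_smul, map_smul, smul_mul_assoc, ← mul_assoc,
          ι_mul_ι_ksign (hd j y y.2) hx, smul_mul_assoc, smul_smul, ← ksign_add, mul_assoc]
        congr 1
        -- The exponents ij from `signOp` and (j + k)i from the exchange with d y add up to ki
        -- modulo 2.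
        exact ksign_congr ⟨i * j, by ring⟩

namespace IsDerivationExtending

variable {k l : ℤ} {d e : V →ₗ[K] V} {D E : GSym 𝒱 →ₗ[K] GSym 𝒱}

theorem unique (hD : IsDerivationExtending 𝒱 k d D) (hE : IsDerivationExtending 𝒱 k d E) :
    D = E :=
  linearMap_ext (by rw [hD.map_one, hE.map_one]) fun i x hx b hb => by
    rw [hD.map_ι_mul hx, hE.map_ι_mul hx, hb]

omit [DirectSum.Decomposition 𝒱] in
theorem congr {d' : V →ₗ[K] V} (hD : IsDerivationExtending 𝒱 k d D) (hk : k = l) (hd : d = d') :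
    IsDerivationExtending 𝒱 l d' D := by
  subst hk hd; exact hD

omit [DirectSum.Decomposition 𝒱] in
theorem zero (k : ℤ) : IsDerivationExtending 𝒱 k 0 0 where
  deg := hasDegree_zero_map k
  map_one := rfl
  map_ι_mul := by simp

omit [DirectSum.Decomposition 𝒱] in
theorem smul (hD : IsDerivationExtending 𝒱 k d D) (c : K) :
    IsDerivationExtending 𝒱 k (c • d) (c • D) where
  deg := hD.deg.smul c
  map_one := by simp [hD.map_one]
  map_ι_mul := by
    intro i x hx b
    simp only [LinearMap.smul_apply, hD.map_ι_mul hx, smul_add, map_smul, smul_mul_assoc,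
      mul_smul_comm]
    rw [smul_comm]

omit [DirectSum.Decomposition 𝒱] in
/-- The graded commutator of two derivations is a derivation. -/
theorem commutator (hD : IsDerivationExtending 𝒱 k d D) (hE : IsDerivationExtending 𝒱 l e E) :
    IsDerivationExtending 𝒱 (k + l) (d ∘ₗ e - ksign K (k * l) • (e ∘ₗ d))
      (D ∘ₗ E - ksign K (k * l) • (E ∘ₗ D)) where
  deg := ((hD.deg.comp hE.deg).congr (add_comm _ _)).sub ((hE.deg.comp hD.deg).smul _)
  map_one := by simp [hD.map_one, hE.map_one]
  map_ι_mul := by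
    intro i x hx b
    simp only [LinearMap.sub_apply, LinearMap.smul_apply, LinearMap.comp_apply, hD.map_ι_mul hx,
      hE.map_ι_mul hx, map_add, map_smul, hD.map_ι_mul (hE.deg i x hx),
      hE.map_ι_mul (hD.deg i x hx), smul_add, map_sub, sub_mul, mul_sub, smul_mul_assoc,
      mul_smul_comm, smul_sub, smul_smul, ← ksign_add]
    have e1 : ksign K (k * l + l * (i + k)) = ksign K (l * i) :=
      ksign_congr ⟨k * l, by ring⟩
    have e2 : k * l + k * i = k * (i + l) := by ring
    rw [e1, e2]
    have e3 : l * i + k * i = (k + l) * i := by ring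
    have e4 : k * l + (k * i + l * i) = (k + l) * i + k * l := by ring
    rw [e3, e4]
    abel

omit [DirectSum.Decomposition 𝒱] in
theorem hasDegree (hD : IsDerivationExtending 𝒱 k d D) :
    HasDegree (degree 𝒱) (degree 𝒱) k D := by
  refine hasDegree_of_ι_mul (by simp [hD.map_one]) fun i x hx j b hb hDb => ?_
  rw [hD.map_ι_mul hx]
  refine Submodule.add_mem _ ?_ (Submodule.smul_mem _ _ ?_)
  · have := SetLike.mul_mem_graded (ι_mem_degree 𝒱 (hD.deg i x hx)) hb
    rwa [add_right_comm] at this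
  · have := SetLike.mul_mem_graded (ι_mem_degree 𝒱 hx) hDb
    rwa [← add_assoc] at this

omit [DirectSum.Decomposition 𝒱] in
-- The Leibniz rule as a commutator of operators, the form that can be transported to the tensor
-- square.
theorem comp_mulLeft (hD : IsDerivationExtending 𝒱 k d D) {i : ℤ} {x : V} (hx : x ∈ 𝒱 i) :
    D ∘ₗ LinearMap.mulLeft K (ι 𝒱 x) - ksign K (k * i) • (LinearMap.mulLeft K (ι 𝒱 x) ∘ₗ D) =
      LinearMap.mulLeft K (ι 𝒱 (d x)) := by
  ext b
  simp [hD.map_ι_mul hx]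

/-- Derivations extending a map of generators are coderivations. -/
theorem isCoderivation (hD : IsDerivationExtending 𝒱 k d D) : IsCoderivation 𝒱 k D where
  deg := hD.hasDegree
  comul_comp := by
    refine linearMap_ext (by simp [hD.map_one, koszulTensor]) fun i x hx b hb => ?_
    -- Multiplication by x corresponds under Δ to the operator it induces on the tensor square.
    -- Commuting the one induced by `D` past it there gives the term of d x, just as in S(V), so the
    -- identity passes from b to x b.
    have h := congrArg (fun f => f (comul 𝒱 b))
      (tensorDeriv_comm (degree 𝒱) hD.hasDegree (hasDegree_mulLeft_ι 𝒱 hx))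
    change _ = (tensorDeriv (degree 𝒱) k D ∘ₗ comul 𝒱) _
    change comul 𝒱 (D b) = tensorDeriv (degree 𝒱) k D (comul 𝒱 b) at hb
    rw [hD.comp_mulLeft hx] at h
    simp only [LinearMap.sub_apply, LinearMap.smul_apply, LinearMap.comp_apply] at h
    rw [LinearMap.comp_apply, LinearMap.comp_apply, hD.map_ι_mul hx, map_add, map_smul,
      comul_ι_mul 𝒱 hx, comul_ι_mul 𝒱 hx, comul_ι_mul 𝒱 (hD.deg i x hx), hb, add_comm i k, ← h]
    abel

theorem signOp_ι_mul (k : ℤ) {i : ℤ} {x : V} (hx : x ∈ 𝒱 i) (b : GSym 𝒱) :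
    signOp (degree 𝒱) k (ι 𝒱 x * b) = ksign K (k * i) • (ι 𝒱 x * signOp (degree 𝒱) k b) :=
  congrArg (fun f => f b) ((hasDegree_mulLeft_ι 𝒱 hx).signOp_comp k)

/-- The graded Leibniz rule. -/
theorem map_mul (hD : IsDerivationExtending 𝒱 k d D) (a b : GSym 𝒱) :
    D (a * b) = D a * b + signOp (degree 𝒱) k a * D b := by
  have h1 : signOp (degree 𝒱) k (1 : GSym 𝒱) = 1 := by
    rw [signOp_eq_ksign_smul _ _ (SetLike.GradedOne.one_mem (A := degree 𝒱))]; simp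
  have h : D ∘ₗ LinearMap.mulRight K b = LinearMap.mulRight K b ∘ₗ D +
      LinearMap.mulRight K (D b) ∘ₗ signOp (degree 𝒱) k := by
    refine linearMap_ext (by simp [hD.map_one, h1]) fun i x hx a ha => ?_
    simp only [LinearMap.comp_apply, LinearMap.add_apply, LinearMap.mulRight_apply] at ha ⊢
    rw [mul_assoc, hD.map_ι_mul hx, hD.map_ι_mul hx, ha, signOp_ι_mul k hx]
    simp only [add_mul, mul_add, smul_add, smul_mul_assoc, mul_assoc]
    abel
  exact congrArg (fun f => f a) h

end IsDerivationExtending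

/-- Puts the matrix construction of `linearExt` under the uniqueness and commutator rules used for
all other derivations. -/
theorem isDerivationExtending_linearExt {d : V →ₗ[K] V} (hd : HasDegree 𝒱 𝒱 1 d) :
    IsDerivationExtending 𝒱 1 d (linearExt 𝒱 d hd) where
  deg := hd
  map_one := by simp [linearExt]
  map_ι_mul := by
    intro i x hx b
    rw [linearExt_mul, linearExt_ι, signOp_eq_ksign_smul _ _ (ι_mem_degree 𝒱 hx), smul_mul_assoc]

end Derivation

/-! ### Morphisms induced by maps of generators -/

section Map

variable {K : Type*} [Field K] {U V : Type*} [AddCommGroup U] [Module K U]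
  [AddCommGroup V] [Module K V]
  {𝒰 : ℤ → Submodule K U} [DirectSum.Decomposition 𝒰]
  {𝒱 : ℤ → Submodule K V} [DirectSum.Decomposition 𝒱]
  {f : U →ₗ[K] V} (hf : HasDegree 𝒰 𝒱 0 f)
include hf

omit [DirectSum.Decomposition 𝒰] [DirectSum.Decomposition 𝒱] in
theorem hasDegree_map : HasDegree (degree 𝒰) (degree 𝒱) 0 (map f hf).toLinearMap := by
  refine hasDegree_of_ι_mul (by simpa using SetLike.GradedOne.one_mem (A := degree 𝒱))
    fun i x hx j b _ hb => ?_
  have h := SetLike.mul_mem_graded (ι_mem_degree 𝒱 (hf i x hx)) hb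
  simpa [map_ι] using h

omit [DirectSum.Decomposition 𝒱] in
-- Both composites obey the same rule on a further generator. Taking one of the derivations to be
-- zero gives the vanishing of σL, Lτ, σN and Nτ.
theorem map_comp_derivation {k : ℤ} {d : U →ₗ[K] U} {D : GSym 𝒰 →ₗ[K] GSym 𝒰} {e : V →ₗ[K] V}
    {E : GSym 𝒱 →ₗ[K] GSym 𝒱} (hD : IsDerivationExtending 𝒰 k d D)
    (hE : IsDerivationExtending 𝒱 k e E) (h : f ∘ₗ d = e ∘ₗ f) :
    (map f hf).toLinearMap ∘ₗ D = E ∘ₗ (map f hf).toLinearMap := by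
  refine linearMap_ext (by simp [hD.map_one, hE.map_one]) fun i x hx b hb => ?_
  have h' : f (d x) = e (f x) := congrArg (fun f => f x) h
  have hfx := hf i x hx
  rw [add_zero] at hfx
  simp only [LinearMap.comp_apply, AlgHom.toLinearMap_apply] at hb ⊢
  rw [hD.map_ι_mul hx, map_add, map_smul, map_mul, map_mul, map_mul, map_ι, map_ι, hb, h',
    hE.map_ι_mul hfx]

theorem isCoalgebraMorphism_map : IsCoalgebraMorphism 𝒰 𝒱 (map f hf).toLinearMap where
  deg := hasDegree_map hf
  map_one := by simp
  counit_comp := by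
    have : (counit 𝒱).comp (map f hf) = counit 𝒰 := algHom_ext fun x => by simp [map_ι]
    ext a
    exact congrArg (fun f => f a) this
  comul_comp := by
    rw [koszulTensor_zero]
    refine linearMap_ext (by simp) fun i x hx b hb => ?_
    have hfx := hf i x hx
    rw [add_zero] at hfx
    have h : (map f hf).toLinearMap ∘ₗ LinearMap.mulLeft K (ι 𝒰 x) =
        LinearMap.mulLeft K (ι 𝒱 (f x)) ∘ₗ (map f hf).toLinearMap := by
      ext a; simp [map_ι]
    have h2 := congrArg (fun f => f (comul 𝒰 b))
      ((hasDegree_map hf).tensor_comp_tensorDeriv (k := i) h)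
    simp only [LinearMap.comp_apply, AlgHom.toLinearMap_apply] at hb h2 ⊢
    rw [map_mul, map_ι, comul_ι_mul 𝒱 hfx, hb, comul_ι_mul 𝒰 hx, h2]

omit [DirectSum.Decomposition 𝒱] in
theorem proj_map (a : GSym 𝒰) : proj 𝒱 (map f hf a) = f (proj 𝒰 a) := by
  have h : proj 𝒱 ∘ₗ (map f hf).toLinearMap = f ∘ₗ proj 𝒰 := by
    refine linearMap_ext (by simp [proj_one]) fun i x hx b _ => ?_
    have : (counit 𝒱).comp (map f hf) = counit 𝒰 := algHom_ext fun x => by simp [map_ι]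
    simp [map_ι, proj_ι_mul, ← this]
  exact congrArg (fun f => f a) h

end Map

end GSym

/-! ### Inverting a diagonalizable operator away from its kernel -/

section PseudoInverse

variable {K : Type*} [Field K] {A : Type*} [AddCommGroup A] [Module K A]

/-- A diagonalizable operator `N` has a pseudo-inverse, which is `μ⁻¹` on the `μ`-eigenspace
(and `0` on the kernel). -/
theorem exists_pseudoInverse (N : A →ₗ[K] A)
    (hN : Submodule.span K {b | ∃ μ : K, N b = μ • b} = ⊤) :
    ∃ P : A →ₗ[K] A, ∀ (μ : K) (b : A), N b = μ • b → P b = μ⁻¹ • b := by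
  classical
  have htop : (⨆ μ, Module.End.eigenspace N μ) = ⊤ := by
    rw [eq_top_iff, ← hN, Submodule.span_le]
    rintro b ⟨μ, hb⟩
    exact Submodule.mem_iSup_of_mem μ (Module.End.mem_eigenspace_iff.2 hb)
  have hint := DirectSum.isInternal_submodule_of_iSupIndep_of_iSup_eq_top
    (Module.End.eigenspaces_iSupIndep N) htop
  let e := LinearEquiv.ofBijective (DirectSum.coeLinearMap fun μ => Module.End.eigenspace N μ) hint
  refine ⟨DirectSum.toModule K K A (fun μ => μ⁻¹ • (Module.End.eigenspace N μ).subtype) ∘ₗ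
    e.symm.toLinearMap, fun μ b hb => ?_⟩
  have hb' : b ∈ Module.End.eigenspace N μ := Module.End.mem_eigenspace_iff.2 hb
  have he : e.symm b = DirectSum.lof K K (fun μ => Module.End.eigenspace N μ) μ ⟨b, hb'⟩ := by
    rw [LinearEquiv.symm_apply_eq]
    exact (DirectSum.coeLinearMap_lof _ μ ⟨b, hb'⟩).symm
  rw [LinearMap.comp_apply, LinearEquiv.coe_coe, he, DirectSum.toModule_lof]
  rfl

end PseudoInverse

namespace GSym

/-! ### The length filtration -/

section Filtration

variable {K : Type*} [Field K] {V : Type*} [AddCommGroup V] [Module K V]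
  (𝒱 : ℤ → Submodule K V)

/-- The subspace `⨁_{m ≤ n} V^{⊙m}` of `S(V)`. -/
def filt (n : ℕ) : Submodule K (GSym 𝒱) := (1 ⊔ LinearMap.range (ι 𝒱)) ^ n

variable {𝒱}

theorem filt_mono {m n : ℕ} (h : m ≤ n) : filt 𝒱 m ≤ filt 𝒱 n :=
  pow_le_pow_right₀ (M₀ := Submodule K (GSym 𝒱)) le_sup_left h

theorem one_mem_filt (n : ℕ) : 1 ∈ filt 𝒱 n :=
  filt_mono (Nat.zero_le n) (by rw [filt, pow_zero]; exact Submodule.one_le.1 le_rfl)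

theorem mem_filt_zero {a : GSym 𝒱} (ha : a ∈ filt 𝒱 0) : ∃ c : K, a = c • 1 := by
  rw [filt, pow_zero, Submodule.mem_one] at ha
  obtain ⟨c, rfl⟩ := ha
  exact ⟨c, Algebra.algebraMap_eq_smul_one c⟩

theorem mul_mem_filt {m n : ℕ} {a b : GSym 𝒱} (ha : a ∈ filt 𝒱 m) (hb : b ∈ filt 𝒱 n) :
    a * b ∈ filt 𝒱 (m + n) := by
  rw [filt, pow_add]; exact Submodule.mul_mem_mul ha hb

theorem ι_mem_filt (x : V) : ι 𝒱 x ∈ filt 𝒱 1 := by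
  rw [filt, pow_one]; exact Submodule.mem_sup_right ⟨x, rfl⟩

theorem ι_mul_mem_filt (x : V) {n : ℕ} {b : GSym 𝒱} (hb : b ∈ filt 𝒱 n) :
    ι 𝒱 x * b ∈ filt 𝒱 (n + 1) := by
  rw [add_comm]; exact mul_mem_filt (ι_mem_filt x) hb

/-- The space of length n + 1 is (K + V) times that of length n. The spanning set `X` is left free:
it will consist of all vectors, of homogeneous ones, or of homogeneous ones fixed or killed by an
idempotent. -/
theorem filt_succ_induction {W : Type*} [AddCommGroup W] [Module K W] {X : Set V}
    (hX : Submodule.span K X = ⊤) {A : GSym 𝒱 →ₗ[K] W} {M : Submodule K W} {n : ℕ}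
    (h0 : ∀ b ∈ filt 𝒱 n, A b ∈ M) (h1 : ∀ x ∈ X, ∀ b ∈ filt 𝒱 n, A (ι 𝒱 x * b) ∈ M)
    {b : GSym 𝒱} (hb : b ∈ filt 𝒱 (n + 1)) : A b ∈ M := by
  rw [filt, pow_succ'] at hb
  refine Submodule.mul_induction_on hb (fun c hc b hb => ?_) fun b c hb hc => by
    rw [map_add]; exact M.add_mem hb hc
  obtain ⟨c, hc', _, ⟨x, rfl⟩, rfl⟩ := Submodule.mem_sup.1 hc
  obtain ⟨c, rfl⟩ := Submodule.mem_one.1 hc'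
  rw [add_mul, map_add, Algebra.algebraMap_eq_smul_one, smul_one_mul, map_smul]
  refine M.add_mem (M.smul_mem c (h0 b hb)) ?_
  clear hc
  have hx : x ∈ Submodule.span K X := hX ▸ Submodule.mem_top
  induction hx using Submodule.span_induction with
  | mem x hx => exact h1 x hx b hb
  | zero => simp
  | add x y _ _ hx hy => rw [map_add, add_mul, map_add]; exact M.add_mem hx hy
  | smul c x _ hx => rw [map_smul, smul_mul_assoc, map_smul]; exact M.smul_mem c hx

/-- A criterion for a linear map out of `S(V)` to respect filtrations. -/
theorem filt_induction {W : Type*} [AddCommGroup W] [Module K W] {X : Set V}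
    (hX : Submodule.span K X = ⊤) {A : GSym 𝒱 →ₗ[K] W} {M : ℕ → Submodule K W}
    (hM : Monotone M) (h0 : A 1 ∈ M 0)
    (h1 : ∀ x ∈ X, ∀ n, ∀ b ∈ filt 𝒱 n, A b ∈ M n → A (ι 𝒱 x * b) ∈ M (n + 1))
    {n : ℕ} {b : GSym 𝒱} (hb : b ∈ filt 𝒱 n) : A b ∈ M n := by
  induction n generalizing b with
  | zero =>
    obtain ⟨c, rfl⟩ := mem_filt_zero hb
    rw [map_smul]; exact (M 0).smul_mem c h0
  | succ n ih =>
    exact filt_succ_induction hX (fun b hb => hM n.le_succ (ih hb))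
      (fun x hx b hb => h1 x hx n b hb (ih hb)) hb

variable (𝒱) in
/-- The subspace of elements of total length at most `n` in `S(V) ⊗ S(V)`. -/
def tensorFilt (n : ℕ) : Submodule K (GSym 𝒱 ⊗[K] GSym 𝒱) :=
  Submodule.span K {u | ∃ i j : ℕ, i + j ≤ n ∧ ∃ a ∈ filt 𝒱 i, ∃ b ∈ filt 𝒱 j, a ⊗ₜ b = u}

theorem tmul_mem_tensorFilt {i j n : ℕ} (h : i + j ≤ n) {a b : GSym 𝒱} (ha : a ∈ filt 𝒱 i)
    (hb : b ∈ filt 𝒱 j) : a ⊗ₜ b ∈ tensorFilt 𝒱 n :=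
  Submodule.subset_span ⟨i, j, h, a, ha, b, hb, rfl⟩

theorem tensorFilt_mono : Monotone (tensorFilt 𝒱) := fun _ _ h =>
  Submodule.span_mono fun _ ⟨i, j, hij, r⟩ => ⟨i, j, hij.trans h, r⟩

theorem tensorFilt_induction {W : Type*} [AddCommGroup W] [Module K W]
    {A : GSym 𝒱 ⊗[K] GSym 𝒱 →ₗ[K] W} {M : Submodule K W} {n : ℕ}
    (h : ∀ i j, i + j ≤ n → ∀ a ∈ filt 𝒱 i, ∀ b ∈ filt 𝒱 j, A (a ⊗ₜ b) ∈ M)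
    {u : GSym 𝒱 ⊗[K] GSym 𝒱} (hu : u ∈ tensorFilt 𝒱 n) : A u ∈ M := by
  refine (?_ : tensorFilt 𝒱 n ≤ M.comap A) hu
  rw [tensorFilt, Submodule.span_le]
  rintro _ ⟨i, j, hij, a, ha, b, hb, rfl⟩
  exact h i j hij a ha b hb

theorem map_mem_filt {U : Type*} [AddCommGroup U] [Module K U] {𝒰 : ℤ → Submodule K U}
    {f : U →ₗ[K] V} (hf : HasDegree 𝒰 𝒱 0 f) {n : ℕ} {a : GSym 𝒰} (ha : a ∈ filt 𝒰 n) :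
    map f hf a ∈ filt 𝒱 n :=
  filt_induction (A := (map f hf).toLinearMap) (X := Set.univ) Submodule.span_univ
    (fun _ _ h => filt_mono h) (by simpa using one_mem_filt 0)
    (fun x _ n b _ h => by simpa [map_ι] using ι_mul_mem_filt (f x) h) ha

theorem proj_eq_zero_of_mem_filt_zero {a : GSym 𝒱} (ha : a ∈ filt 𝒱 0) : proj 𝒱 a = 0 := by
  obtain ⟨c, rfl⟩ := mem_filt_zero ha
  rw [map_smul, proj_one, smul_zero]

variable [DirectSum.Decomposition 𝒱]

variable (𝒱) in
omit [DirectSum.Decomposition 𝒱] in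
theorem span_homogeneous_eq_top [DirectSum.Decomposition 𝒱] :
    Submodule.span K {x | ∃ i, x ∈ 𝒱 i} = ⊤ := by
  rw [eq_top_iff]
  intro x _
  induction x using DirectSum.Decomposition.inductionOn 𝒱 with
  | zero => exact Submodule.zero_mem _
  | add x y hx hy => exact Submodule.add_mem _ (hx trivial) (hy trivial)
  | @homogeneous i x => exact Submodule.subset_span ⟨i, x.2⟩

theorem exists_mem_filt (a : GSym 𝒱) : ∃ n, a ∈ filt 𝒱 n := by
  have hdir : Directed (· ≤ ·) (filt 𝒱) := directed_of_isDirected_le fun _ _ h => filt_mono h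
  rw [← Submodule.mem_iSup_of_directed _ hdir]
  refine mem_of_ι_mul_mem (Submodule.mem_iSup_of_mem 0 (one_mem_filt 0)) (fun i x hx b hb => ?_) a
  rw [Submodule.mem_iSup_of_directed _ hdir] at hb ⊢
  obtain ⟨n, hb⟩ := hb
  exact ⟨n + 1, ι_mul_mem_filt x hb⟩

theorem exists_mem_tensorFilt (u : GSym 𝒱 ⊗[K] GSym 𝒱) : ∃ n, u ∈ tensorFilt 𝒱 n := by
  induction u using TensorProduct.induction_on with
  | zero => exact ⟨0, Submodule.zero_mem _⟩
  | tmul a b =>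
    obtain ⟨i, ha⟩ := exists_mem_filt a
    obtain ⟨j, hb⟩ := exists_mem_filt b
    exact ⟨i + j, tmul_mem_tensorFilt le_rfl ha hb⟩
  | add u v hu hv =>
    obtain ⟨m, hu⟩ := hu
    obtain ⟨n, hv⟩ := hv
    exact ⟨max m n, Submodule.add_mem _ (tensorFilt_mono (le_max_left m n) hu)
      (tensorFilt_mono (le_max_right m n) hv)⟩

theorem IsDerivationExtending.mem_filt {k : ℤ} {d : V →ₗ[K] V} {D : GSym 𝒱 →ₗ[K] GSym 𝒱}
    (hD : IsDerivationExtending 𝒱 k d D) {n : ℕ} {b : GSym 𝒱} (hb : b ∈ filt 𝒱 n) :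
    D b ∈ filt 𝒱 n := by
  refine filt_induction (span_homogeneous_eq_top 𝒱) (fun _ _ h => filt_mono h)
    (by rw [hD.map_one]; exact Submodule.zero_mem _) ?_ hb
  rintro x ⟨i, hx⟩ n b hb hDb
  rw [hD.map_ι_mul hx]
  exact Submodule.add_mem _ (ι_mul_mem_filt _ hb) (Submodule.smul_mem _ _ (ι_mul_mem_filt _ hDb))

theorem signOp_one (k : ℤ) : signOp (degree 𝒱) k (1 : GSym 𝒱) = 1 := by
  rw [signOp_eq_ksign_smul _ _ (SetLike.GradedOne.one_mem (A := degree 𝒱))]; simp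

theorem signOp_mem_filt (k : ℤ) {n : ℕ} {b : GSym 𝒱} (hb : b ∈ filt 𝒱 n) :
    signOp (degree 𝒱) k b ∈ filt 𝒱 n := by
  refine filt_induction (span_homogeneous_eq_top 𝒱) (fun _ _ h => filt_mono h)
    (by rw [signOp_one]; exact one_mem_filt 0) ?_ hb
  rintro x ⟨i, hx⟩ n b hb hDb
  rw [IsDerivationExtending.signOp_ι_mul k hx]
  exact Submodule.smul_mem _ _ (ι_mul_mem_filt _ hDb)

theorem comul_mem_tensorFilt {n : ℕ} {b : GSym 𝒱} (hb : b ∈ filt 𝒱 n) :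
    comul 𝒱 b ∈ tensorFilt 𝒱 n := by
  refine filt_induction (A := comul 𝒱) (span_homogeneous_eq_top 𝒱) tensorFilt_mono
    (by
      rw [comul_one]
      exact tmul_mem_tensorFilt (i := 0) (j := 0) le_rfl (one_mem_filt 0) (one_mem_filt 0)) ?_ hb
  rintro x ⟨i, hx⟩ n b _ hb
  rw [comul_ι_mul 𝒱 hx]
  refine tensorFilt_induction (A := tensorDeriv (degree 𝒱) i (LinearMap.mulLeft K (ι 𝒱 x)))
    (fun j k hjk a ha c hc => ?_) hb
  rw [tensorDeriv_tmul]
  refine Submodule.add_mem _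
    (tmul_mem_tensorFilt (i := j + 1) (j := k) (by omega) (ι_mul_mem_filt x ha) hc)
    (tmul_mem_tensorFilt (i := j) (j := k + 1) (by omega) (signOp_mem_filt i ha)
      (ι_mul_mem_filt x hc))

/-! ### The Euler operator -/

variable (𝒱) in
/-- The Euler operator, which is multiplication by `n` on `V^{⊙n}`. -/
def euler : GSym 𝒱 →ₗ[K] GSym 𝒱 := extend 𝒱 LinearMap.id

variable (𝒱) in
theorem isDerivationExtending_euler : IsDerivationExtending 𝒱 0 LinearMap.id (euler 𝒱) :=
  isDerivationExtending_extend hasDegree_id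

theorem euler_apply (a : GSym 𝒱) :
    euler 𝒱 a = LinearMap.mul' K _ (TensorProduct.map (ι 𝒱 ∘ₗ proj 𝒱) LinearMap.id (comul 𝒱 a)) :=
  rfl

theorem euler_ι_mul (x : V) (b : GSym 𝒱) :
    euler 𝒱 (ι 𝒱 x * b) = ι 𝒱 x * b + ι 𝒱 x * euler 𝒱 b := by
  induction x using DirectSum.Decomposition.inductionOn 𝒱 with
  | zero => simp
  | add x y hx hy => simp only [map_add, add_mul, hx, hy]; abel
  | @homogeneous i x =>
    rw [(isDerivationExtending_euler 𝒱).map_ι_mul x.2]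
    simp

theorem euler_ι (x : V) : euler 𝒱 (ι 𝒱 x) = ι 𝒱 x := by
  simpa [(isDerivationExtending_euler 𝒱).map_one] using euler_ι_mul (𝒱 := 𝒱) x 1

/-- The Euler operator acts on the quotient of lengths n + 1 by n as the scalar n + 1, because each
new factor adds one to the eigenvalue. -/
theorem euler_sub_mem_filt {n : ℕ} {b : GSym 𝒱} (hb : b ∈ filt 𝒱 (n + 1)) :
    euler 𝒱 b - ((n + 1 : ℕ) : K) • b ∈ filt 𝒱 n := by
  have hE : ∀ {n b}, b ∈ filt 𝒱 n → euler 𝒱 b ∈ filt 𝒱 n :=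
    (isDerivationExtending_euler 𝒱).mem_filt
  have h0 : ∀ n, ∀ b ∈ filt 𝒱 n,
      (euler 𝒱 - ((n + 1 : ℕ) : K) • LinearMap.id : GSym 𝒱 →ₗ[K] GSym 𝒱) b ∈ filt 𝒱 n :=
    fun n b hb =>
    Submodule.sub_mem _ (hE hb) (Submodule.smul_mem _ _ hb)
  induction n generalizing b with
  | zero =>
    refine filt_succ_induction (A := euler 𝒱 - ((0 + 1 : ℕ) : K) • LinearMap.id) (X := Set.univ)
      Submodule.span_univ (h0 0) (fun x _ b hb => ?_) hb
    obtain ⟨c, rfl⟩ := mem_filt_zero hb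
    simp [euler_ι]
  | succ n ih =>
    refine filt_succ_induction (A := euler 𝒱 - ((n + 1 + 1 : ℕ) : K) • LinearMap.id)
      (X := Set.univ) Submodule.span_univ (h0 (n + 1)) (fun x _ b hb => ?_) hb
    have h := ι_mul_mem_filt x (ih hb)
    convert h using 1
    simp only [LinearMap.sub_apply, LinearMap.add_apply, LinearMap.smul_apply, LinearMap.id_apply,
      euler_ι_mul, mul_sub, mul_add,
      mul_smul_comm, Nat.cast_add, Nat.cast_one, add_smul, one_smul]
    abel

variable [CharZero K]

/-- On each quotient of length m + 1 > n the Euler operator is the scalar m + 1, invertible in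
characteristic zero, so the length can be lowered step by step down to n. -/
theorem mem_filt_of_euler_mem_filt {n : ℕ} {b : GSym 𝒱} (hb : euler 𝒱 b ∈ filt 𝒱 n) :
    b ∈ filt 𝒱 n := by
  obtain ⟨m, hm⟩ := exists_mem_filt b
  induction m with
  | zero => exact filt_mono n.zero_le hm
  | succ m ih =>
    by_cases h : m + 1 ≤ n
    · exact filt_mono h hm
    · refine ih ?_
      have h1 := Submodule.sub_mem _ (filt_mono (by omega : n ≤ m) hb) (euler_sub_mem_filt hm)
      rw [sub_sub_cancel] at h1
      rwa [Submodule.smul_mem_iff _ (by exact_mod_cast m.succ_ne_zero)] at h1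

omit [CharZero K] in
-- Applying ε ⊗ ε to the coderivation identity gives εD = εD + εD.
theorem counit_comp_coderivation {k : ℤ} {D : GSym 𝒱 →ₗ[K] GSym 𝒱} (hD : IsCoderivation 𝒱 k D) :
    (counit 𝒱).toLinearMap ∘ₗ D = 0 := by
  ext b
  have h : ∀ u : GSym 𝒱 ⊗[K] GSym 𝒱, counit 𝒱 (TensorProduct.lid K _
      (TensorProduct.map (counit 𝒱).toLinearMap LinearMap.id (tensorDeriv (degree 𝒱) k D u))) =
      counit 𝒱 (D (TensorProduct.rid K _
        (TensorProduct.map LinearMap.id (counit 𝒱).toLinearMap u))) +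
      counit 𝒱 (D (TensorProduct.lid K _
        (TensorProduct.map (counit 𝒱).toLinearMap LinearMap.id u))) := by
    intro u
    induction u using TensorProduct.induction_on with
    | zero => simp
    | add u v hu hv => simp only [map_add, hu, hv]; ring
    | tmul a b => simp [tensorDeriv_tmul, counit_signOp, mul_comm]
  have h1 := h (comul 𝒱 b)
  have h2 : comul 𝒱 (D b) = tensorDeriv (degree 𝒱) k D (comul 𝒱 b) :=
    congrArg (fun f => f b) hD.comul_comp
  rw [← h2, counit_comul, counit_comul, comul_counit] at h1
  simpa using h1

omit [DirectSum.Decomposition 𝒱] [CharZero K] in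
theorem proj_coderivation_filt_one {D : GSym 𝒱 →ₗ[K] GSym 𝒱} (h1 : D 1 = 0)
    (hp : ∀ x, proj 𝒱 (D (ι 𝒱 x)) = 0) {a : GSym 𝒱} (ha : a ∈ filt 𝒱 1) :
    proj 𝒱 (D a) = 0 := by
  have := filt_succ_induction (A := proj 𝒱 ∘ₗ D) (M := ⊥) (X := Set.univ) (n := 0)
    Submodule.span_univ (fun b hb => ?_) (fun x _ b hb => ?_) ha
  · simpa using this
  all_goals
    obtain ⟨c, rfl⟩ := mem_filt_zero hb
    simp [h1, hp]

/-- A coderivation without constant and linear Taylor coefficients lowers the length. -/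
theorem coderivation_mem_filt {k : ℤ} {D : GSym 𝒱 →ₗ[K] GSym 𝒱} (hD : IsCoderivation 𝒱 k D)
    (h1 : D 1 = 0) (hp : ∀ x, proj 𝒱 (D (ι 𝒱 x)) = 0) {n : ℕ} {b : GSym 𝒱}
    (hb : b ∈ filt 𝒱 (n + 1)) : D b ∈ filt 𝒱 n := by
  induction n using Nat.strong_induction_on generalizing b with
  | _ n ih =>
  -- The Euler operator is multiplication after ιp ⊗ id and Δ. Applied to D b it involves only pD
  -- and p on left tensor factors, and D on shorter right ones.
  apply mem_filt_of_euler_mem_filt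
  have h2 : comul 𝒱 (D b) = tensorDeriv (degree 𝒱) k D (comul 𝒱 b) :=
    congrArg (fun f => f b) hD.comul_comp
  rw [euler_apply, h2]
  refine tensorFilt_induction (A := LinearMap.mul' K _ ∘ₗ TensorProduct.map (ι 𝒱 ∘ₗ proj 𝒱)
    LinearMap.id ∘ₗ tensorDeriv (degree 𝒱) k D) (fun i j hij a ha c hc => ?_)
    (comul_mem_tensorFilt hb)
  simp only [LinearMap.comp_apply, tensorDeriv_tmul, map_add, TensorProduct.map_tmul,
    LinearMap.mul'_apply, LinearMap.id_apply]
  refine Submodule.add_mem _ ?_ ?_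
  -- The term pD(a)·c: for a of length at most 1 it vanishes by hypothesis, otherwise its length is
  -- at most 1 + j ≤ n.
  · by_cases hi : i ≤ 1
    · rw [proj_coderivation_filt_one h1 hp (filt_mono hi ha), map_zero, zero_mul]
      exact Submodule.zero_mem _
    · exact filt_mono (by omega) (ι_mul_mem_filt _ hc)
  -- The term p(a)·D(c): it vanishes if a or c is constant. Otherwise c has length at most n, and
  -- induction applies to it.
  · rcases i with _ | i
    · rw [proj_eq_zero_of_mem_filt_zero (signOp_mem_filt k ha), map_zero, zero_mul]
      exact Submodule.zero_mem _
    · rcases j with _ | j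
      · obtain ⟨c, rfl⟩ := mem_filt_zero hc
        rw [map_smul, h1, smul_zero, mul_zero]
        exact Submodule.zero_mem _
      · exact filt_mono (by omega) (ι_mul_mem_filt _ (ih j (by omega) hc))

end Filtration

end GSym

/-! ### Operators with a weight decomposition -/

section Weight

variable {K : Type*} [Field K] {A : Type*} [AddCommGroup A] [Module K A]

/-- `b` has weight `m` with respect to the operator `N`, and `π` acts on it as the projection onto
weight `0`. -/
def HasWeight (N π : A →ₗ[K] A) (m : ℕ) (b : A) : Prop :=
  N b = (m : K) • b ∧ π b = if m = 0 then b else 0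

/-- `P` is the pseudo-inverse of the diagonalizable operator `N`. -/
def IsPseudoInverse (N P : A →ₗ[K] A) : Prop :=
  ∀ (μ : K) (b : A), N b = μ • b → P b = μ⁻¹ • b

/-- The spaces of the filtration `Fil`, which is exhaustive, are spanned by elements with a
weight. -/
structure IsWeightFiltration (N π : A →ₗ[K] A) (Fil : ℕ → Submodule K A) : Prop where
  exists_mem : ∀ a, ∃ n, a ∈ Fil n
  le_span : ∀ n, Fil n ≤ Submodule.span K {b | b ∈ Fil n ∧ ∃ m : ℕ, HasWeight N π m b}

namespace IsWeightFiltration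

variable {N π P : A →ₗ[K] A} {Fil : ℕ → Submodule K A}

theorem span_eq_top (h : IsWeightFiltration N π Fil) :
    Submodule.span K {b | ∃ m : ℕ, HasWeight N π m b} = ⊤ := by
  rw [eq_top_iff]
  intro a _
  obtain ⟨n, ha⟩ := h.exists_mem a
  exact Submodule.span_mono (fun b hb => hb.2) (h.le_span n ha)

theorem linearMap_ext (h : IsWeightFiltration N π Fil) {W : Type*} [AddCommGroup W] [Module K W]
    {f g : A →ₗ[K] W} (hfg : ∀ (m : ℕ) b, HasWeight N π m b → f b = g b) : f = g :=
  LinearMap.ext_on h.span_eq_top fun b ⟨m, hb⟩ => hfg m b hb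

theorem exists_isPseudoInverse (h : IsWeightFiltration N π Fil) : ∃ P, IsPseudoInverse N P := by
  refine exists_pseudoInverse N ?_
  rw [eq_top_iff, ← h.span_eq_top]
  exact Submodule.span_mono fun b ⟨m, hb⟩ => ⟨m, hb.1⟩

/-- On weight m ≠ 0 this is m⁻¹m = 1, where characteristic zero is needed; on weight 0 both sides
vanish. -/
theorem pseudoInverse_comp [CharZero K] (h : IsWeightFiltration N π Fil)
    (hP : IsPseudoInverse N P) : P ∘ₗ N = LinearMap.id - π :=
  h.linearMap_ext fun m b hb => by
    rw [LinearMap.comp_apply, hb.1, map_smul, hP m b hb.1, LinearMap.sub_apply, hb.2]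
    by_cases hm : m = 0
    · simp [hm]
    · simp [hm, smul_smul]

theorem pseudoInverse_mem (h : IsWeightFiltration N π Fil) (hP : IsPseudoInverse N P) {n : ℕ}
    {a : A} (ha : a ∈ Fil n) : P a ∈ Fil n := by
  refine (?_ : Fil n ≤ (Fil n).comap P) ha
  refine (h.le_span n).trans (Submodule.span_le.2 ?_)
  rintro b ⟨hb, m, hm⟩
  change P b ∈ Fil n
  rw [hP m b hm.1]
  exact Submodule.smul_mem _ _ hb

/-- The pseudo-inverse commutes with all operators that commute with `N`. -/
theorem pseudoInverse_comm (h : IsWeightFiltration N π Fil) (hP : IsPseudoInverse N P)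
    {B : A →ₗ[K] A} (hB : N ∘ₗ B = B ∘ₗ N) : P ∘ₗ B = B ∘ₗ P :=
  h.linearMap_ext fun m b hb => by
    have h1 : N (B b) = (m : K) • B b := by
      rw [← LinearMap.comp_apply, hB, LinearMap.comp_apply, hb.1, map_smul]
    rw [LinearMap.comp_apply, LinearMap.comp_apply, hP m _ h1, hP m b hb.1, map_smul]

/-- `B` vanishes on the nonzero weights, and `P` vanishes on weight 0 because 0⁻¹ = 0. -/
theorem comp_pseudoInverse_eq_zero [CharZero K] (h : IsWeightFiltration N π Fil)
    (hP : IsPseudoInverse N P) {W : Type*} [AddCommGroup W] [Module K W] {B : A →ₗ[K] W}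
    (hB : B ∘ₗ N = 0) : B ∘ₗ P = 0 :=
  h.linearMap_ext fun m b hb => by
    have h1 : (m : K) • B b = 0 := by
      rw [← map_smul, ← hb.1, ← LinearMap.comp_apply, hB, LinearMap.zero_apply]
    rw [LinearMap.comp_apply, hP m b hb.1, map_smul, LinearMap.zero_apply]
    rcases smul_eq_zero.1 h1 with h2 | h2
    · simp [h2]
    · simp [h2]

end IsWeightFiltration

end Weight

namespace GSym

/-! ### The weight on the symmetric algebra given by an idempotent -/

section Idempotent

variable {K : Type*} [Field K] {U : Type*} [AddCommGroup U] [Module K U]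
  {𝒰 : ℤ → Submodule K U} [DirectSum.Decomposition 𝒰]
  {φ : U →ₗ[K] U} (hφ : HasDegree 𝒰 𝒰 0 φ) (hφφ : φ ∘ₗ φ = φ)

omit [DirectSum.Decomposition 𝒰] in
-- `N` is a derivation counting the factors killed by φ, and S(φ), being multiplicative, annihilates
-- any product with such a factor.
theorem HasWeight.ι_mul {N : GSym 𝒰 →ₗ[K] GSym 𝒰}
    (hN : IsDerivationExtending 𝒰 0 (LinearMap.id - φ) N) {i : ℤ} {x : U} (hx : x ∈ 𝒰 i) {m : ℕ}
    {b : GSym 𝒰} (hb : HasWeight N (map φ hφ).toLinearMap m b) :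
    (φ x = x → HasWeight N (map φ hφ).toLinearMap m (ι 𝒰 x * b)) ∧
    (φ x = 0 → HasWeight N (map φ hφ).toLinearMap (m + 1) (ι 𝒰 x * b)) := by
  have hb2 : map φ hφ b = if m = 0 then b else 0 := hb.2
  constructor
  · intro h
    refine ⟨?_, ?_⟩
    · rw [hN.map_ι_mul hx, hb.1]
      simp [h]
    · rw [AlgHom.toLinearMap_apply, map_mul, map_ι, hb2, h]
      split_ifs <;> simp
  · intro h
    refine ⟨?_, ?_⟩
    · rw [hN.map_ι_mul hx, hb.1]
      simp [h, add_smul, add_comm]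
    · rw [AlgHom.toLinearMap_apply, map_mul, map_ι, h]
      simp

include hφ hφφ in
-- Every x is φx + (x - φx), and both parts keep the degree of x since φ has degree 0.
theorem span_idempotent_eq_top :
    Submodule.span K {x | ∃ i, x ∈ 𝒰 i ∧ (φ x = x ∨ φ x = 0)} = ⊤ := by
  rw [eq_top_iff, ← span_homogeneous_eq_top 𝒰, Submodule.span_le]
  rintro x ⟨i, hx⟩
  have h := hφ i x hx
  rw [add_zero] at h
  have h2 : φ (φ x) = φ x := congrArg (fun f => f x) hφφ
  have : x = φ x + (x - φ x) := by abel
  rw [this]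
  exact Submodule.add_mem _ (Submodule.subset_span ⟨i, h, Or.inl h2⟩)
    (Submodule.subset_span ⟨i, Submodule.sub_mem _ hx h, Or.inr (by rw [map_sub, h2, sub_self])⟩)

include hφφ in
-- Monomials in generators that are fixed or killed by φ have a weight and span each step of the
-- length filtration.
theorem isWeightFiltration_filt {N : GSym 𝒰 →ₗ[K] GSym 𝒰}
    (hN : IsDerivationExtending 𝒰 0 (LinearMap.id - φ) N) :
    IsWeightFiltration N (map φ hφ).toLinearMap (filt 𝒰) where
  exists_mem := exists_mem_filt
  le_span := by
    intro n a ha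
    refine filt_induction (A := LinearMap.id) (M := fun n => Submodule.span K
      {b | b ∈ filt 𝒰 n ∧ ∃ m : ℕ, HasWeight N (map φ hφ).toLinearMap m b})
      (span_idempotent_eq_top hφ hφφ)
      (fun m n h => Submodule.span_mono fun b hb => ⟨filt_mono h hb.1, hb.2⟩) ?_ ?_ ha
    · refine Submodule.subset_span ⟨one_mem_filt 0, 0, ?_, ?_⟩
      · simp [hN.map_one]
      · simp
    · rintro x ⟨i, hx, hx'⟩ n b _ hb
      change LinearMap.mulLeft K (ι 𝒰 x) b ∈ _
      refine Submodule.mem_comap.1 ((Submodule.span_le (p := Submodule.comap _ _)).2 ?_ hb)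
      rintro b ⟨hb, m, hm⟩
      rcases hx' with hx' | hx'
      · exact Submodule.subset_span ⟨ι_mul_mem_filt x hb, m, (HasWeight.ι_mul hφ hN hx hm).1 hx'⟩
      · exact Submodule.subset_span
          ⟨ι_mul_mem_filt x hb, m + 1, (HasWeight.ι_mul hφ hN hx hm).2 hx'⟩

include hφφ in
-- Weights add under ⊗. As they are natural numbers, a sum is 0 only if both terms are, which makes
-- the tensor square of S(φ) the projection to weight 0.
theorem isWeightFiltration_tensorFilt {N : GSym 𝒰 →ₗ[K] GSym 𝒰}
    (hN : IsDerivationExtending 𝒰 0 (LinearMap.id - φ) N) :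
    IsWeightFiltration (tensorDeriv (degree 𝒰) 0 N)
      (TensorProduct.map (map φ hφ).toLinearMap (map φ hφ).toLinearMap) (tensorFilt 𝒰) where
  exists_mem := exists_mem_tensorFilt
  le_span := by
    intro n
    rw [tensorFilt, Submodule.span_le]
    rintro _ ⟨i, j, hij, a, ha, b, hb, rfl⟩
    have hw := isWeightFiltration_filt hφ hφφ hN
    have ha' := hw.le_span i ha
    have hb' := hw.le_span j hb
    rw [SetLike.mem_coe]
    change TensorProduct.mk K (GSym 𝒰) (GSym 𝒰) a b ∈ _
    generalize hM : (Submodule.span K _ : Submodule K (GSym 𝒰 ⊗[K] GSym 𝒰)) = M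
    clear ha hb
    induction ha' using Submodule.span_induction with
    | zero => simp
    | add a a' _ _ h h' => rw [map_add, LinearMap.add_apply]; exact M.add_mem h h'
    | smul c a _ h => rw [map_smul, LinearMap.smul_apply]; exact M.smul_mem c h
    | mem a ha =>
      induction hb' using Submodule.span_induction with
      | zero => simp
      | add b b' _ _ h h' => rw [map_add]; exact M.add_mem h h'
      | smul c b _ h => rw [map_smul]; exact M.smul_mem c h
      | mem b hb =>
        obtain ⟨ha, m, hm⟩ := ha
        obtain ⟨hb, m', hm'⟩ := hb
        rw [← hM]
        refine Submodule.subset_span ⟨tmul_mem_tensorFilt hij ha hb, m + m', ?_, ?_⟩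
        · rw [TensorProduct.mk_apply, tensorDeriv_tmul, signOp_zero, LinearMap.id_apply, hm.1,
            hm'.1, Nat.cast_add, add_smul, TensorProduct.smul_tmul', TensorProduct.tmul_smul]
        · rw [TensorProduct.mk_apply, TensorProduct.map_tmul, hm.2, hm'.2]
          by_cases h : m = 0 <;> by_cases h' : m' = 0 <;> simp [h, h']

/-- Pseudo-inverses of operators of degree `0` have degree `0`. -/
theorem IsPseudoInverse.hasDegree {N π P : GSym 𝒰 →ₗ[K] GSym 𝒰}
    {Fil : ℕ → Submodule K (GSym 𝒰)} (hw : IsWeightFiltration N π Fil) (hP : IsPseudoInverse N P)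
    (hN : HasDegree (degree 𝒰) (degree 𝒰) 0 N) : HasDegree (degree 𝒰) (degree 𝒰) 0 P := by
  intro i a ha
  rw [add_zero]
  -- The projection to degree i commutes with `N`, hence with its pseudo-inverse.
  let p : GSym 𝒰 →ₗ[K] GSym 𝒰 := (degree 𝒰 i).subtype ∘ₗ
    DirectSum.component K ℤ (fun i => degree 𝒰 i) i ∘ₗ
    (DirectSum.decomposeLinearEquiv (degree 𝒰)).toLinearMap
  have hp : ∀ b, p b = DirectSum.decompose (degree 𝒰) b i := fun b => rfl
  have hpN : N ∘ₗ p = p ∘ₗ N := by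
    refine linearMap_ext_homogeneous (degree 𝒰) fun j b hb => ?_
    have hNb := hN j b hb
    rw [add_zero] at hNb
    change N (p b) = p (N b)
    rw [hp, hp]
    by_cases hij : j = i
    · subst hij
      rw [DirectSum.decompose_of_mem_same _ hb, DirectSum.decompose_of_mem_same _ hNb]
    · rw [DirectSum.decompose_of_mem_ne _ hb hij, DirectSum.decompose_of_mem_ne _ hNb hij, map_zero]
  have h := congrArg (fun f => f a) (hw.pseudoInverse_comm hP hpN)
  change P (p a) = p (P a) at h
  rw [hp, DirectSum.decompose_of_mem_same _ ha] at h
  rw [h, hp]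
  exact (DirectSum.decompose (degree 𝒰) (P a) i).2

end Idempotent

end GSym

/-! ### Signs and permutations -/

theorem neg_one_zpow_sum {ι : Type*} (s : Finset ι) (p : ι → ℤ) :
    (-1 : ℤˣ) ^ (∑ i ∈ s, p i) = ∏ i ∈ s, (-1 : ℤˣ) ^ p i := by
  classical
  induction s using Finset.induction_on with
  | empty => simp
  | insert a s ha ih => rw [Finset.sum_insert ha, Finset.prod_insert ha, zpow_add, ih]

/-- The effect on the Koszul sign of applying an operator of degree `-1` to one of the factors. -/
theorem koszulSign_update {n : ℕ} (p : Fin n → ℤ) (σ : Equiv.Perm (Fin n)) (j : Fin n) :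
    koszulSign p σ * (-1 : ℤˣ) ^ (∑ i with i < j, p (σ i)) =
      koszulSign (Function.update p (σ j) (p (σ j) - 1)) σ *
        (-1 : ℤˣ) ^ (∑ i with i < σ j, p i) := by
  set q := Function.update p (σ j) (p (σ j) - 1) with hq
  have hqj : q (σ j) = p (σ j) - 1 := by simp [hq]
  have hqi : ∀ i, i ≠ j → q (σ i) = p (σ i) := fun i hi => by
    rw [hq, Function.update_of_ne (fun e => hi (σ.injective e))]
  -- In the product of the two signs only the inversions involving position j survive, and each
  -- leaves the parity of the other element.
  have h1 : koszulSign p σ * koszulSign q σ =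
      ∏ i, (if (j < i ∧ σ i < σ j) ∨ (i < j ∧ σ j < σ i) then (-1 : ℤˣ) ^ p (σ i) else 1) := by
    have h2 : koszulSign p σ * koszulSign q σ =
        (∏ i, ∏ i', if i = j then
          (if j < i' ∧ σ i' < σ j then (-1 : ℤˣ) ^ p (σ i') else 1) else 1) *
        ∏ i, ∏ i', if i' = j then
          (if i < j ∧ σ j < σ i then (-1 : ℤˣ) ^ p (σ i) else 1) else 1 := by
      rw [koszulSign, koszulSign, ← Finset.prod_mul_distrib, ← Finset.prod_mul_distrib]
      refine Finset.prod_congr rfl fun i _ => ?_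
      rw [← Finset.prod_mul_distrib, ← Finset.prod_mul_distrib]
      refine Finset.prod_congr rfl fun i' _ => ?_
      have e1 : ∀ a b : ℤ, (-1 : ℤˣ) ^ (a * b) * (-1 : ℤˣ) ^ ((a - 1) * b) = (-1 : ℤˣ) ^ b := by
        intro a b
        rw [← zpow_add, show a * b + (a - 1) * b = (a - 1) * b + (a - 1) * b + b by ring, zpow_add,
          zpow_add, Int.units_mul_self, one_mul]
      by_cases hi : i = j
      · subst hi
        by_cases hi' : i' = i
        · subst hi'; simp
        · simp only [hi', if_true, if_false, mul_one, hqj, hqi i' hi']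
          split_ifs <;> simp [e1]
      · by_cases hi' : i' = j
        · subst hi'
          simp only [hi, if_true, if_false, one_mul, hqj, hqi i hi]
          split_ifs
          · rw [mul_comm (p (σ i)), mul_comm (p (σ i)), e1]
          · simp
        · simp only [hi, hi', if_false, hqi i hi, hqi i' hi']
          split_ifs <;> simp [Int.units_mul_self]
    rw [h2, Finset.prod_comm (f := fun i i' => if i = j then
      (if j < i' ∧ σ i' < σ j then (-1 : ℤˣ) ^ p (σ i') else 1) else 1), ← Finset.prod_mul_distrib]
    refine Finset.prod_congr rfl fun i _ => ?_
    rw [Finset.prod_ite_eq' Finset.univ j, Finset.prod_ite_eq' Finset.univ j]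
    simp only [Finset.mem_univ, if_true]
    rcases lt_trichotomy i j with h | h | h
    · simp [h, h.asymm]
    · simp [h]
    · simp [h, h.asymm]
  -- The same product again: an element is left over exactly when it precedes the j-th one in one of
  -- the two orders but not in the other.
  have h3 : (-1 : ℤˣ) ^ (∑ i with i < j, p (σ i)) * (-1 : ℤˣ) ^ (∑ i with i < σ j, p i) =
      ∏ i, (if (j < i ∧ σ i < σ j) ∨ (i < j ∧ σ j < σ i) then (-1 : ℤˣ) ^ p (σ i) else 1) := by
    rw [neg_one_zpow_sum, neg_one_zpow_sum, Finset.prod_filter, Finset.prod_filter,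
      ← Equiv.prod_comp σ (fun i => if i < σ j then (-1 : ℤˣ) ^ p i else 1),
      ← Finset.prod_mul_distrib]
    refine Finset.prod_congr rfl fun i _ => ?_
    rcases lt_trichotomy i j with h | h | h
    · rcases lt_or_gt_of_ne (fun e => h.ne (σ.injective e)) with h' | h' <;>
        simp [h, h', h.asymm, h'.asymm, Int.units_mul_self]
    · simp [h]
    · simp [h, h.asymm]
  have h4 : ∀ a b c d : ℤˣ, a * c = b * d → a * b = c * d := by decide
  exact h4 _ _ _ _ (h1.trans h3.symm)

/-- For each `k ∈ A`, the number of permutations of which `k` is the first value in `A` is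
`n! / #A`. -/
theorem exists_card_first_value {n : ℕ} (A : Finset (Fin n)) : ∃ c : ℕ,
    (∀ k ∈ A, ({σ : Equiv.Perm (Fin n) | ∀ i < σ⁻¹ k, σ i ∉ A} : Finset _).card = c) ∧
    (A.Nonempty → A.card * c = n.factorial) := by
  classical
  rcases A.eq_empty_or_nonempty with rfl | ⟨k₀, hk₀⟩
  · exact ⟨0, by simp, by simp⟩
  let N : Fin n → ℕ := fun k =>
    ({σ : Equiv.Perm (Fin n) | ∀ i < σ⁻¹ k, σ i ∉ A} : Finset _).card
  -- Left multiplication by the transposition of k and k₀ preserves `A` and carries the permutations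
  -- with first value k to those with first value k₀.
  have hN : ∀ k ∈ A, N k = N k₀ := by
    intro k hk
    have hA : ∀ i, Equiv.swap k k₀ i ∈ A ↔ i ∈ A := by
      intro i
      by_cases h1 : i = k
      · simp [h1, hk, hk₀]
      · by_cases h2 : i = k₀
        · simp [h2, hk, hk₀]
        · rw [Equiv.swap_apply_of_ne_of_ne h1 h2]
    refine Finset.card_equiv (Equiv.mulLeft (Equiv.swap k k₀)) fun σ => ?_
    have h : (Equiv.swap k k₀ * σ)⁻¹ k₀ = σ⁻¹ k := by
      rw [mul_inv_rev, Equiv.Perm.mul_apply, Equiv.swap_inv, Equiv.swap_apply_right]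
    simp only [Finset.mem_filter, Finset.mem_univ, true_and, Equiv.coe_mulLeft, h,
      Equiv.Perm.mul_apply, hA]
  refine ⟨N k₀, hN, fun _ => ?_⟩
  have h1 : ∑ k ∈ A, N k = A.card * N k₀ := by
    rw [Finset.sum_congr rfl hN, Finset.sum_const, smul_eq_mul]
  rw [← h1]
  have h2 : ∑ k ∈ A, N k =
      ∑ σ : Equiv.Perm (Fin n), (A.filter fun k => ∀ i < σ⁻¹ k, σ i ∉ A).card := by
    simp only [N, Finset.card_filter]
    exact Finset.sum_comm
  -- Each permutation has exactly one first value in `A`, so a double count gives n!.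
  have h3 : ∀ σ : Equiv.Perm (Fin n), (A.filter fun k => ∀ i < σ⁻¹ k, σ i ∉ A).card = 1 := by
    intro σ
    have hne : (Finset.univ.filter fun i => σ i ∈ A).Nonempty := ⟨σ⁻¹ k₀, by simpa using hk₀⟩
    have hmin := Finset.min'_mem _ hne
    set j := Finset.min' _ hne with hj
    rw [Finset.card_eq_one]
    refine ⟨σ j, ?_⟩
    ext k
    simp only [Finset.mem_filter, Finset.mem_univ, true_and, Finset.mem_singleton] at hmin ⊢
    have hlt : ∀ i < j, σ i ∉ A := fun i hi hiA =>
      absurd (Finset.min'_le (Finset.univ.filter fun i => σ i ∈ A) i (by simpa using hiA))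
        (not_le.2 hi)
    constructor
    · rintro ⟨hk, hk'⟩
      rw [← Equiv.Perm.inv_eq_iff_eq]
      rcases lt_trichotomy (σ⁻¹ k) j with h | h | h
      · exact absurd (by simpa using hk) (hlt _ h)
      · exact h
      · exact absurd hmin (hk' _ h)
    · rintro rfl
      exact ⟨hmin, by simpa using hlt⟩
  rw [h2, Finset.sum_congr rfl fun σ _ => h3 σ]
  simp [Fintype.card_perm]

namespace GSym

/-! ### Monomials -/

section Monomial

variable {K : Type*} [Field K] {V : Type*} [AddCommGroup V] [Module K V]
  (𝒱 : ℤ → Submodule K V)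

@[simp] theorem monomial_zero (x : Fin 0 → V) : monomial 𝒱 x = 1 := by simp [monomial]

theorem monomial_succ {n : ℕ} (x : Fin (n + 1) → V) :
    monomial 𝒱 x = ι 𝒱 (x 0) * monomial 𝒱 fun i => x i.succ := by
  simp [monomial, List.ofFn_succ]

theorem monomial_eq_zero {n : ℕ} {x : Fin n → V} {k : Fin n} (hk : x k = 0) :
    monomial 𝒱 x = 0 := by
  rw [monomial]
  exact List.prod_eq_zero (by rw [List.mem_ofFn]; exact ⟨k, by simp [hk]⟩)

theorem monomial_swap {n : ℕ} {p : Fin (n + 1) → ℤ} {x : Fin (n + 1) → V}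
    (hx : ∀ i, x i ∈ 𝒱 (p i)) (i : Fin n) :
    monomial 𝒱 x = ((-1 : ℤˣ) ^ (p i.castSucc * p i.succ)) •
      monomial 𝒱 fun k => x (Equiv.swap i.castSucc i.succ k) := by
  induction n with
  | zero => exact i.elim0
  | succ n ih =>
    refine Fin.cases ?_ (fun i => ?_) i
    · rw [monomial_succ, monomial_succ, monomial_succ 𝒱 (fun k => x _),
        monomial_succ 𝒱 (fun k => x _),
        ← mul_assoc, ← mul_assoc]
      have h : ∀ k : Fin n, Equiv.swap (0 : Fin (n + 2)) 1 k.succ.succ = k.succ.succ := fun k =>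
        Equiv.swap_apply_of_ne_of_ne (Fin.succ_ne_zero _)
          (fun e => Fin.succ_ne_zero k (Fin.succ_injective _ e))
      simp only [Fin.castSucc_zero, Fin.succ_zero_eq_one, Equiv.swap_apply_left,
        Equiv.swap_apply_right, h]
      rw [ι_mul_ι 𝒱 (hx 0) (hx 1), smul_mul_assoc]
    · rw [monomial_succ, monomial_succ 𝒱 (fun k => x (Equiv.swap _ _ k)), ih (fun k => hx k.succ) i]
      have h0 : Equiv.swap i.succ.castSucc i.succ.succ 0 = 0 :=
        Equiv.swap_apply_of_ne_of_ne (by simp [Fin.ext_iff]) (Fin.succ_ne_zero _).symm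
      have h : ∀ k : Fin (n + 1), Equiv.swap i.succ.castSucc i.succ.succ k.succ =
          (Equiv.swap i.castSucc i.succ k).succ := fun k =>
        (Function.Injective.swap_apply (Fin.succ_injective _) i.castSucc i.succ k)
      simp only [h0, h]
      rw [mul_smul_comm]
      rfl

/-- Reordering the factors of a monomial. -/
theorem monomial_perm {n : ℕ} (σ : Equiv.Perm (Fin n)) {p : Fin n → ℤ} {x : Fin n → V}
    (hx : ∀ i, x i ∈ 𝒱 (p i)) :
    koszulSign p σ • monomial 𝒱 (fun i => x (σ i)) = monomial 𝒱 x := by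
  rcases n with _ | n
  · have : koszulSign p σ = 1 := by simp [koszulSign]
    simp [this]
  -- Adjacent transpositions generate the group as a monoid, and the cocycle identity
  -- `koszulSign_mul` handles products.
  have hσ : σ ∈ Submonoid.closure
      (Set.range fun i : Fin n => Equiv.swap i.castSucc i.succ) := by
    rw [Equiv.Perm.mclosure_swap_castSucc_succ]; trivial
  induction hσ using Submonoid.closure_induction generalizing p x with
  | mem σ hσ =>
    obtain ⟨i, rfl⟩ := hσ
    rw [koszulSign_swap p _ _ (by simp), monomial_swap 𝒱 hx i]
  | one =>
    have : koszulSign p 1 = 1 := by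
      refine Finset.prod_eq_one fun i _ => Finset.prod_eq_one fun j _ => if_neg ?_
      rintro ⟨h1, h2⟩
      exact h1.asymm h2
    simp [this]
  | mul τ σ _ _ hτ hσ =>
    rw [koszulSign_mul, mul_smul, ← hτ hx, ← hσ (x := fun i => x (τ i)) (fun i => hx (τ i))]
    rfl

variable {𝒱}

theorem IsDerivationExtending.map_monomial {k : ℤ} {d : V →ₗ[K] V} {D : GSym 𝒱 →ₗ[K] GSym 𝒱}
    (hD : IsDerivationExtending 𝒱 k d D) {n : ℕ} {p : Fin n → ℤ} {x : Fin n → V}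
    (hx : ∀ i, x i ∈ 𝒱 (p i)) :
    D (monomial 𝒱 x) = ∑ j, ksign K (k * ∑ i with i < j, p i) •
      monomial 𝒱 (Function.update x j (d (x j))) := by
  induction n with
  | zero => simp [hD.map_one]
  | succ n ih =>
    rw [monomial_succ, hD.map_ι_mul (hx 0), ih fun i => hx i.succ, Fin.sum_univ_succ]
    congr 1
    · rw [monomial_succ]; simp
    · rw [Finset.mul_sum, Finset.smul_sum]
      refine Finset.sum_congr rfl fun j _ => ?_
      have h1 : ∑ i with i < j.succ, p i = p 0 + ∑ i with i < j, p i.succ := by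
        rw [Finset.sum_filter, Fin.sum_univ_succ, Finset.sum_filter]
        simp
      rw [monomial_succ 𝒱 (Function.update x j.succ _), h1, mul_add, ksign_add, mul_smul_comm,
        smul_smul]
      congr 3
      ext i
      simp [Function.update_apply]

theorem span_monomial_eq_top [DirectSum.Decomposition 𝒱] {X : Set V}
    (hX : Submodule.span K X = ⊤) :
    Submodule.span K {a | ∃ (n : ℕ) (x : Fin n → V), (∀ i, x i ∈ X) ∧ monomial 𝒱 x = a} = ⊤ := by
  rw [eq_top_iff]
  intro a _
  have h1 : ∃ (n : ℕ) (x : Fin n → V), (∀ i, x i ∈ X) ∧ monomial 𝒱 x = 1 := ⟨0, Fin.elim0, by simp⟩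
  refine mem_of_ι_mul_mem (Submodule.subset_span h1) (fun i x hxi b hb => ?_) a
  clear hxi
  have hx : x ∈ Submodule.span K X := hX ▸ Submodule.mem_top
  generalize hM : (Submodule.span K _ : Submodule K (GSym 𝒱)) = M at hb ⊢
  induction hx using Submodule.span_induction with
  | zero => simp
  | add x y _ _ hx hy => rw [map_add, add_mul]; exact M.add_mem hx hy
  | smul c x _ hx => rw [map_smul, smul_mul_assoc]; exact M.smul_mem c hx
  | mem x hx =>
    rw [← hM] at hb ⊢
    induction hb using Submodule.span_induction with
    | zero => simp
    | add b c _ _ hb hc => rw [mul_add]; exact Submodule.add_mem _ hb hc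
    | smul c b _ hb => rw [mul_smul_comm]; exact Submodule.smul_mem _ c hb
    | mem b hb =>
      obtain ⟨n, y, hy, rfl⟩ := hb
      refine Submodule.subset_span ⟨n + 1, Fin.cons x y, Fin.cases (by simpa using hx)
        (by simpa using hy), ?_⟩
      rw [monomial_succ]; simp

end Monomial

/-! ### The symmetrized tensor trick -/

section Trick

variable {K : Type*} [Field K] [CharZero K] {U : Type*} [AddCommGroup U] [Module K U]
  {𝒰 : ℤ → Submodule K U} [DirectSum.Decomposition 𝒰]
  {φ h : U →ₗ[K] U}

/-- The symmetrized tensor trick on a monomial of which each factor is fixed or killed by `φ`. -/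
theorem symTrick_monomial_of_weight {L : GSym 𝒰 →ₗ[K] GSym 𝒰}
    (hL : IsDerivationExtending 𝒰 (-1) h L) (hhφ : h ∘ₗ φ = 0) {n : ℕ} {p : Fin n → ℤ}
    {x : Fin n → U} (hx : ∀ i, x i ∈ 𝒰 (p i)) (A : Finset (Fin n))
    (hA : ∀ i ∈ A, φ (x i) = 0) (hA' : ∀ i, i ∉ A → φ (x i) = x i) :
    symTrick 𝒰 φ h (monomial 𝒰 x) = (A.card : K)⁻¹ • L (monomial 𝒰 x) := by
  classical
  let T : Fin n → GSym 𝒰 := fun k => ((-1 : ℤˣ) ^ (∑ i with i < k, p i)) •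
    monomial 𝒰 (Function.update x k (h (x k)))
  -- A vector fixed by φ is killed by h, as hφ = 0.
  have hh0 : ∀ k, k ∉ A → h (x k) = 0 := fun k hk => by
    rw [← hA' k hk]; exact congrArg (fun f => f (x k)) hhφ
  have hT0 : ∀ k, k ∉ A → T k = 0 := fun k hk => by
    simp only [T]
    rw [monomial_eq_zero 𝒰 (k := k) (by simp [hh0 k hk]), smul_zero]
  have hLx : L (monomial 𝒰 x) = ∑ k ∈ A, T k := by
    rw [hL.map_monomial hx, ← Finset.sum_subset (Finset.subset_univ A) fun k _ hk => ?_]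
    · refine Finset.sum_congr rfl fun k _ => ?_
      rw [neg_one_mul, ksign_neg, ← units_smul_eq_ksign]
    · have := hT0 k hk
      simp only [T] at this
      rw [neg_one_mul, ksign_neg, ← units_smul_eq_ksign, this]
  -- A summand vanishes unless h meets an element of `A` and φ meets none, that is, unless σ j is
  -- the first value in `A`. Then φ acts as the identity, and undoing the permutation gives the
  -- corresponding term of L.
  have hterm : ∀ (σ : Equiv.Perm (Fin n)) (j : Fin n),
      (koszulSign p σ * (-1 : ℤˣ) ^ (∑ i with i < j, p (σ i))) •
        monomial 𝒰 (fun i => trickFactor φ h j i (x (σ i))) =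
      if σ j ∈ A ∧ ∀ i < j, σ i ∉ A then T (σ j) else 0 := by
    intro σ j
    split_ifs with hj
    -- After h has acted, the factor has degree one less, so the reordering uses the Koszul sign of
    -- the modified degrees.
    · rw [koszulSign_update, mul_comm, mul_smul]
      simp only [T]
      congr 1
      rw [← monomial_perm 𝒰 σ (p := Function.update p (σ j) (p (σ j) - 1))
        (x := Function.update x (σ j) (h (x (σ j)))) fun i => ?_]
      · congr 2
        ext i
        simp only [trickFactor]
        rcases lt_trichotomy i j with hij | hij | hij
        · rw [if_pos hij, hA' _ (hj.2 i hij),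
            Function.update_of_ne fun e => hij.ne (σ.injective e)]
        · simp [hij]
        · rw [if_neg hij.asymm, if_neg hij.ne', LinearMap.id_apply,
            Function.update_of_ne fun e => hij.ne' (σ.injective e)]
      · by_cases hi : i = σ j
        · subst hi
          simpa [sub_eq_add_neg] using hL.deg _ _ (hx (σ j))
        · simpa [Function.update_of_ne hi] using hx i
    · by_cases h1 : σ j ∈ A
      · have h2 : ∃ i < j, σ i ∈ A := by
          by_contra! h2
          exact hj ⟨h1, h2⟩
        obtain ⟨i, hij, hi⟩ := h2
        rw [monomial_eq_zero 𝒰 (k := i) (by simp [trickFactor, hij, hA _ hi]), smul_zero]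
      · rw [monomial_eq_zero 𝒰 (k := j) (by simp [trickFactor, hh0 _ h1]), smul_zero]
  obtain ⟨c, hc, hc'⟩ := exists_card_first_value A
  have hsum : ∀ σ : Equiv.Perm (Fin n),
      (∑ j, if σ j ∈ A ∧ ∀ i < j, σ i ∉ A then T (σ j) else 0) =
      ∑ k ∈ A, if ∀ i < σ⁻¹ k, σ i ∉ A then T k else 0 := by
    intro σ
    have hσ : ∀ k, σ (σ⁻¹ k) = k := fun k => by simp
    rw [← Equiv.sum_comp σ⁻¹, ← Finset.sum_subset (Finset.subset_univ A) fun k _ hk => ?_]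
    · refine Finset.sum_congr rfl fun k hk => ?_
      rw [hσ]
      simp only [hk, true_and]
    · rw [hσ]
      exact if_neg fun h => hk h.1
  rw [symTrick_monomial 𝒰 φ h p x hx]
  simp only [hterm, hsum]
  rw [Finset.sum_comm, hLx]
  have h5 : ∀ k ∈ A, (∑ σ : Equiv.Perm (Fin n), if ∀ i < σ⁻¹ k, σ i ∉ A then T k else 0) =
      (c : K) • T k := by
    intro k hk
    rw [← Finset.sum_filter, Finset.sum_const, hc k hk, Nat.cast_smul_eq_nsmul]
  -- Each term of L occurs c times, where #A · c = n!, so the prefactor 1/n! becomes 1/#A.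
  rw [Finset.sum_congr rfl h5, ← Finset.smul_sum, smul_smul]
  rcases A.eq_empty_or_nonempty with rfl | hne
  · simp
  · congr 1
    have h6 := hc' hne
    have h7 : (A.card : K) ≠ 0 := by exact_mod_cast hne.card_ne_zero
    have h8 : (n.factorial : K) ≠ 0 := by exact_mod_cast n.factorial_ne_zero
    field_simp
    rw [mul_comm]
    exact_mod_cast h6

/-- The symmetrized tensor trick is the composition of the derivation extending `h` with the
pseudo-inverse of the weight operator. -/
theorem symTrick_eq {N L P : GSym 𝒰 →ₗ[K] GSym 𝒰} (hφ : HasDegree 𝒰 𝒰 0 φ) (hφφ : φ ∘ₗ φ = φ)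
    (hN : IsDerivationExtending 𝒰 0 (LinearMap.id - φ) N)
    (hL : IsDerivationExtending 𝒰 (-1) h L) (hhφ : h ∘ₗ φ = 0) (hNL : N ∘ₗ L = L ∘ₗ N)
    (hP : IsPseudoInverse N P) : symTrick 𝒰 φ h = P ∘ₗ L := by
  classical
  refine LinearMap.ext_on (span_monomial_eq_top (span_idempotent_eq_top hφ hφφ)) ?_
  rintro _ ⟨n, x, hx, rfl⟩
  choose p hp hx using hx
  let A : Finset (Fin n) := Finset.univ.filter fun i => φ (x i) ≠ x i
  have hA : ∀ i ∈ A, φ (x i) = 0 := fun i hi => (hx i).resolve_left (by simpa [A] using hi)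
  have hA' : ∀ i, i ∉ A → φ (x i) = x i := fun i hi => by simpa [A] using hi
  rw [symTrick_monomial_of_weight hL hhφ hp A hA hA', LinearMap.comp_apply]
  -- It remains to see that L of the monomial has eigenvalue #A; since N and L commute, this can be
  -- checked on the monomial.
  refine (hP _ _ ?_).symm
  rw [← LinearMap.comp_apply, hNL, LinearMap.comp_apply, ← map_smul]
  congr 1
  rw [hN.map_monomial hp, ← Finset.sum_subset (Finset.subset_univ A) fun k _ hk => ?_]
  · rw [Finset.sum_congr rfl (g := fun _ => monomial 𝒰 x) fun k hk => ?_, Finset.sum_const,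
      Nat.cast_smul_eq_nsmul]
    simp [hA k hk]
  · rw [monomial_eq_zero 𝒰 (k := k) (by simp [hA' k hk]), smul_zero]

end Trick

end GSym

/-! ### Locally nilpotent operators and the perturbation lemma -/

section LocallyFinite

variable {K : Type*} [Field K] {A B : Type*} [AddCommGroup A] [Module K A]
  [AddCommGroup B] [Module K B]

theorem locallyFiniteSum_apply {u : ℕ → (A →ₗ[K] B)}
    (hu : ∀ a, (Function.support fun n => u n a).Finite) (a : A) :
    locallyFiniteSum u a = ∑ᶠ n, u n a := by
  rw [locallyFiniteSum, dif_pos hu]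
  rfl

theorem locallyFiniteSum_comp {A' B' : Type*} [AddCommGroup A'] [Module K A'] [AddCommGroup B']
    [Module K B'] {u : ℕ → (A →ₗ[K] B)} (hu : ∀ a, (Function.support fun n => u n a).Finite)
    (f : A' →ₗ[K] A) (g : B →ₗ[K] B') :
    locallyFiniteSum (fun n => g ∘ₗ u n ∘ₗ f) = g ∘ₗ locallyFiniteSum u ∘ₗ f := by
  have hu' : ∀ a, (Function.support fun n => (g ∘ₗ u n ∘ₗ f) a).Finite := fun a =>
    (hu (f a)).subset fun n hn h0 => hn (by
      change g (u n (f a)) = 0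
      rw [show u n (f a) = 0 from h0, map_zero])
  ext a
  rw [locallyFiniteSum_apply hu', LinearMap.comp_apply, LinearMap.comp_apply,
    locallyFiniteSum_apply hu]
  exact (AddMonoidHom.map_finsum (g : B →+ B') (hu (f a))).symm

/-- `T` is locally nilpotent. -/
def LocallyNilpotent (T : A →ₗ[K] A) : Prop :=
  ∀ a, ∃ N, ∀ n ≥ N, (T ^ n : Module.End K A) a = 0

/-- The geometric series of a locally nilpotent operator. -/
def geomSeries (T : A →ₗ[K] A) : A →ₗ[K] A :=
  locallyFiniteSum fun n => (T ^ n : Module.End K A)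

namespace LocallyNilpotent

variable {T : A →ₗ[K] A}

theorem support_finite (hT : LocallyNilpotent T) (a : A) :
    (Function.support fun n => (T ^ n : Module.End K A) a).Finite := by
  obtain ⟨N, hN⟩ := hT a
  refine (Set.finite_lt_nat N).subset fun n hn => ?_
  by_contra h
  exact hn (hN n (not_lt.1 h))

theorem geomSeries_apply (hT : LocallyNilpotent T) {a : A} {N : ℕ}
    (hN : ∀ n ≥ N, (T ^ n : Module.End K A) a = 0) :
    geomSeries T a = ∑ n ∈ Finset.range N, (T ^ n : Module.End K A) a := by
  rw [geomSeries, locallyFiniteSum_apply hT.support_finite]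
  refine finsum_eq_sum_of_support_subset _ fun n hn => ?_
  rw [Finset.coe_range, Set.mem_Iio]
  by_contra h
  exact hn (hN n (not_lt.1 h))

/-- The series solves X = 1 + TX, and in `geomSeries_right` X = 1 + XT. A truncation at N + 1 is
compared with one at N. -/
theorem geomSeries_left (hT : LocallyNilpotent T) (a : A) :
    geomSeries T a = a + T (geomSeries T a) := by
  obtain ⟨N, hN⟩ := hT a
  have h1 := hT.geomSeries_apply (a := a) (N := N + 1) fun n hn => hN n (by omega)
  rw [Finset.sum_range_succ'] at h1
  conv_rhs => rw [hT.geomSeries_apply hN, map_sum]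
  rw [h1, add_comm]
  simp only [pow_succ', Module.End.mul_apply, pow_zero, Module.End.one_apply]

theorem geomSeries_right (hT : LocallyNilpotent T) (a : A) :
    geomSeries T a = a + geomSeries T (T a) := by
  obtain ⟨N, hN⟩ := hT a
  have h1 := hT.geomSeries_apply (a := a) (N := N + 1) fun n hn => hN n (by omega)
  rw [Finset.sum_range_succ'] at h1
  rw [h1, hT.geomSeries_apply (a := T a) (N := N) fun n hn => ?_, add_comm]
  · simp only [pow_succ, Module.End.mul_apply, pow_zero, Module.End.one_apply]
  · rw [← Module.End.mul_apply, ← pow_succ]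
    exact hN _ (by omega)

/-- A vector fixed by T is fixed by all powers of T, some of which annihilate it. -/
theorem eq_zero (hT : LocallyNilpotent T) {a : A} (ha : a = T a) : a = 0 := by
  obtain ⟨N, hN⟩ := hT a
  rw [← hN N le_rfl]
  have : ∀ n, (T ^ n : Module.End K A) a = a := by
    intro n
    induction n with
    | zero => simp
    | succ n ih => rw [pow_succ, Module.End.mul_apply, ← ha, ih]
  exact (this N).symm

/-- Dual to `eq_zero`: a map unchanged by precomposition with T. -/
theorem linearMap_eq_zero (hT : LocallyNilpotent T) {E : A →ₗ[K] B} (hE : ∀ a, E a = E (T a)) :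
    E = 0 := by
  ext a
  obtain ⟨N, hN⟩ := hT a
  have : ∀ n, E ((T ^ n : Module.End K A) a) = E a := by
    intro n
    induction n with
    | zero => simp
    | succ n ih => rw [pow_succ', Module.End.mul_apply, ← hE, ih]
  rw [← this N, hN N le_rfl, map_zero, LinearMap.zero_apply]

theorem geomSeries_mem (hT : LocallyNilpotent T) {M : Submodule K A} (hM : ∀ a ∈ M, T a ∈ M)
    {a : A} (ha : a ∈ M) : geomSeries T a ∈ M := by
  obtain ⟨N, hN⟩ := hT a
  rw [hT.geomSeries_apply hN]
  refine M.sum_mem fun n hn => ?_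
  clear hN hn
  induction n with
  | zero => simpa using ha
  | succ n ih => rw [pow_succ', Module.End.mul_apply]; exact hM _ ih

theorem of_filtration {Fil : ℕ → Submodule K A} (hex : ∀ a, ∃ n, a ∈ Fil n)
    (h0 : ∀ a ∈ Fil 0, T a = 0) (h1 : ∀ n, ∀ a ∈ Fil (n + 1), T a ∈ Fil n) :
    LocallyNilpotent T := by
  intro a
  obtain ⟨N, hN⟩ := hex a
  -- N applications lead into step 0 of the filtration, and one more gives 0.
  refine ⟨N + 1, fun n hn => ?_⟩
  have h2 : (T ^ (N + 1) : Module.End K A) a = 0 := by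
    clear hn
    induction N generalizing a with
    | zero => simpa using h0 a hN
    | succ N ih => rw [pow_succ, Module.End.mul_apply]; exact ih _ (h1 N a hN)
  obtain ⟨k, rfl⟩ := Nat.exists_eq_add_of_le hn
  rw [add_comm, pow_add, Module.End.mul_apply, h2, map_zero]

end LocallyNilpotent

end LocallyFinite

/-! ### The homological perturbation lemma -/

section Perturbation

variable {K : Type*} [Field K] {A B : Type*} [AddCommGroup A] [Module K A]
  [AddCommGroup B] [Module K B] {𝒜 : ℤ → Submodule K A} {ℬ : ℤ → Submodule K B}
  {dA : A →ₗ[K] A} {dB : B →ₗ[K] B} {σ : A →ₗ[K] B} {τ : B →ₗ[K] A} {h δ : A →ₗ[K] A}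

namespace PerturbationConverges

variable (hconv : PerturbationConverges h δ)
include hconv

theorem left : LocallyNilpotent (h ∘ₗ δ) := fun a => by
  obtain ⟨N, hN⟩ := hconv a
  exact ⟨N, fun n hn => (hN n hn).1⟩

theorem right : LocallyNilpotent (δ ∘ₗ h) := fun a => by
  obtain ⟨N, hN⟩ := hconv a
  exact ⟨N, fun n hn => (hN n hn).2⟩

theorem perturbedInclusion_eq : perturbedInclusion τ h δ = geomSeries (h ∘ₗ δ) ∘ₗ τ :=
  locallyFiniteSum_comp hconv.left.support_finite τ LinearMap.id

theorem perturbedHomotopy_eq : perturbedHomotopy h δ = geomSeries (h ∘ₗ δ) ∘ₗ h :=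
  locallyFiniteSum_comp hconv.left.support_finite h LinearMap.id

theorem perturbedProjection_eq : perturbedProjection σ h δ = σ ∘ₗ geomSeries (δ ∘ₗ h) :=
  locallyFiniteSum_comp hconv.right.support_finite LinearMap.id σ

theorem perturbedDifferential_eq :
    perturbedDifferential dB σ τ h δ = dB + σ ∘ₗ δ ∘ₗ perturbedInclusion τ h δ := by
  rw [perturbedDifferential, hconv.perturbedInclusion_eq]
  congr 1
  exact locallyFiniteSum_comp hconv.left.support_finite τ (σ ∘ₗ δ)

theorem perturbedInclusion_apply (b : B) : perturbedInclusion τ h δ b =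
    τ b + h (δ (perturbedInclusion τ h δ b)) := by
  conv_lhs => rw [hconv.perturbedInclusion_eq, LinearMap.comp_apply, hconv.left.geomSeries_left]
  rw [hconv.perturbedInclusion_eq]
  rfl

theorem perturbedHomotopy_apply (a : A) : perturbedHomotopy h δ a =
    h a + h (δ (perturbedHomotopy h δ a)) := by
  conv_lhs => rw [hconv.perturbedHomotopy_eq, LinearMap.comp_apply, hconv.left.geomSeries_left]
  rw [hconv.perturbedHomotopy_eq]
  rfl

/-- With `perturbedProjection_sub` and `exists_eq_sub` this removes the series: on elements c - δhc
the perturbed maps are the unperturbed ones at c. -/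
theorem perturbedHomotopy_sub (a : A) : perturbedHomotopy h δ (a - δ (h a)) = h a := by
  have h1 := hconv.left.geomSeries_right (h a)
  rw [hconv.perturbedHomotopy_eq, LinearMap.comp_apply, map_sub, map_sub]
  rw [LinearMap.comp_apply] at h1
  rw [sub_eq_iff_eq_add]
  exact h1

theorem perturbedProjection_sub (a : A) : perturbedProjection σ h δ (a - δ (h a)) = σ a := by
  have h1 := hconv.right.geomSeries_right a
  rw [hconv.perturbedProjection_eq, LinearMap.comp_apply, map_sub, ← map_sub]
  rw [LinearMap.comp_apply] at h1
  congr 1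
  rw [map_sub, sub_eq_iff_eq_add]
  exact h1

theorem perturbedProjection_apply (a : A) : perturbedProjection σ h δ a =
    σ a + perturbedProjection σ h δ (δ (h a)) := by
  have := hconv.perturbedProjection_sub (σ := σ) a
  rwa [map_sub, sub_eq_iff_eq_add] at this

/-- The geometric series of δh inverts 1 - δh on the right. -/
theorem exists_eq_sub (a : A) : ∃ c, a = c - δ (h c) :=
  ⟨geomSeries (δ ∘ₗ h) a, eq_sub_of_add_eq (hconv.right.geomSeries_left a).symm⟩

end PerturbationConverges

variable (hc : IsContraction 𝒜 ℬ dA dB σ τ h) (hconv : PerturbationConverges h δ)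
include hc hconv

theorem h_perturbedInclusion (b : B) : h (perturbedInclusion τ h δ b) = 0 := by
  have h1 : ∀ a, h (h a) = 0 := fun a => congrArg (fun f => f a) hc.h_h
  have h2 : ∀ b, h (τ b) = 0 := fun b => congrArg (fun f => f b) hc.h_τ
  rw [hconv.perturbedInclusion_apply, map_add, h1, h2, add_zero]

theorem σ_perturbedInclusion (b : B) : σ (perturbedInclusion τ h δ b) = b := by
  have h1 : ∀ a, σ (h a) = 0 := fun a => congrArg (fun f => f a) hc.σ_h
  have h2 : ∀ b, σ (τ b) = b := fun b => congrArg (fun f => f b) hc.σ_τ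
  rw [hconv.perturbedInclusion_apply, map_add, h1, h2, add_zero]

theorem perturbedProjection_h (a : A) : perturbedProjection σ h δ (h a) = 0 := by
  have h1 : ∀ a, h (h a) = 0 := fun a => congrArg (fun f => f a) hc.h_h
  have h2 : ∀ a, σ (h a) = 0 := fun a => congrArg (fun f => f a) hc.σ_h
  rw [hconv.perturbedProjection_apply, h1, h2, map_zero, map_zero, add_zero]

theorem perturbedProjection_τ (b : B) : perturbedProjection σ h δ (τ b) = b := by
  have h1 : ∀ b, h (τ b) = 0 := fun b => congrArg (fun f => f b) hc.h_τ
  have h2 : ∀ b, σ (τ b) = b := fun b => congrArg (fun f => f b) hc.σ_τ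
  rw [hconv.perturbedProjection_apply, h1, h2, map_zero, map_zero, add_zero]

/-- The homological perturbation lemma. -/
theorem isContraction_perturbed (hδ : HasDegree 𝒜 𝒜 1 δ) (hsq : (dA + δ) ∘ₗ (dA + δ) = 0) :
    IsContraction 𝒜 ℬ (dA + δ) (perturbedDifferential dB σ τ h δ) (perturbedProjection σ h δ)
      (perturbedInclusion τ h δ) (perturbedHomotopy h δ) := by
  have hR := hconv.perturbedDifferential_eq (dB := dB) (σ := σ) (τ := τ)
  have hhF := h_perturbedInclusion hc hconv
  have hσF := σ_perturbedInclusion hc hconv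
  have hGh := perturbedProjection_h hc hconv
  have hG := hconv.perturbedProjection_apply (σ := σ)
  have hGs := hconv.perturbedProjection_sub (σ := σ)
  have hF := hconv.perturbedInclusion_apply (τ := τ)
  have hH := hconv.perturbedHomotopy_apply
  have hHs := hconv.perturbedHomotopy_sub
  have hh : ∀ a, h (h a) = 0 := fun a => congrArg (fun f => f a) hc.h_h
  have hσh : ∀ a, σ (h a) = 0 := fun a => congrArg (fun f => f a) hc.σ_h
  have hσd : ∀ a, σ (dA a) = dB (σ a) := fun a => congrArg (fun f => f a) hc.σ_comm
  have hhom : ∀ a, h (dA a) + dA (h a) = τ (σ a) - a := fun a =>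
    congrArg (fun f => f a) hc.homotopy
  have hdd : ∀ a, dA (dA a) = 0 := fun a => congrArg (fun f => f a) hc.dA_sq
  have hDD : ∀ a, (dA + δ) ((dA + δ) a) = 0 := fun a => congrArg (fun f => f a) hsq
  have hcross : ∀ a, dA (δ a) + δ (dA a) + δ (δ a) = 0 := fun a => by
    have := hDD a
    simp only [LinearMap.add_apply, map_add, hdd, zero_add] at this
    rw [← this]; abel
  have hdegl : HasDegree 𝒜 𝒜 0 (h ∘ₗ δ) := (hc.h_deg.comp hδ).congr (by norm_num)
  have hdegr : HasDegree 𝒜 𝒜 0 (δ ∘ₗ h) := (hδ.comp hc.h_deg).congr (by norm_num)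
  have hXdeg : HasDegree 𝒜 𝒜 0 (geomSeries (h ∘ₗ δ)) := fun i a ha => by
    rw [add_zero]
    exact hconv.left.geomSeries_mem (fun a ha => by simpa using hdegl i a ha) ha
  have hYdeg : HasDegree 𝒜 𝒜 0 (geomSeries (δ ∘ₗ h)) := fun i a ha => by
    rw [add_zero]
    exact hconv.right.geomSeries_mem (fun a ha => by simpa using hdegr i a ha) ha
  have hFdeg : HasDegree ℬ 𝒜 0 (perturbedInclusion τ h δ) := by
    rw [hconv.perturbedInclusion_eq]; exact (hXdeg.comp hc.τ_deg).congr (by norm_num)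
  have hGdeg : HasDegree 𝒜 ℬ 0 (perturbedProjection σ h δ) := by
    rw [hconv.perturbedProjection_eq]; exact (hc.σ_deg.comp hYdeg).congr (by norm_num)
  have hDdeg : HasDegree 𝒜 𝒜 1 (dA + δ) := hc.dA_deg.add hδ
  set F := perturbedInclusion τ h δ
  set G := perturbedProjection σ h δ
  set H := perturbedHomotopy h δ
  set R := perturbedDifferential dB σ τ h δ
  have hGF : ∀ b, G (F b) = b := fun b => by rw [hG, hhF, map_zero, map_zero, add_zero, hσF]
  have hGH : ∀ a, G (H a) = 0 := fun a => by rw [hH, map_add, hGh, hGh, add_zero]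
  have hHF : ∀ b, H (F b) = 0 := fun b => by
    have := hHs (F b)
    rwa [hhF, map_zero, sub_zero] at this
  have hHh : ∀ a, H (h a) = 0 := fun a => by
    have := hHs (h a)
    rwa [hh, map_zero, sub_zero] at this
  have hHH : ∀ a, H (H a) = 0 := fun a => by rw [hH a, map_add, hHh, hHh, add_zero]
  -- For a = c - δhc one has Ha = hc and Ga = σc. The fixed-point equations of H and F and the
  -- relation dδ + δd + δ² = 0 show that the defect e satisfies e = hδe, so e = 0 by nilpotence.
  have hhomotopy : ∀ a, H ((dA + δ) a) + (dA + δ) (H a) = F (G a) - a := by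
    intro a
    obtain ⟨c, rfl⟩ := hconv.exists_eq_sub a
    rw [hHs, hGs, ← sub_eq_zero]
    apply hconv.left.eq_zero
    have e1 := hH ((dA + δ) (c - δ (h c)))
    have e2 := hF (σ c)
    have e3 := hhom c
    have e4 := congrArg h (hcross (h c))
    have e5 : h (δ (H ((dA + δ) (c - δ (h c))))) =
        H ((dA + δ) (c - δ (h c))) - h ((dA + δ) (c - δ (h c))) := by
      rw [eq_sub_iff_add_eq, add_comm]; exact e1.symm
    have e6 : h (δ (F (σ c))) = F (σ c) - τ (σ c) := by
      rw [eq_sub_iff_add_eq, add_comm]; exact e2.symm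
    rw [LinearMap.comp_apply, map_sub δ, map_add δ, map_sub δ, map_sub h, map_add h, map_sub h, e5,
      e6]
    simp only [LinearMap.add_apply, map_add, map_sub, map_zero] at e4 ⊢
    rw [← sub_eq_zero] at e3 ⊢
    rw [show (0 : A) = (h (dA c) + dA (h c) - (τ (σ c) - c)) -
      (h (dA (δ (h c))) + h (δ (dA (h c))) + h (δ (δ (h c)))) by rw [e3, e4, sub_zero]]
    abel
  have hHDF : ∀ b, H ((dA + δ) (F b)) = 0 := by
    intro b
    have := hhomotopy (F b)
    rwa [hGF, sub_self, hHF, map_zero, add_zero] at this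
  -- HDF = 0 forces hDF = 0 by the equation for H. So G acts on DF as σ does, and σDF = dB + σδF is
  -- the series defining R.
  have hRb : ∀ b, R b = G ((dA + δ) (F b)) := by
    intro b
    have h1 := hH ((dA + δ) (F b))
    rw [hHDF, map_zero, map_zero, add_zero] at h1
    rw [hG, ← h1, map_zero, map_zero, add_zero, LinearMap.add_apply, map_add, hσd, hσF, hR]
    rfl
  -- The homotopy identity at DFb: both terms on its left vanish, so FG fixes DFb.
  have hDF : ∀ b, (dA + δ) (F b) = F (R b) := by
    intro b
    have := hhomotopy ((dA + δ) (F b))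
    rw [hDD, hHDF, map_zero, map_zero, add_zero] at this
    rw [hRb]
    exact (sub_eq_zero.1 this.symm).symm
  have hGDH : ∀ a, G ((dA + δ) (H a)) = 0 := by
    intro a
    have := congrArg G (hhomotopy a)
    rwa [map_add, hGH, zero_add, map_sub, hGF, sub_self] at this
  have hGD : ∀ a, G ((dA + δ) a) = R (G a) := by
    intro a
    have := congrArg (fun a => G ((dA + δ) a)) (hhomotopy a)
    simp only [map_add (dA + δ), map_sub (dA + δ), hDD, add_zero, map_sub G, ← hRb, hGDH] at this
    exact (sub_eq_zero.1 this.symm).symm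
  have hRR : ∀ b, R (R b) = 0 := fun b => by
    rw [hRb (R b), ← hDF, hDD, map_zero]
  exact
    { dA_deg := hDdeg
      dA_sq := hsq
      dB_deg := by
        have : R = G ∘ₗ (dA + δ) ∘ₗ F := LinearMap.ext hRb
        rw [this]
        exact (hGdeg.comp (hDdeg.comp hFdeg)).congr (by norm_num)
      dB_sq := LinearMap.ext hRR
      σ_deg := hGdeg
      σ_comm := LinearMap.ext hGD
      τ_deg := hFdeg
      τ_comm := LinearMap.ext fun b => (hDF b).symm
      h_deg := by
        rw [show H = _ from hconv.perturbedHomotopy_eq]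
        exact (hXdeg.comp hc.h_deg).congr (by norm_num)
      σ_τ := LinearMap.ext hGF
      homotopy := LinearMap.ext hhomotopy
      σ_h := LinearMap.ext hGH
      h_τ := LinearMap.ext hHF
      h_h := LinearMap.ext hHH }

end Perturbation

open GSym

/-! ### Calculus of coderivations and coalgebra morphisms -/

section Coderivation

variable {K : Type*} [Field K] {U V : Type*} [AddCommGroup U] [Module K U]
  [AddCommGroup V] [Module K V]
  {𝒰 : ℤ → Submodule K U} [DirectSum.Decomposition 𝒰]
  {𝒱 : ℤ → Submodule K V} [DirectSum.Decomposition 𝒱]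

theorem IsCoderivation.comul_apply {k : ℤ} {D : GSym 𝒰 →ₗ[K] GSym 𝒰} (hD : IsCoderivation 𝒰 k D)
    (a : GSym 𝒰) : comul 𝒰 (D a) = tensorDeriv (degree 𝒰) k D (comul 𝒰 a) :=
  congrArg (fun f => f a) hD.comul_comp

theorem IsCoderivation.sub {k : ℤ} {D E : GSym 𝒰 →ₗ[K] GSym 𝒰} (hD : IsCoderivation 𝒰 k D)
    (hE : IsCoderivation 𝒰 k E) : IsCoderivation 𝒰 k (D - E) where
  deg := hD.deg.sub hE.deg
  comul_comp := by
    ext a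
    change comul 𝒰 ((D - E) a) = tensorDeriv (degree 𝒰) k (D - E) (comul 𝒰 a)
    rw [tensorDeriv_sub, LinearMap.sub_apply, LinearMap.sub_apply, map_sub, hD.comul_apply,
      hE.comul_apply]

/-- The graded commutator of two coderivations is a coderivation. -/
theorem IsCoderivation.commutator {k l : ℤ} {D E : GSym 𝒰 →ₗ[K] GSym 𝒰}
    (hD : IsCoderivation 𝒰 k D) (hE : IsCoderivation 𝒰 l E) :
    IsCoderivation 𝒰 (k + l) (D ∘ₗ E - ksign K (k * l) • (E ∘ₗ D)) where
  deg := ((hD.deg.comp hE.deg).congr (add_comm _ _)).sub ((hE.deg.comp hD.deg).smul _)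
  comul_comp := by
    ext a
    change comul 𝒰 _ = tensorDeriv (degree 𝒰) (k + l) _ (comul 𝒰 a)
    rw [← tensorDeriv_comm (degree 𝒰) hD.deg hE.deg]
    simp only [LinearMap.sub_apply, LinearMap.smul_apply, LinearMap.comp_apply, map_sub, map_smul,
      hD.comul_apply, hE.comul_apply]

theorem IsCoalgebraMorphism.comul_apply {F : GSym 𝒰 →ₗ[K] GSym 𝒱}
    (hF : IsCoalgebraMorphism 𝒰 𝒱 F) (a : GSym 𝒰) :
    comul 𝒱 (F a) = TensorProduct.map F F (comul 𝒰 a) := by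
  have := congrArg (fun f => f a) hF.comul_comp
  rwa [koszulTensor_zero] at this

theorem map_tensorDeriv_eq_zero {k : ℤ} {L : GSym 𝒰 →ₗ[K] GSym 𝒰} {W W' : Type*}
    [AddCommGroup W] [Module K W] [AddCommGroup W'] [Module K W'] {A : GSym 𝒰 →ₗ[K] W}
    {B : GSym 𝒰 →ₗ[K] W'} (hA : ∀ a, A (L a) = 0) (hB : ∀ a, B (L a) = 0)
    (u : GSym 𝒰 ⊗[K] GSym 𝒰) : TensorProduct.map A B (tensorDeriv (degree 𝒰) k L u) = 0 := by
  induction u using TensorProduct.induction_on with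
  | zero => simp
  | add u v hu hv => rw [map_add, map_add, hu, hv, add_zero]
  | tmul a b => simp [tensorDeriv_tmul, hA, hB]

end Coderivation

/-! ### The symmetrized tensor trick is a semifull contraction -/

section SymContraction

variable {K : Type*} [Field K] [CharZero K] {U V : Type*} [AddCommGroup U] [Module K U]
  [AddCommGroup V] [Module K V]
  {𝒰 : ℤ → Submodule K U} [DirectSum.Decomposition 𝒰]
  {𝒱 : ℤ → Submodule K V}
  {dU : U →ₗ[K] U} {dV : V →ₗ[K] V} {g : U →ₗ[K] V} {f : V →ₗ[K] U} {h : U →ₗ[K] U}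

/-- In odd degree the graded commutator of D with itself is 2D², the derivation extending 2d² = 0.
-/
theorem GSym.IsDerivationExtending.comp_self {k : ℤ} (hk : ksign K (k * k) = -1) {d : U →ₗ[K] U}
    {D : GSym 𝒰 →ₗ[K] GSym 𝒰} (hD : IsDerivationExtending 𝒰 k d D) (hd : d ∘ₗ d = 0) :
    D ∘ₗ D = 0 := by
  have h := (hD.commutator hD).congr rfl (d' := 0) (by rw [hd]; simp)
  have h2 := h.unique (IsDerivationExtending.zero (k + k))
  ext a
  have h3 := congrArg (fun f => f a) h2
  simp only [hk, LinearMap.sub_apply, LinearMap.smul_apply, neg_smul, one_smul, sub_neg_eq_add,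
    ← two_smul K, LinearMap.zero_apply] at h3
  exact (smul_eq_zero.1 h3).resolve_left two_ne_zero

variable (𝒰) in
/-- The derivation of `S(U)` which is multiplication by the number of factors killed by the
idempotent `f g`, on products of elements that are fixed or killed by it. -/
def weightOp (g : U →ₗ[K] V) (f : V →ₗ[K] U) : GSym 𝒰 →ₗ[K] GSym 𝒰 :=
  extend 𝒰 (LinearMap.id - f ∘ₗ g)

namespace IsContraction

variable (hc : IsContraction 𝒰 𝒱 dU dV g f h)
include hc

omit [CharZero K] [DirectSum.Decomposition 𝒰] in
theorem hasDegree_idem : HasDegree 𝒰 𝒰 0 (f ∘ₗ g) := (hc.τ_deg.comp hc.σ_deg).congr (by simp)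

omit [CharZero K] [DirectSum.Decomposition 𝒰] in
theorem idem_comp_idem : (f ∘ₗ g) ∘ₗ (f ∘ₗ g) = f ∘ₗ g := by
  rw [LinearMap.comp_assoc, ← LinearMap.comp_assoc g, hc.σ_τ, LinearMap.id_comp]

omit [CharZero K] [DirectSum.Decomposition 𝒰] in
theorem h_comp_idem : h ∘ₗ (f ∘ₗ g) = 0 := by
  rw [← LinearMap.comp_assoc, hc.h_τ, LinearMap.zero_comp]

omit [CharZero K] [DirectSum.Decomposition 𝒰] in
theorem idem_comp_h : (f ∘ₗ g) ∘ₗ h = 0 := by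
  rw [LinearMap.comp_assoc, hc.σ_h, LinearMap.comp_zero]

omit [CharZero K] in
theorem derivation_weightOp :
    IsDerivationExtending 𝒰 0 (LinearMap.id - f ∘ₗ g) (weightOp 𝒰 g f) :=
  isDerivationExtending_extend (hasDegree_id.sub hc.hasDegree_idem)

omit [CharZero K] in
theorem derivation_h : IsDerivationExtending 𝒰 (-1) h (extend 𝒰 h) :=
  isDerivationExtending_extend hc.h_deg

omit [CharZero K] [DirectSum.Decomposition 𝒰] in
theorem map_idem : (map (f ∘ₗ g) hc.hasDegree_idem).toLinearMap =
    (map f hc.τ_deg).toLinearMap ∘ₗ (map g hc.σ_deg).toLinearMap := by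
  have : map (f ∘ₗ g) hc.hasDegree_idem = (map f hc.τ_deg).comp (map g hc.σ_deg) :=
    algHom_ext fun x => by simp [map_ι]
  rw [this]
  rfl

omit [CharZero K] in
theorem isWeightFiltration : IsWeightFiltration (weightOp 𝒰 g f)
    (map (f ∘ₗ g) hc.hasDegree_idem).toLinearMap (filt 𝒰) :=
  isWeightFiltration_filt _ hc.idem_comp_idem hc.derivation_weightOp

theorem derivation_h_sq (a : GSym 𝒰) : extend 𝒰 h (extend 𝒰 h a) = 0 :=
  congrArg (fun f => f a) (IsDerivationExtending.comp_self (ksign_odd (by decide)) hc.derivation_h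
    hc.h_h)

omit [CharZero K] in
-- The commutator is the derivation extending that of id - fg with h, which is 0 since h fg = fg h =
-- 0.
theorem weightOp_comp_derivation_h :
    weightOp 𝒰 g f ∘ₗ extend 𝒰 h = extend 𝒰 h ∘ₗ weightOp 𝒰 g f := by
  have h1 := ((hc.derivation_weightOp.commutator hc.derivation_h).congr rfl (d' := 0) (by
    rw [LinearMap.sub_comp, LinearMap.comp_sub, hc.h_comp_idem, hc.idem_comp_h]; simp)).unique
    (IsDerivationExtending.zero _)
  simpa [sub_eq_zero] using h1

section

variable {D : GSym 𝒰 →ₗ[K] GSym 𝒰} (hD : IsDerivationExtending 𝒰 1 dU D)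
  {E : GSym 𝒱 →ₗ[K] GSym 𝒱} (hE : IsDerivationExtending 𝒱 1 dV E)

include hD in
omit [CharZero K] in
theorem weightOp_comp_differential : weightOp 𝒰 g f ∘ₗ D = D ∘ₗ weightOp 𝒰 g f := by
  have h1 := ((hc.derivation_weightOp.commutator hD).congr rfl (d' := 0) (by
    have : (f ∘ₗ g) ∘ₗ dU = dU ∘ₗ (f ∘ₗ g) := by
      rw [LinearMap.comp_assoc, hc.σ_comm, ← LinearMap.comp_assoc, hc.τ_comm, LinearMap.comp_assoc]
    rw [LinearMap.sub_comp, LinearMap.comp_sub, this]; simp)).unique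
    (IsDerivationExtending.zero _)
  simpa [sub_eq_zero] using h1

include hD in
omit [CharZero K] in
-- The graded commutator extends hd + dh = fg - id. As a derivation this gives the weight operator
-- instead of S(f)S(g) - id, which is what division by the weight corrects.
theorem derivation_h_homotopy (a : GSym 𝒰) :
    extend 𝒰 h (D a) + D (extend 𝒰 h a) = -weightOp 𝒰 g f a := by
  have h1 := ((hc.derivation_h.commutator hD).congr (l := 0) (by simp)
    (d' := (-1 : K) • (LinearMap.id - f ∘ₗ g)) (by
      have := hc.homotopy
      simp [this])).unique (hc.derivation_weightOp.smul (-1))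
  have h2 := congrArg (fun f => f a) h1
  simpa using h2

omit [CharZero K] in
theorem map_g_derivation_h (a : GSym 𝒰) : map g hc.σ_deg (extend 𝒰 h a) = 0 :=
  congrArg (fun f => f a) (map_comp_derivation hc.σ_deg hc.derivation_h
    (IsDerivationExtending.zero (-1)) (by rw [hc.σ_h]; simp))

omit [CharZero K] in
theorem derivation_h_map_f [DirectSum.Decomposition 𝒱] (a : GSym 𝒱) :
    extend 𝒰 h (map f hc.τ_deg a) = 0 :=
  (congrArg (fun f => f a) (map_comp_derivation hc.τ_deg (IsDerivationExtending.zero (-1))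
    hc.derivation_h (by rw [hc.h_τ]; simp))).symm.trans (by simp)

omit [CharZero K] in
theorem map_g_weightOp (a : GSym 𝒰) : map g hc.σ_deg (weightOp 𝒰 g f a) = 0 :=
  congrArg (fun f => f a) (map_comp_derivation hc.σ_deg hc.derivation_weightOp
    (IsDerivationExtending.zero 0) (by
      rw [LinearMap.comp_sub, ← LinearMap.comp_assoc, hc.σ_τ]; simp))

omit [CharZero K] in
theorem weightOp_map_f [DirectSum.Decomposition 𝒱] (a : GSym 𝒱) :
    weightOp 𝒰 g f (map f hc.τ_deg a) = 0 :=
  (congrArg (fun f => f a) (map_comp_derivation hc.τ_deg (IsDerivationExtending.zero 0)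
    hc.derivation_weightOp (by
      rw [LinearMap.sub_comp, LinearMap.comp_assoc, hc.σ_τ]; simp))).symm.trans (by simp)

omit [CharZero K] [DirectSum.Decomposition 𝒰] in
theorem map_g_map_f (a : GSym 𝒱) : map g hc.σ_deg (map f hc.τ_deg a) = a := by
  have : (map g hc.σ_deg).comp (map f hc.τ_deg) = AlgHom.id K _ := algHom_ext fun x => by
    have : g (f x) = x := congrArg (fun f => f x) hc.σ_τ
    simp [map_ι, this]
  exact congrArg (fun f => f a) this

variable {P : GSym 𝒰 →ₗ[K] GSym 𝒰} (hP : IsPseudoInverse (weightOp 𝒰 g f) P)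
include hP

theorem symTrick_eq_comp : symTrick 𝒰 (f ∘ₗ g) h = P ∘ₗ extend 𝒰 h :=
  symTrick_eq hc.hasDegree_idem hc.idem_comp_idem hc.derivation_weightOp hc.derivation_h
    hc.h_comp_idem hc.weightOp_comp_derivation_h hP

omit [CharZero K] in
theorem derivation_h_pseudoInverse (a : GSym 𝒰) : extend 𝒰 h (P a) = P (extend 𝒰 h a) :=
  (congrArg (fun f => f a)
    (hc.isWeightFiltration.pseudoInverse_comm hP hc.weightOp_comp_derivation_h)).symm

theorem pseudoInverse_weightOp (a : GSym 𝒰) :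
    P (weightOp 𝒰 g f a) = a - map f hc.τ_deg (map g hc.σ_deg a) := by
  have := congrArg (fun f => f a) (hc.isWeightFiltration.pseudoInverse_comp hP)
  rw [hc.map_idem] at this
  exact this

theorem weightOp_pseudoInverse (a : GSym 𝒰) :
    weightOp 𝒰 g f (P a) = a - map f hc.τ_deg (map g hc.σ_deg a) := by
  rw [← hc.pseudoInverse_weightOp hP]
  exact (congrArg (fun f => f a) (hc.isWeightFiltration.pseudoInverse_comm hP rfl)).symm

include hD hE in
-- P commutes with L and D, so the homotopy identity is P applied to LD + DL = -N. The side
-- conditions come from L² = 0, S(g)L = 0 and LS(f) = 0.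
theorem isContraction_sym [DirectSum.Decomposition 𝒱] :
    IsContraction (degree 𝒰) (degree 𝒱) D E (map g hc.σ_deg).toLinearMap
    (map f hc.τ_deg).toLinearMap (P ∘ₗ extend 𝒰 h) where
  dA_deg := hD.hasDegree
  dA_sq := hD.comp_self (by simp) hc.dA_sq
  dB_deg := hE.hasDegree
  dB_sq := hE.comp_self (by simp) hc.dB_sq
  σ_deg := hasDegree_map hc.σ_deg
  σ_comm := map_comp_derivation hc.σ_deg hD hE hc.σ_comm
  τ_deg := hasDegree_map hc.τ_deg
  τ_comm := map_comp_derivation hc.τ_deg hE hD hc.τ_comm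
  h_deg := ((IsPseudoInverse.hasDegree hc.isWeightFiltration hP
    hc.derivation_weightOp.hasDegree).comp
    hc.derivation_h.hasDegree).congr (by simp)
  σ_τ := LinearMap.ext hc.map_g_map_f
  homotopy := by
    ext a
    have h1 : D (P (extend 𝒰 h a)) = P (D (extend 𝒰 h a)) :=
      (congrArg (fun f => f (extend 𝒰 h a)) (hc.isWeightFiltration.pseudoInverse_comm hP
        (hc.weightOp_comp_differential hD))).symm
    simp only [LinearMap.add_apply, LinearMap.sub_apply, LinearMap.comp_apply, h1, ← map_add,
      hc.derivation_h_homotopy hD, map_neg, hc.pseudoInverse_weightOp hP]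
    simp
  σ_h := by
    ext a
    simp only [LinearMap.comp_apply, ← hc.derivation_h_pseudoInverse hP]
    exact hc.map_g_derivation_h _
  h_τ := by
    ext a
    simp [hc.derivation_h_map_f]
  h_h := by
    ext a
    simp [hc.derivation_h_pseudoInverse hP, hc.derivation_h_sq]

theorem homotopy_derivation_h (a : GSym 𝒰) : extend 𝒰 h ((P ∘ₗ extend 𝒰 h) a) = 0 := by
  rw [LinearMap.comp_apply, hc.derivation_h_pseudoInverse hP, hc.derivation_h_sq, map_zero]

/-- The derivation L annihilates the images of the homotopy PL and of S(f), hence all their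
products; S(g) is multiplicative and annihilates the image of PL. -/
theorem isSemifullDGAlgebraContraction_sym [DirectSum.Decomposition 𝒱] (hD' : ∀ a b,
    D (a * b) = D a * b + signOp (degree 𝒰) 1 a * D b)
    (hE1 : E 1 = 0) (hD1 : D 1 = 0)
    (hsym : IsContraction (degree 𝒰) (degree 𝒱) D E (map g hc.σ_deg).toLinearMap
      (map f hc.τ_deg).toLinearMap (P ∘ₗ extend 𝒰 h)) :
    IsSemifullDGAlgebraContraction (degree 𝒰) (degree 𝒱) D E (map g hc.σ_deg).toLinearMap
      (map f hc.τ_deg).toLinearMap (P ∘ₗ extend 𝒰 h) where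
  toIsContraction := hsym
  dA_one := hD1
  dB_one := hE1
  dA_mul := hD'
  h_h_mul_h a b := by
    rw [LinearMap.comp_apply, hc.derivation_h.map_mul, hc.homotopy_derivation_h hP,
      hc.homotopy_derivation_h hP]
    simp
  h_h_mul_τ a x := by
    rw [LinearMap.comp_apply, hc.derivation_h.map_mul, hc.homotopy_derivation_h hP,
      AlgHom.toLinearMap_apply, hc.derivation_h_map_f]
    simp
  h_τ_mul_τ x y := by
    rw [LinearMap.comp_apply, hc.derivation_h.map_mul, AlgHom.toLinearMap_apply,
      AlgHom.toLinearMap_apply, hc.derivation_h_map_f, hc.derivation_h_map_f]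
    simp
  h_one := by rw [LinearMap.comp_apply, hc.derivation_h.map_one, map_zero]
  σ_h_mul_h a b := by
    have h1 := congrArg (fun f => f a) hsym.σ_h
    simp only [LinearMap.comp_apply, AlgHom.toLinearMap_apply, LinearMap.zero_apply] at h1 ⊢
    rw [_root_.map_mul, h1, zero_mul]
  σ_h_mul_τ a x := by
    have h1 := congrArg (fun f => f a) hsym.σ_h
    simp only [LinearMap.comp_apply, AlgHom.toLinearMap_apply, LinearMap.zero_apply] at h1 ⊢
    rw [_root_.map_mul, h1, zero_mul]
  σ_τ_mul_τ x y := by simp [hc.map_g_map_f]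
  σ_one := by simp

theorem counit_homotopy (a : GSym 𝒰) : counit 𝒰 (P a) = 0 :=
  congrArg (fun f => f a) (hc.isWeightFiltration.comp_pseudoInverse_eq_zero hP
    (counit_comp_coderivation hc.derivation_weightOp.isCoderivation))

include hD hE in
-- The homotopy is also LP with L a coderivation, so its coproduct lies in the image of L ⊗ id ± id
-- ⊗ L, where PL and S(g) vanish on the factor hit by L. For S(f) it suffices that it is a coalgebra
-- morphism.
theorem isSemifullDGCoalgebraContraction_sym [DirectSum.Decomposition 𝒱] :
    IsSemifullDGCoalgebraContraction 𝒰 𝒱 D E (map g hc.σ_deg).toLinearMap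
      (map f hc.τ_deg).toLinearMap (P ∘ₗ extend 𝒰 h) := by
  have hsym := hc.isContraction_sym hD hE hP
  have hσL : ∀ a, (map g hc.σ_deg).toLinearMap (extend 𝒰 h a) = 0 := hc.map_g_derivation_h
  have hhL : ∀ a, (P ∘ₗ extend 𝒰 h) (extend 𝒰 h a) = 0 := fun a => by
    rw [LinearMap.comp_apply, hc.derivation_h_sq, map_zero]
  -- The Koszul sign of ĥ ⊗ ĥ puts a sign operator into the first factor; L commutes with it up to a
  -- scalar.
  have hhsL : ∀ a, ((P ∘ₗ extend 𝒰 h) ∘ₗ signOp (degree 𝒰) (-1)) (extend 𝒰 h a) = 0 := fun a => by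
    have := congrArg (fun f => f a) (hc.derivation_h.hasDegree.signOp_comp (-1))
    simp only [LinearMap.comp_apply, LinearMap.smul_apply] at this ⊢
    rw [this, map_smul, hc.derivation_h_sq, smul_zero, map_zero]
  have hcomulh : ∀ a, comul 𝒰 ((P ∘ₗ extend 𝒰 h) a) =
      tensorDeriv (degree 𝒰) (-1) (extend 𝒰 h) (comul 𝒰 (P a)) := fun a => by
    rw [LinearMap.comp_apply, ← hc.derivation_h_pseudoInverse hP,
      hc.derivation_h.isCoderivation.comul_apply]
  have hτ := isCoalgebraMorphism_map hc.τ_deg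
  have hσ := isCoalgebraMorphism_map hc.σ_deg
  have hhτ : (P ∘ₗ extend 𝒰 h) ∘ₗ (map f hc.τ_deg).toLinearMap = 0 := hsym.h_τ
  have hsτ : signOp (degree 𝒰) (-1) ∘ₗ (map f hc.τ_deg).toLinearMap =
    (map f hc.τ_deg).toLinearMap ∘ₗ signOp (degree 𝒱) (-1) := hτ.deg.signOp_comm (-1)
  exact
  { toIsContraction := hsym
    dC_one := hD.map_one
    counit_dC := counit_comp_coderivation hD.isCoderivation
    dD_one := hE.map_one
    counit_dD := counit_comp_coderivation hE.isCoderivation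
    dC_coderivation := hD.isCoderivation
    σ_one := by simp
    counit_σ := hσ.counit_comp
    τ_one := by simp
    counit_τ := hτ.counit_comp
    h_one := by rw [LinearMap.comp_apply, hc.derivation_h.map_one, map_zero]
    counit_h := LinearMap.ext fun a => hc.counit_homotopy hP _
    h_h_comul_h := LinearMap.ext fun a => by
      rw [LinearMap.comp_apply, LinearMap.comp_apply, hcomulh]
      exact map_tensorDeriv_eq_zero hhsL hhL _
    h_σ_comul_h := LinearMap.ext fun a => by
      rw [LinearMap.comp_apply, LinearMap.comp_apply, hcomulh, koszulTensor_zero]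
      exact map_tensorDeriv_eq_zero hhL hσL _
    σ_σ_comul_h := LinearMap.ext fun a => by
      rw [LinearMap.comp_apply, LinearMap.comp_apply, hcomulh, koszulTensor_zero]
      exact map_tensorDeriv_eq_zero hσL hσL _
    h_h_comul_τ := LinearMap.ext fun a => by
      rw [LinearMap.comp_apply, LinearMap.comp_apply, hτ.comul_apply, koszulTensor,
        ← LinearMap.comp_apply, ← TensorProduct.map_comp, hhτ]
      simp
    h_σ_comul_τ := LinearMap.ext fun a => by
      rw [LinearMap.comp_apply, LinearMap.comp_apply, hτ.comul_apply, koszulTensor_zero,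
        ← LinearMap.comp_apply, ← TensorProduct.map_comp, hhτ]
      simp
    σ_σ_comul_τ := LinearMap.ext fun a => by
      rw [LinearMap.comp_apply, LinearMap.comp_apply, hτ.comul_apply, koszulTensor_zero,
        ← LinearMap.comp_apply, ← TensorProduct.map_comp, hsym.σ_τ]
      simp }

end

end IsContraction

end SymContraction

/-! ### Homotopy transfer -/

section Transfer

variable {K : Type*} [Field K] [CharZero K] {U V : Type*} [AddCommGroup U] [Module K U]
  [AddCommGroup V] [Module K V]
  {𝒰 : ℤ → Submodule K U} [DirectSum.Decomposition 𝒰]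
  {𝒱 : ℤ → Submodule K V} [DirectSum.Decomposition 𝒱]
  {dU : U →ₗ[K] U} {dV : V →ₗ[K] V} {g : U →ₗ[K] V} {f : V →ₗ[K] U} {h : U →ₗ[K] U}

/-- A coderivation of degree `1` without constant and linear Taylor coefficients. -/
structure IsReducedCoderivation (δ : GSym 𝒰 →ₗ[K] GSym 𝒰) : Prop where
  coderivation : IsCoderivation 𝒰 1 δ
  map_one : δ 1 = 0
  proj_ι : ∀ x, proj 𝒰 (δ (ι 𝒰 x)) = 0

namespace IsReducedCoderivation

variable {δ : GSym 𝒰 →ₗ[K] GSym 𝒰} (hδ : IsReducedCoderivation δ)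
include hδ

theorem mem_filt {n : ℕ} {a : GSym 𝒰} (ha : a ∈ filt 𝒰 (n + 1)) : δ a ∈ filt 𝒰 n :=
  coderivation_mem_filt hδ.coderivation hδ.map_one hδ.proj_ι ha

omit [CharZero K] in
theorem eq_zero_of_mem_filt_zero {a : GSym 𝒰} (ha : a ∈ filt 𝒰 0) : δ a = 0 := by
  obtain ⟨c, rfl⟩ := mem_filt_zero ha
  rw [map_smul, hδ.map_one, smul_zero]

omit [CharZero K] in
theorem counit_apply (a : GSym 𝒰) : counit 𝒰 (δ a) = 0 :=
  congrArg (fun f => f a) (counit_comp_coderivation hδ.coderivation)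

theorem locallyNilpotent_left {T : GSym 𝒰 →ₗ[K] GSym 𝒰}
    (hT : ∀ n, ∀ a ∈ filt 𝒰 n, T a ∈ filt 𝒰 n) : LocallyNilpotent (T ∘ₗ δ) :=
  LocallyNilpotent.of_filtration exists_mem_filt
    (fun a ha => by rw [LinearMap.comp_apply, hδ.eq_zero_of_mem_filt_zero ha, map_zero])
    fun n a ha => hT n _ (hδ.mem_filt ha)

theorem locallyNilpotent_right {T : GSym 𝒰 →ₗ[K] GSym 𝒰}
    (hT : ∀ n, ∀ a ∈ filt 𝒰 n, T a ∈ filt 𝒰 n) : LocallyNilpotent (δ ∘ₗ T) :=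
  LocallyNilpotent.of_filtration exists_mem_filt
    (fun a ha => hδ.eq_zero_of_mem_filt_zero (hT 0 a ha))
    fun n a ha => hδ.mem_filt (hT (n + 1) a ha)

end IsReducedCoderivation

namespace IsContraction

variable (hc : IsContraction 𝒰 𝒱 dU dV g f h)
  {D : GSym 𝒰 →ₗ[K] GSym 𝒰} {E : GSym 𝒱 →ₗ[K] GSym 𝒱}
  {P : GSym 𝒰 →ₗ[K] GSym 𝒰} (hP : IsPseudoInverse (weightOp 𝒰 g f) P)
  {δ : GSym 𝒰 →ₗ[K] GSym 𝒰} (hδ : IsReducedCoderivation δ)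
include hc

include hP in
omit [CharZero K] [DirectSum.Decomposition 𝒱] in
theorem homotopy_mem_filt (n : ℕ) (a : GSym 𝒰) (ha : a ∈ filt 𝒰 n) :
    (P ∘ₗ extend 𝒰 h) a ∈ filt 𝒰 n :=
  hc.isWeightFiltration.pseudoInverse_mem hP (hc.derivation_h.mem_filt ha)

include hP hδ in
omit [DirectSum.Decomposition 𝒱] in
theorem perturbationConverges : PerturbationConverges (P ∘ₗ extend 𝒰 h) δ := fun a => by
  obtain ⟨M, hM⟩ := hδ.locallyNilpotent_left (hc.homotopy_mem_filt hP) a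
  obtain ⟨N, hN⟩ := hδ.locallyNilpotent_right (hc.homotopy_mem_filt hP) a
  exact ⟨max M N, fun n hn =>
    ⟨hM n ((le_max_left _ _).trans hn), hN n ((le_max_right _ _).trans hn)⟩⟩

omit [CharZero K] [DirectSum.Decomposition 𝒱] in
/-- The graded commutator of the derivation extending `h` with `δ`. -/
theorem coderivation_commutator (hδ : IsReducedCoderivation δ) :
    IsCoderivation 𝒰 0 (extend 𝒰 h ∘ₗ δ + δ ∘ₗ extend 𝒰 h) := by
  have h1 := hc.derivation_h.isCoderivation.commutator hδ.coderivation
  have h2 : extend 𝒰 h ∘ₗ δ - ksign K (-1 * 1) • (δ ∘ₗ extend 𝒰 h) =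
      extend 𝒰 h ∘ₗ δ + δ ∘ₗ extend 𝒰 h := by
    ext a
    simp [ksign, neg_smul, sub_neg_eq_add]
  rw [h2] at h1
  exact h1

include hδ in
omit [DirectSum.Decomposition 𝒱] in
theorem commutator_mem_filt {n : ℕ} {a : GSym 𝒰} (ha : a ∈ filt 𝒰 (n + 1)) :
    (extend 𝒰 h ∘ₗ δ + δ ∘ₗ extend 𝒰 h) a ∈ filt 𝒰 n :=
  Submodule.add_mem _ (hc.derivation_h.mem_filt (hδ.mem_filt ha))
    (hδ.mem_filt (hc.derivation_h.mem_filt ha))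

include hδ in
omit [CharZero K] [DirectSum.Decomposition 𝒱] in
theorem commutator_eq_zero {a : GSym 𝒰} (ha : a ∈ filt 𝒰 0) :
    (extend 𝒰 h ∘ₗ δ + δ ∘ₗ extend 𝒰 h) a = 0 := by
  rw [LinearMap.add_apply, LinearMap.comp_apply, LinearMap.comp_apply,
    hδ.eq_zero_of_mem_filt_zero ha, hδ.eq_zero_of_mem_filt_zero (hc.derivation_h.mem_filt ha),
    map_zero, add_zero]

include hP

omit [DirectSum.Decomposition 𝒱] in
-- PLN = PNL = L - τσL, and σL = 0. Thus L is recovered from ĥ, and whatever annihilates the image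
-- of ĥ annihilates that of L.
theorem derivation_h_weightOp (a : GSym 𝒰) :
    (P ∘ₗ extend 𝒰 h) (weightOp 𝒰 g f a) = extend 𝒰 h a := by
  have h1 : extend 𝒰 h (weightOp 𝒰 g f a) = weightOp 𝒰 g f (extend 𝒰 h a) :=
    (congrArg (fun f => f a) hc.weightOp_comp_derivation_h).symm
  rw [LinearMap.comp_apply, h1, hc.pseudoInverse_weightOp hP, hc.map_g_derivation_h, map_zero,
    sub_zero]

omit [DirectSum.Decomposition 𝒱] in
theorem weightOp_homotopy (a : GSym 𝒰) :
    weightOp 𝒰 g f ((P ∘ₗ extend 𝒰 h) a) = extend 𝒰 h a := by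
  rw [LinearMap.comp_apply, hc.weightOp_pseudoInverse hP, hc.map_g_derivation_h, map_zero,
    sub_zero]

include hδ

/-- The perturbed projection is a morphism of coalgebras. -/
theorem isCoalgebraMorphism_perturbedProjection
    (hsym : IsContraction (degree 𝒰) (degree 𝒱) D E (map g hc.σ_deg).toLinearMap
      (map f hc.τ_deg).toLinearMap (P ∘ₗ extend 𝒰 h))
    (hdeg : HasDegree (degree 𝒰) (degree 𝒱) 0
      (perturbedProjection (map g hc.σ_deg).toLinearMap (P ∘ₗ extend 𝒰 h) δ)) :
    IsCoalgebraMorphism 𝒰 𝒱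
      (perturbedProjection (map g hc.σ_deg).toLinearMap (P ∘ₗ extend 𝒰 h) δ) := by
  have hconv := hc.perturbationConverges hP hδ
  have hG := hconv.perturbedProjection_apply (σ := (map g hc.σ_deg).toLinearMap)
  have hGh := perturbedProjection_h hsym hconv
  have hGτ := perturbedProjection_τ hsym hconv
  have hGeq := hconv.perturbedProjection_eq (σ := (map g hc.σ_deg).toLinearMap)
  have hτ := isCoalgebraMorphism_map hc.τ_deg
  have hσ := isCoalgebraMorphism_map hc.σ_deg
  set G := perturbedProjection (map g hc.σ_deg).toLinearMap (P ∘ₗ extend 𝒰 h) δ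
  set B := extend 𝒰 h ∘ₗ δ + δ ∘ₗ extend 𝒰 h with hB
  have hGL : ∀ a, G (extend 𝒰 h a) = 0 := fun a => by
    rw [← hc.derivation_h_weightOp hP, hGh]
  -- In G = σ + Gδĥ evaluated on N, σN = 0 and ĥN = L, so GN = GδL; the missing summand GLδ of GB is
  -- 0.
  have hGN : ∀ a, G (weightOp 𝒰 g f a) = G (B a) := fun a => by
    rw [hG (weightOp 𝒰 g f a), hc.derivation_h_weightOp hP, hB, LinearMap.add_apply,
      map_add, LinearMap.comp_apply, LinearMap.comp_apply, hGL, AlgHom.toLinearMap_apply,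
      hc.map_g_weightOp]
  have hBc : IsCoderivation 𝒰 0 B := hc.coderivation_commutator hδ
  have htens : ∀ u, TensorProduct.map G G (tensorDeriv (degree 𝒰) 0 (weightOp 𝒰 g f) u) =
      TensorProduct.map G G (tensorDeriv (degree 𝒰) 0 B u) := by
    intro u
    induction u using TensorProduct.induction_on with
    | zero => simp
    | add u v hu hv => simp only [map_add, hu, hv]
    | tmul a b => simp only [tensorDeriv_tmul, map_add, TensorProduct.map_tmul, hGN, signOp_zero]
  -- P preserves the length and B lowers it.
  have hBP : LocallyNilpotent (B ∘ₗ P) :=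
    LocallyNilpotent.of_filtration exists_mem_filt
      (fun a ha => hc.commutator_eq_zero hδ (hc.isWeightFiltration.pseudoInverse_mem hP ha))
      fun n a ha => hc.commutator_mem_filt hδ (hc.isWeightFiltration.pseudoInverse_mem hP ha)
  -- With a = τσa + NPa, the first part contributes nothing because Gτ = id and τ is a coalgebra
  -- morphism. In the second, N may be replaced by B, on S(U) and on its tensor square alike.
  have hzero : comul 𝒱 ∘ₗ G - TensorProduct.map G G ∘ₗ comul 𝒰 = 0 := by
    refine hBP.linearMap_eq_zero fun a => ?_
    have h1 : a = map f hc.τ_deg (map g hc.σ_deg a) + weightOp 𝒰 g f (P a) := by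
      rw [hc.weightOp_pseudoInverse hP]; abel
    have h2 : comul 𝒱 (G (map f hc.τ_deg (map g hc.σ_deg a))) =
        TensorProduct.map G G (comul 𝒰 (map f hc.τ_deg (map g hc.σ_deg a))) := by
      have h3 : G ∘ₗ (map f hc.τ_deg).toLinearMap = LinearMap.id := LinearMap.ext hGτ
      have h4 := hτ.comul_apply (map g hc.σ_deg a)
      rw [AlgHom.toLinearMap_apply] at h4
      rw [h4, ← LinearMap.comp_apply (TensorProduct.map G G), ← TensorProduct.map_comp, h3,
        TensorProduct.map_id]
      exact congrArg _ (hGτ _)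
    conv_lhs => rw [h1]
    simp only [LinearMap.sub_apply, LinearMap.comp_apply, map_add, h2, hGN,
      hc.derivation_weightOp.isCoderivation.comul_apply, htens, hBc.comul_apply]
    abel
  have hY1 : geomSeries (δ ∘ₗ P ∘ₗ extend 𝒰 h) 1 = 1 := by
    rw [hconv.right.geomSeries_right]
    simp [hc.derivation_h.map_one]
  have hYc : ∀ a, counit 𝒰 (geomSeries (δ ∘ₗ P ∘ₗ extend 𝒰 h) a) = counit 𝒰 a := fun a => by
    rw [hconv.right.geomSeries_left, map_add, LinearMap.comp_apply, hδ.counit_apply, add_zero]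
  exact
  { deg := hdeg
    map_one := by rw [hGeq, LinearMap.comp_apply, hY1]; simp
    counit_comp := by
      ext a
      rw [LinearMap.comp_apply, hGeq, LinearMap.comp_apply]
      exact (congrArg (fun m => m (geomSeries (δ ∘ₗ P ∘ₗ extend 𝒰 h) a)) hσ.counit_comp).trans
        (hYc a)
    comul_comp := by rw [koszulTensor_zero]; exact sub_eq_zero.1 hzero }

/-- The perturbed inclusion is a morphism of coalgebras. -/
theorem isCoalgebraMorphism_perturbedInclusion
    (hsym : IsContraction (degree 𝒰) (degree 𝒱) D E (map g hc.σ_deg).toLinearMap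
      (map f hc.τ_deg).toLinearMap (P ∘ₗ extend 𝒰 h))
    (hdeg : HasDegree (degree 𝒱) (degree 𝒰) 0
      (perturbedInclusion (map f hc.τ_deg).toLinearMap (P ∘ₗ extend 𝒰 h) δ)) :
    IsCoalgebraMorphism 𝒱 𝒰
      (perturbedInclusion (map f hc.τ_deg).toLinearMap (P ∘ₗ extend 𝒰 h) δ) := by
  have hconv := hc.perturbationConverges hP hδ
  have hF := hconv.perturbedInclusion_apply (τ := (map f hc.τ_deg).toLinearMap)
  have hσF := σ_perturbedInclusion hsym hconv
  have hFeq := hconv.perturbedInclusion_eq (τ := (map f hc.τ_deg).toLinearMap)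
  have hτ := isCoalgebraMorphism_map hc.τ_deg
  set F := perturbedInclusion (map f hc.τ_deg).toLinearMap (P ∘ₗ extend 𝒰 h) δ
  set B := extend 𝒰 h ∘ₗ δ + δ ∘ₗ extend 𝒰 h with hB
  have hLF : ∀ b, extend 𝒰 h (F b) = 0 := fun b => by
    rw [hF, map_add, AlgHom.toLinearMap_apply, hc.derivation_h_map_f,
      hc.homotopy_derivation_h hP, add_zero]
  -- In F = τ + ĥδF, Nτ = 0 and Nĥ = L give NF = LδF, which is BF because LF = 0.
  have hNF : ∀ b, weightOp 𝒰 g f (F b) = B (F b) := fun b => by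
    rw [hB, LinearMap.add_apply, LinearMap.comp_apply, LinearMap.comp_apply, hLF, map_zero,
      add_zero]
    conv_lhs => rw [hF, map_add, AlgHom.toLinearMap_apply, hc.weightOp_map_f,
      hc.weightOp_homotopy hP, zero_add]
  have hπF : ∀ b, map (f ∘ₗ g) hc.hasDegree_idem (F b) = map f hc.τ_deg b := fun b => by
    have h1 := congrArg (fun m => m (F b)) hc.map_idem
    simp only [LinearMap.comp_apply, AlgHom.toLinearMap_apply] at h1 hσF
    rw [h1, hσF]
  have hBc : IsCoderivation 𝒰 0 B := hc.coderivation_commutator hδ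
  have hw := isWeightFiltration_tensorFilt hc.hasDegree_idem hc.idem_comp_idem
    hc.derivation_weightOp
  -- The defect of F takes values in the tensor square, so the weight must be inverted there.
  obtain ⟨P₂, hP₂⟩ := hw.exists_isPseudoInverse
  have hPN := hw.pseudoInverse_comp hP₂
  have hB₂ : ∀ n, ∀ u ∈ tensorFilt 𝒰 (n + 1), tensorDeriv (degree 𝒰) 0 B u ∈ tensorFilt 𝒰 n := by
    intro n u hu
    refine tensorFilt_induction (A := tensorDeriv (degree 𝒰) 0 B) (fun i j hij a ha b hb => ?_) hu
    rw [tensorDeriv_tmul, signOp_zero, LinearMap.id_apply]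
    refine Submodule.add_mem _ ?_ ?_
    · rcases i with _ | i
      · rw [hc.commutator_eq_zero hδ ha, TensorProduct.zero_tmul]
        exact Submodule.zero_mem _
      · exact tmul_mem_tensorFilt (by omega) (hc.commutator_mem_filt hδ ha) hb
    · rcases j with _ | j
      · rw [hc.commutator_eq_zero hδ hb, TensorProduct.tmul_zero]
        exact Submodule.zero_mem _
      · exact tmul_mem_tensorFilt (by omega) ha (hc.commutator_mem_filt hδ hb)
  have hB₂0 : ∀ u ∈ tensorFilt 𝒰 0, tensorDeriv (degree 𝒰) 0 B u = 0 := by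
    intro u hu
    refine (Submodule.mem_bot K).1 (tensorFilt_induction (A := tensorDeriv (degree 𝒰) 0 B)
      (fun i j hij a ha b hb => ?_) hu)
    obtain ⟨rfl, rfl⟩ : i = 0 ∧ j = 0 := by omega
    rw [tensorDeriv_tmul, signOp_zero, hc.commutator_eq_zero hδ ha,
      hc.commutator_eq_zero hδ hb]
    simp
  have hPB : LocallyNilpotent (P₂ ∘ₗ tensorDeriv (degree 𝒰) 0 B) :=
    LocallyNilpotent.of_filtration exists_mem_tensorFilt
      (fun u hu => by rw [LinearMap.comp_apply, hB₂0 u hu, map_zero])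
      fun n u hu => hw.pseudoInverse_mem hP₂ (hB₂ n u hu)
  have hzero : ∀ b, comul 𝒰 (F b) - TensorProduct.map F F (comul 𝒱 b) = 0 := by
    intro b
    apply hPB.eq_zero
    have h1 : tensorDeriv (degree 𝒰) 0 (weightOp 𝒰 g f)
        (comul 𝒰 (F b) - TensorProduct.map F F (comul 𝒱 b)) = tensorDeriv (degree 𝒰) 0 B
        (comul 𝒰 (F b) - TensorProduct.map F F (comul 𝒱 b)) := by
      rw [map_sub, map_sub, ← hBc.comul_apply,
        ← hc.derivation_weightOp.isCoderivation.comul_apply, hNF]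
      congr 1
      generalize comul 𝒱 b = u
      induction u using TensorProduct.induction_on with
      | zero => simp
      | add u v hu hv => simp only [map_add, hu, hv]
      | tmul a b => simp only [tensorDeriv_tmul, TensorProduct.map_tmul, hNF, signOp_zero,
          LinearMap.id_apply]
    -- The weight 0 part of the defect: S(fg)F = τ as σF = id, and the defect of τ is zero.
    have h2 : TensorProduct.map (map (f ∘ₗ g) hc.hasDegree_idem).toLinearMap
        (map (f ∘ₗ g) hc.hasDegree_idem).toLinearMap
        (comul 𝒰 (F b) - TensorProduct.map F F (comul 𝒱 b)) = 0 := by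
      have h3 : (map (f ∘ₗ g) hc.hasDegree_idem).toLinearMap ∘ₗ F =
        (map f hc.τ_deg).toLinearMap := LinearMap.ext hπF
      rw [map_sub, ← (isCoalgebraMorphism_map hc.hasDegree_idem).comul_apply,
        ← LinearMap.comp_apply (TensorProduct.map _ _), ← TensorProduct.map_comp, h3,
        ← hτ.comul_apply]
      exact sub_eq_zero.2 (congrArg (comul 𝒰) (hπF b))
    -- P₂N₂ is the identity minus the weight 0 projection; on the defect this leaves P₂B₂ acting as
    -- the identity.
    have h4 := congrArg (fun m => m (comul 𝒰 (F b) - TensorProduct.map F F (comul 𝒱 b))) hPN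
    simp only [LinearMap.comp_apply, LinearMap.sub_apply, h1, h2, sub_zero, LinearMap.id_apply]
      at h4
    exact h4.symm
  have hX1 : geomSeries ((P ∘ₗ extend 𝒰 h) ∘ₗ δ) 1 = 1 := by
    rw [hconv.left.geomSeries_right]
    simp [hδ.map_one]
  have hXc : ∀ a, counit 𝒰 (geomSeries ((P ∘ₗ extend 𝒰 h) ∘ₗ δ) a) = counit 𝒰 a := fun a => by
    rw [hconv.left.geomSeries_left, map_add, LinearMap.comp_apply, LinearMap.comp_apply,
      hc.counit_homotopy hP, add_zero]
  exact
  { deg := hdeg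
    map_one := by rw [hFeq, LinearMap.comp_apply, AlgHom.toLinearMap_apply, map_one, hX1]
    counit_comp := by
      ext a
      rw [LinearMap.comp_apply, hFeq, LinearMap.comp_apply]
      exact (hXc _).trans (congrArg (fun f => f a) hτ.counit_comp)
    comul_comp := by
      rw [koszulTensor_zero]
      exact LinearMap.ext fun b => sub_eq_zero.1 (hzero b) }

end IsContraction

omit [CharZero K] in
/-- The transferred structure `R = G Q F` is a coderivation. -/
theorem isLInftyStructure_transfer {Q : GSym 𝒰 →ₗ[K] GSym 𝒰} (hQ : IsLInftyStructure 𝒰 Q)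
    {R : GSym 𝒱 →ₗ[K] GSym 𝒱} {G : GSym 𝒰 →ₗ[K] GSym 𝒱} {F : GSym 𝒱 →ₗ[K] GSym 𝒰}
    {H : GSym 𝒰 →ₗ[K] GSym 𝒰} (hc : IsContraction (degree 𝒰) (degree 𝒱) Q R G F H)
    (hG : IsCoalgebraMorphism 𝒰 𝒱 G) (hF : IsCoalgebraMorphism 𝒱 𝒰 F) :
    IsLInftyStructure 𝒱 R := by
  have hGF : ∀ b, G (F b) = b := fun b => congrArg (fun f => f b) hc.σ_τ
  have hR : ∀ b, R b = G (Q (F b)) := fun b => by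
    have h1 : G (Q (F b)) = R (G (F b)) := congrArg (fun f => f (F b)) hc.σ_comm
    rw [h1, hGF]
  refine ⟨⟨hc.dB_deg, ?_⟩, by rw [hR, hF.map_one, hQ.map_one, map_zero], hc.dB_sq⟩
  ext b
  change comul 𝒱 (R b) = tensorDeriv (degree 𝒱) 1 R (comul 𝒱 b)
  rw [hR, hG.comul_apply, hQ.coderivation.comul_apply, hF.comul_apply]
  -- The remaining claim concerns (G ⊗ G)(Q ⊗ id ± id ⊗ Q)(F ⊗ F), where GF = id and GQF = R.
  generalize comul 𝒱 b = u
  induction u using TensorProduct.induction_on with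
  | zero => simp
  | add u v hu hv => simp only [map_add, hu, hv]
  | tmul a b =>
    have h1 : signOp (degree 𝒰) 1 (F a) = F (signOp (degree 𝒱) 1 a) :=
      congrArg (fun f => f a) (hF.deg.signOp_comm 1)
    simp [tensorDeriv_tmul, hR, hGF, h1]

end Transfer

/-! ### Linear Taylor coefficients -/

section Linear

variable {K : Type*} [Field K] {U V : Type*} [AddCommGroup U] [Module K U]
  [AddCommGroup V] [Module K V] {𝒰 : ℤ → Submodule K U} {𝒱 : ℤ → Submodule K V}

theorem taylor_one (F : GSym 𝒰 →ₗ[K] GSym 𝒱) (x : U) : taylor F ![x] = proj 𝒱 (F (ι 𝒰 x)) := by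
  simp [taylor, monomial]

variable [DirectSum.Decomposition 𝒰] [DirectSum.Decomposition 𝒱]

omit [DirectSum.Decomposition 𝒱] in
-- In p applied to the Leibniz rule only terms with a scalar cofactor count, and the counit of D b
-- is zero.
theorem GSym.IsDerivationExtending.proj_apply {k : ℤ} {d : U →ₗ[K] U} {D : GSym 𝒰 →ₗ[K] GSym 𝒰}
    (hD : IsDerivationExtending 𝒰 k d D) (a : GSym 𝒰) : proj 𝒰 (D a) = d (proj 𝒰 a) := by
  have h1 : ∀ a, counit 𝒰 (D a) = 0 := fun a =>
    congrArg (fun m => m a) (counit_comp_coderivation hD.isCoderivation)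
  have h2 : proj 𝒰 ∘ₗ D = d ∘ₗ proj 𝒰 :=
    linearMap_ext (by simp [hD.map_one, proj_one]) fun i x hx b _ => by
      simp [hD.map_ι_mul hx, proj_ι_mul, h1]
  exact congrArg (fun m => m a) h2

variable [CharZero K]
  {dU : U →ₗ[K] U} {dV : V →ₗ[K] V} {g : U →ₗ[K] V} {f : V →ₗ[K] U} {h : U →ₗ[K] U}

omit [CharZero K] [DirectSum.Decomposition 𝒱] in
theorem IsLInftyStructure.isReducedCoderivation_sub {Q D : GSym 𝒰 →ₗ[K] GSym 𝒰}
    (hQ : IsLInftyStructure 𝒰 Q) (hQ1 : ∀ x : U, taylor Q ![x] = dU x)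
    (hD : IsDerivationExtending 𝒰 1 dU D) : IsReducedCoderivation (Q - D) where
  coderivation := hQ.coderivation.sub hD.isCoderivation
  map_one := by rw [LinearMap.sub_apply, hQ.map_one, hD.map_one, sub_zero]
  proj_ι x := by
    rw [LinearMap.sub_apply, map_sub, hD.proj_apply, proj_ι, ← taylor_one, hQ1, sub_self]

namespace IsContraction

variable (hc : IsContraction 𝒰 𝒱 dU dV g f h)
  {P : GSym 𝒰 →ₗ[K] GSym 𝒰} (hP : IsPseudoInverse (weightOp 𝒰 g f) P)
  {δ : GSym 𝒰 →ₗ[K] GSym 𝒰} (hδ : IsReducedCoderivation δ)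
include hc hP

/-- pLP = hpP, and hp = hpN because hf = 0. So hpP = hpNP = hp(id - S(f)S(g)) = hp. -/
theorem proj_homotopy (a : GSym 𝒰) :
    proj 𝒰 ((P ∘ₗ extend 𝒰 h) a) = h (proj 𝒰 a) := by
  have h1 : ∀ x, h (f x) = 0 := fun x => congrArg (fun m => m x) hc.h_τ
  have h2 : ∀ b, h (proj 𝒰 (weightOp 𝒰 g f b)) = h (proj 𝒰 b) := fun b => by
    rw [hc.derivation_weightOp.proj_apply]
    simp [h1]
  rw [LinearMap.comp_apply, ← hc.derivation_h_pseudoInverse hP, hc.derivation_h.proj_apply, ← h2,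
    hc.weightOp_pseudoInverse hP, map_sub, proj_map, map_sub, h1, sub_zero]

include hδ

theorem proj_perturbedInclusion (b : GSym 𝒱) :
    proj 𝒰 (perturbedInclusion (map f hc.τ_deg).toLinearMap (P ∘ₗ extend 𝒰 h) δ b) =
      f (proj 𝒱 b) + h (proj 𝒰 (δ (perturbedInclusion (map f hc.τ_deg).toLinearMap
        (P ∘ₗ extend 𝒰 h) δ b))) := by
  conv_lhs => rw [(hc.perturbationConverges hP hδ).perturbedInclusion_apply]
  rw [map_add, hc.proj_homotopy hP, AlgHom.toLinearMap_apply, proj_map]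

omit [DirectSum.Decomposition 𝒱] in
-- F preserves length at most 1, and there pδ vanishes.
theorem proj_comp_perturbedInclusion_ι (x : V) :
    proj 𝒰 (δ (perturbedInclusion (map f hc.τ_deg).toLinearMap (P ∘ₗ extend 𝒰 h) δ (ι 𝒱 x))) =
      0 := by
  have hconv := hc.perturbationConverges hP hδ
  refine proj_coderivation_filt_one hδ.map_one hδ.proj_ι ?_
  rw [hconv.perturbedInclusion_eq]
  refine hconv.left.geomSeries_mem (fun a ha => ?_) (map_mem_filt hc.τ_deg (ι_mem_filt x))
  exact hc.homotopy_mem_filt hP 1 _ (filt_mono zero_le_one (hδ.mem_filt ha))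

theorem taylor_perturbedInclusion (x : V) :
    taylor (perturbedInclusion (map f hc.τ_deg).toLinearMap (P ∘ₗ extend 𝒰 h) δ) ![x] = f x := by
  rw [taylor_one, hc.proj_perturbedInclusion hP hδ, hc.proj_comp_perturbedInclusion_ι hP hδ,
    proj_ι, map_zero, add_zero]

theorem taylor_perturbedDifferential {E : GSym 𝒱 →ₗ[K] GSym 𝒱}
    (hE : IsDerivationExtending 𝒱 1 dV E) (x : V) :
    taylor (perturbedDifferential E (map g hc.σ_deg).toLinearMap (map f hc.τ_deg).toLinearMap
      (P ∘ₗ extend 𝒰 h) δ) ![x] = dV x := by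
  rw [taylor_one, (hc.perturbationConverges hP hδ).perturbedDifferential_eq, LinearMap.add_apply,
    map_add, hE.proj_apply, LinearMap.comp_apply, LinearMap.comp_apply, AlgHom.toLinearMap_apply,
    proj_map, hc.proj_comp_perturbedInclusion_ι hP hδ, proj_ι, map_zero, add_zero]

omit [DirectSum.Decomposition 𝒱] in
theorem taylor_perturbedProjection (x : U) :
    taylor (perturbedProjection (map g hc.σ_deg).toLinearMap (P ∘ₗ extend 𝒰 h) δ) ![x] =
      g x := by
  have hconv := hc.perturbationConverges hP hδ
  -- δĥx has length 0, hence is a scalar, and pG(1) = 0; only S(g)x contributes.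
  obtain ⟨c, hc0⟩ := mem_filt_zero
    (hδ.mem_filt (hc.homotopy_mem_filt hP 1 _ (ι_mem_filt x)))
  have h1 : proj 𝒱 (perturbedProjection (map g hc.σ_deg).toLinearMap (P ∘ₗ extend 𝒰 h) δ 1) =
      0 := by
    rw [hconv.perturbedProjection_apply]
    simp [hc.derivation_h.map_one, proj_one]
  rw [taylor_one, hconv.perturbedProjection_apply, map_add, hc0, map_smul, map_smul, h1,
    AlgHom.toLinearMap_apply, proj_map, proj_ι, smul_zero, add_zero]

end IsContraction

end Linear

namespace GSym

/-! ### Iterated convolution on monomials -/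

section MultiConv

variable {K : Type*} [Field K] {V : Type*} [AddCommGroup V] [Module K V]
  {𝒱 : ℤ → Submodule K V} [DirectSum.Decomposition 𝒱] {C : Type*} [Ring C] [Algebra K C]

theorem conv_sum {ι' : Type*} (s : Finset ι') (A : GSym 𝒱 →ₗ[K] C)
    (B : ι' → GSym 𝒱 →ₗ[K] C) (b : GSym 𝒱) :
    conv A (∑ j ∈ s, B j) b = ∑ j ∈ s, conv A (B j) b := by
  simp only [conv, LinearMap.comp_apply]
  generalize comul 𝒱 b = u
  induction u using TensorProduct.induction_on with
  | zero => simp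
  | add u v hu hv => simp only [map_add, hu, hv, Finset.sum_add_distrib]
  | tmul a b => simp [Finset.mul_sum]

/-- The convolution product of `k` linear maps (without signs). -/
def multiConv : {k : ℕ} → (Fin k → GSym 𝒱 →ₗ[K] C) → GSym 𝒱 →ₗ[K] C
  | 0, _ => (counit 𝒱).toLinearMap.smulRight 1
  | _ + 1, A => conv (A 0) (multiConv fun j => A j.succ)

/-- The linear maps `a ↦ A_l(± a)` for `l < j`, `a ↦ A_j(x a)`, and `A_l` for `l > j`. -/
def insertFactor {k : ℕ} (A : Fin k → GSym 𝒱 →ₗ[K] C) (i : ℤ) (x : V) (j l : Fin k) :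
    GSym 𝒱 →ₗ[K] C :=
  if l < j then A l ∘ₗ signOp (degree 𝒱) i
  else if l = j then A l ∘ₗ LinearMap.mulLeft K (ι 𝒱 x) else A l

theorem multiConv_ι_mul {k : ℕ} (A : Fin k → GSym 𝒱 →ₗ[K] C) {i : ℤ} {x : V} (hx : x ∈ 𝒱 i)
    (b : GSym 𝒱) : multiConv A (ι 𝒱 x * b) = ∑ j, multiConv (insertFactor A i x j) b := by
  induction k generalizing b with
  | zero => simp [multiConv]
  | succ k ih =>
    have h1 : multiConv (fun j => A j.succ) ∘ₗ LinearMap.mulLeft K (ι 𝒱 x) =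
        ∑ j, multiConv (insertFactor (fun j => A j.succ) i x j) := by
      ext b
      simp [ih]
    rw [multiConv, conv_ι_mul _ _ hx, h1, conv_sum, Fin.sum_univ_succ]
    congr 1
    refine Finset.sum_congr rfl fun j _ => ?_
    simp [multiConv, insertFactor]
    rfl

/-- The sign of the reordering of homogeneous elements of degrees `p₁, …, pₙ` that sorts them by
the values of `c`. -/
def colorSign {n k : ℕ} (p : Fin n → ℤ) (c : Fin n → Fin k) : ℤˣ :=
  ∏ i, ∏ j, if i < j ∧ c j < c i then (-1 : ℤˣ) ^ (p i * p j) else 1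

variable (𝒱) in
/-- The product of the `xᵢ` with `c i = j`, in increasing order of the indices. -/
def colorFactor {n k : ℕ} (x : Fin n → V) (c : Fin n → Fin k) (j : Fin k) : GSym 𝒱 :=
  (((List.finRange n).filter fun i => c i = j).map fun i => ι 𝒱 (x i)).prod

theorem colorSign_cons {n k : ℕ} (p : Fin (n + 1) → ℤ) (a : Fin k) (c : Fin n → Fin k) :
    colorSign p (Fin.cons a c : Fin (n + 1) → Fin k) =
      (∏ l, if c l < a then (-1 : ℤˣ) ^ (p 0 * p l.succ) else 1) *
        colorSign (fun i => p i.succ) c := by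
  simp [colorSign, Fin.prod_univ_succ]

omit [DirectSum.Decomposition 𝒱] in
theorem colorFactor_cons {n k : ℕ} (x : Fin (n + 1) → V) (a : Fin k) (c : Fin n → Fin k)
    (j : Fin k) : colorFactor 𝒱 x (Fin.cons a c : Fin (n + 1) → Fin k) j =
      if j = a then ι 𝒱 (x 0) * colorFactor 𝒱 (fun i => x i.succ) c j
      else colorFactor 𝒱 (fun i => x i.succ) c j := by
  have h1 : (((List.finRange n).map Fin.succ).filter fun i =>
      (Fin.cons a c : Fin (n + 1) → Fin k) i = j) =
        ((List.finRange n).filter fun i => c i = j).map Fin.succ := by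
    rw [List.filter_map]
    congr 1
  rw [colorFactor, List.finRange_succ, List.filter_cons, h1]
  by_cases h : a = j
  · subst h
    simp [colorFactor, Function.comp_def]
  · simp [h, Ne.symm h, colorFactor, Function.comp_def]

omit [DirectSum.Decomposition 𝒱] in
theorem colorFactor_mem_degree {n k : ℕ} {p : Fin n → ℤ} {x : Fin n → V}
    (hx : ∀ i, x i ∈ 𝒱 (p i)) (c : Fin n → Fin k) (j : Fin k) :
    colorFactor 𝒱 x c j ∈ degree 𝒱 (∑ i with c i = j, p i) := by
  induction n with
  | zero => simpa [colorFactor] using SetLike.GradedOne.one_mem (A := degree 𝒱)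
  | succ n ih =>
    have h1 := ih (fun i => hx i.succ) (fun i => c i.succ)
    have h2 := colorFactor_cons (𝒱 := 𝒱) x (c 0) (fun i => c i.succ) j
    rw [show (Fin.cons (c 0) fun i => c i.succ : Fin (n + 1) → Fin k) = c from
      Fin.cons_self_tail c] at h2
    rw [h2, Finset.sum_filter, Fin.sum_univ_succ]
    rw [Finset.sum_filter] at h1
    by_cases h : j = c 0
    · rw [if_pos h, if_pos h.symm]
      exact SetLike.mul_mem_graded (ι_mem_degree 𝒱 (hx 0)) h1
    · rw [if_neg h, if_neg (Ne.symm h), zero_add]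
      exact h1

theorem prod_ofFn_smul {M : Type*} [Ring M] {k : ℕ} (s : Fin k → ℤˣ) (a : Fin k → M) :
    (List.ofFn fun j => s j • a j).prod = (∏ j, s j) • (List.ofFn a).prod := by
  induction k with
  | zero => simp
  | succ k ih =>
    simp only [List.ofFn_succ, List.prod_cons, Fin.prod_univ_succ, ih, smul_mul_assoc,
      mul_smul_comm, smul_smul, mul_comm (s 0)]

/-- The iterated coproduct sends each factor to one of k slots. The sum over colorings records these
choices, and the sign that of sorting the factors by slot. -/
theorem multiConv_monomial {n k : ℕ} (A : Fin k → GSym 𝒱 →ₗ[K] C) {p : Fin n → ℤ} {x : Fin n → V}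
    (hx : ∀ i, x i ∈ 𝒱 (p i)) : multiConv A (monomial 𝒱 x) =
      ∑ c : Fin n → Fin k, colorSign p c • (List.ofFn fun j => A j (colorFactor 𝒱 x c j)).prod := by
  induction n generalizing A with
  | zero =>
    have h1 : ∀ {k : ℕ} (A : Fin k → GSym 𝒱 →ₗ[K] C), multiConv A 1 =
        (List.ofFn fun j => A j 1).prod := by
      intro k
      induction k with
      | zero => simp [multiConv]
      | succ k ih => intro A; rw [multiConv, conv_one, ih, List.ofFn_succ, List.prod_cons]
    simp [h1, colorSign, colorFactor]
  | succ n ih =>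
    rw [monomial_succ, multiConv_ι_mul A (hx 0), ← (Fin.consEquiv fun _ => Fin k).sum_comp,
      Fintype.sum_prod_type]
    refine Finset.sum_congr rfl fun a _ => ?_
    rw [ih _ fun i => hx i.succ]
    refine Finset.sum_congr rfl fun c _ => ?_
    change _ = colorSign p (Fin.cons a c : Fin (n + 1) → Fin k) • (List.ofFn fun j =>
      A j (colorFactor 𝒱 x (Fin.cons a c : Fin (n + 1) → Fin k) j)).prod
    -- To reach slot a, the new first factor passes everything placed in the slots before a.
    have h1 : ∀ j, insertFactor A (p 0) (x 0) a j (colorFactor 𝒱 (fun i => x i.succ) c j) =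
        (if j < a then ∏ l with c l = j, (-1 : ℤˣ) ^ (p 0 * p l.succ) else 1) •
          A j (colorFactor 𝒱 x (Fin.cons a c : Fin (n + 1) → Fin k) j) := by
      intro j
      rw [insertFactor, colorFactor_cons]
      rcases lt_trichotomy j a with h | h | h
      · rw [if_pos h, if_pos h, if_neg h.ne, LinearMap.comp_apply,
          signOp_apply _ _ (colorFactor_mem_degree (fun i => hx i.succ) c j), Finset.mul_sum,
          neg_one_zpow_sum, Units.smul_def, map_zsmul, Units.smul_def]
      · subst h
        simp
      · simp [h.not_gt, h.ne']
    have h2 : (∏ j, if j < a then ∏ l with c l = j, (-1 : ℤˣ) ^ (p 0 * p l.succ) else 1) =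
        ∏ l, if c l < a then (-1 : ℤˣ) ^ (p 0 * p l.succ) else 1 := by
      rw [← Finset.prod_fiberwise Finset.univ c]
      refine Finset.prod_congr rfl fun j _ => ?_
      by_cases h : j < a
      · rw [if_pos h]
        refine Finset.prod_congr rfl fun l hl => ?_
        rw [(Finset.mem_filter.1 hl).2, if_pos h]
      · rw [if_neg h]
        refine (Finset.prod_eq_one fun l hl => ?_).symm
        rw [(Finset.mem_filter.1 hl).2, if_neg h]
    simp only [h1, prod_ofFn_smul, h2, colorSign_cons, smul_smul]
    rw [mul_comm]

end MultiConv

/-! ### Coalgebra morphisms as exponentials -/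

section Exponential

variable {K : Type*} [Field K] [CharZero K] {U V : Type*} [AddCommGroup U] [Module K U]
  [AddCommGroup V] [Module K V]
  {𝒰 : ℤ → Submodule K U} [DirectSum.Decomposition 𝒰]
  {𝒱 : ℤ → Submodule K V} [DirectSum.Decomposition 𝒱]

variable (F : GSym 𝒱 →ₗ[K] GSym 𝒰)

/-- The `k`-th convolution power of the corestriction of `F`. -/
def corestrictionPow (k : ℕ) : GSym 𝒱 →ₗ[K] GSym 𝒰 :=
  multiConv fun _ : Fin k => ι 𝒰 ∘ₗ proj 𝒰 ∘ₗ F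

omit [CharZero K] [DirectSum.Decomposition 𝒰] in
theorem corestrictionPow_succ (k : ℕ) : corestrictionPow F (k + 1) =
    conv (ι 𝒰 ∘ₗ proj 𝒰 ∘ₗ F) (corestrictionPow F k) := rfl

omit [CharZero K] in
-- A k-fold product of generators has length k.
theorem euler_corestrictionPow (k : ℕ) (a : GSym 𝒱) :
    euler 𝒰 (corestrictionPow F k a) = (k : K) • corestrictionPow F k a := by
  induction k generalizing a with
  | zero => simp [corestrictionPow, multiConv, (isDerivationExtending_euler 𝒰).map_one]
  | succ k ih =>
    simp only [corestrictionPow_succ, conv, LinearMap.comp_apply]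
    generalize comul 𝒱 a = u
    induction u using TensorProduct.induction_on with
    | zero => simp
    | add u v hu hv => simp only [map_add, hu, hv, smul_add]
    | tmul a b =>
      simp only [TensorProduct.map_tmul, LinearMap.comp_apply, LinearMap.mul'_apply, euler_ι_mul,
        ih, mul_smul_comm, Nat.cast_succ, add_smul, one_smul]
      rw [add_comm]

omit [CharZero K] [DirectSum.Decomposition 𝒰] in
theorem counit_conv_corestriction (B : GSym 𝒱 →ₗ[K] GSym 𝒰) (a : GSym 𝒱) :
    counit 𝒰 (conv (ι 𝒰 ∘ₗ proj 𝒰 ∘ₗ F) B a) = 0 := by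
  simp only [conv, LinearMap.comp_apply]
  generalize comul 𝒱 a = u
  induction u using TensorProduct.induction_on with
  | zero => simp
  | add u v hu hv => simp only [map_add, hu, hv, add_zero]
  | tmul a b => simp

variable {F}

omit [CharZero K] in
-- Comultiplicativity moves the coproduct in the Euler operator to the source. This is the
-- differential equation of the exponential.
theorem _root_.HomotopyTransfer.IsCoalgebraMorphism.euler_apply (hF : IsCoalgebraMorphism 𝒱 𝒰 F)
    (a : GSym 𝒱) : euler 𝒰 (F a) = conv (ι 𝒰 ∘ₗ proj 𝒰 ∘ₗ F) F a := by
  rw [GSym.euler_apply, hF.comul_apply, conv, LinearMap.comp_apply, LinearMap.comp_apply,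
    ← LinearMap.comp_apply (TensorProduct.map _ _), ← TensorProduct.map_comp, LinearMap.id_comp,
    LinearMap.comp_assoc]

/-- A morphism of coalgebras is the convolution exponential of its corestriction. -/
theorem _root_.HomotopyTransfer.IsCoalgebraMorphism.eq_sum (hF : IsCoalgebraMorphism 𝒱 𝒰 F)
    {n N : ℕ} (hn : n ≤ N) {a : GSym 𝒱} (ha : a ∈ filt 𝒱 n) :
    F a = ∑ k ∈ Finset.range (N + 1), (k.factorial : K)⁻¹ • corestrictionPow F k a := by
  have hcounit : ∀ a, counit 𝒰 (F a) = counit 𝒱 a := fun a =>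
    congrArg (fun m => m a) hF.counit_comp
  have h0 : ∀ a ∈ filt 𝒱 0, proj 𝒰 (F a) = 0 := fun a ha => by
    obtain ⟨c, rfl⟩ := mem_filt_zero ha
    rw [map_smul, hF.map_one, map_smul, proj_one, smul_zero]
  induction N generalizing n a with
  | zero =>
    obtain rfl : n = 0 := by omega
    obtain ⟨c, rfl⟩ := mem_filt_zero ha
    simp [corestrictionPow, multiConv, hF.map_one]
  | succ N ih =>
    set S : GSym 𝒱 →ₗ[K] GSym 𝒰 :=
      ∑ k ∈ Finset.range (N + 1), (k.factorial : K)⁻¹ • corestrictionPow F k with hS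
    set T : GSym 𝒱 →ₗ[K] GSym 𝒰 :=
      ∑ k ∈ Finset.range (N + 1 + 1), (k.factorial : K)⁻¹ • corestrictionPow F k with hT
    have hTa : T a = ∑ k ∈ Finset.range (N + 1 + 1),
        (k.factorial : K)⁻¹ • corestrictionPow F k a := by simp [hT]
    -- The partial sums satisfy the same equation with a shift: k + 1 cancels a factor of (k + 1)!.
    have h1 : euler 𝒰 (T a) = conv (ι 𝒰 ∘ₗ proj 𝒰 ∘ₗ F) S a := by
      rw [hTa, hS, conv_sum, map_sum, Finset.sum_range_succ']
      simp only [map_smul, euler_corestrictionPow, Nat.cast_zero, zero_smul, smul_zero, add_zero]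
      refine Finset.sum_congr rfl fun k _ => ?_
      have h2 : ((k + 1 : ℕ) : K) ≠ 0 := Nat.cast_ne_zero.2 k.succ_ne_zero
      have h3 : ∀ (c : K) (A B : GSym 𝒱 →ₗ[K] GSym 𝒰), conv A (c • B) a = c • conv A B a := by
        intro c A B
        simp [conv, TensorProduct.map_smul_right]
      rw [h3, corestrictionPow_succ, smul_smul, Nat.factorial_succ, Nat.cast_mul, mul_inv_rev,
        mul_assoc, inv_mul_cancel₀ h2, mul_one]
    -- The corestriction kills constants, so the second tensor factor has length at most N, where F
    -- and S agree by induction.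
    have h2 : conv (ι 𝒰 ∘ₗ proj 𝒰 ∘ₗ F) F a = conv (ι 𝒰 ∘ₗ proj 𝒰 ∘ₗ F) S a := by
      have hmap : TensorProduct.map (ι 𝒰 ∘ₗ proj 𝒰 ∘ₗ F) (F - S) =
          TensorProduct.map (ι 𝒰 ∘ₗ proj 𝒰 ∘ₗ F) F - TensorProduct.map (ι 𝒰 ∘ₗ proj 𝒰 ∘ₗ F) S :=
        TensorProduct.ext' fun a b => by simp [TensorProduct.tmul_sub]
      have h3 := tensorFilt_induction (M := ⊥) (n := n)
        (A := LinearMap.mul' K (GSym 𝒰) ∘ₗ TensorProduct.map (ι 𝒰 ∘ₗ proj 𝒰 ∘ₗ F) (F - S))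
        (fun i j hij a ha b hb => ?_) (comul_mem_tensorFilt ha)
      · rw [Submodule.mem_bot, LinearMap.comp_apply, hmap, LinearMap.sub_apply, map_sub,
          sub_eq_zero] at h3
        exact h3
      · rw [Submodule.mem_bot, LinearMap.comp_apply, TensorProduct.map_tmul,
          LinearMap.comp_apply, LinearMap.comp_apply, LinearMap.mul'_apply]
        rcases i with _ | i
        · rw [h0 a ha, map_zero, zero_mul]
        · rw [LinearMap.sub_apply, ih (n := j) (by omega) hb]
          simp [hS]
    -- The Euler operator kills the difference, so it is a scalar, which the counit then shows to be
    -- 0.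
    have h3 : F a - T a ∈ filt 𝒰 0 := by
      apply mem_filt_of_euler_mem_filt
      rw [map_sub, hF.euler_apply, h1, h2, sub_self]
      exact Submodule.zero_mem _
    obtain ⟨c, h4⟩ := mem_filt_zero h3
    have h5 : counit 𝒰 (T a) = counit 𝒱 a := by
      rw [hTa, map_sum, Finset.sum_range_succ']
      simp only [corestrictionPow_succ, map_smul, counit_conv_corestriction]
      simp [corestrictionPow, multiConv]
    have h6 : c = 0 := by
      have h7 := congrArg (counit 𝒰) h4
      rw [map_sub, hcounit, h5, sub_self, map_smul, map_one, smul_eq_mul, mul_one] at h7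
      exact h7.symm
    rw [h6, zero_smul, sub_eq_zero] at h4
    rw [h4, hTa]

end Exponential

end GSym

/-! ### Unshuffles and surjective colorings -/

section Unshuffle

variable {n : ℕ}

theorem monotone_index (c : Composition n) : Monotone c.index := fun i j hij => by
  by_contra hlt
  rw [not_le] at hlt
  have h1 := c.lt_sizeUpTo_index_succ j
  have h2 := c.sizeUpTo_index_le i
  have h3 := c.monotone_sizeUpTo (Nat.succ_le_of_lt (Fin.lt_def.1 hlt))
  rw [Fin.le_def] at hij
  rw [Fin.val_succ] at h1
  simp only [Nat.succ_eq_add_one] at h3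
  omega

theorem card_index_eq (c : Composition n) (j : Fin c.length) :
    (Finset.univ.filter fun i => c.index i = j).card = c.blocksFun j := by
  have h : (Finset.univ.filter fun i => c.index i = j) =
      Finset.univ.map (c.embedding j).toEmbedding := by
    ext i
    rw [Finset.mem_filter, eq_comm, ← c.mem_range_embedding_iff']
    simp
  rw [h, Finset.card_map, Finset.card_univ, Fintype.card_fin]

theorem composition_ext_of_index {c d : Composition n} (hl : c.length = d.length)
    (h : ∀ i, (c.index i : ℕ) = d.index i) : c = d := by
  refine Composition.ext (List.ext_getElem hl fun k hk hk' => ?_)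
  have h1 : c.blocksFun ⟨k, hk⟩ = d.blocksFun ⟨k, hk'⟩ := by
    rw [← card_index_eq, ← card_index_eq]
    simp only [Fin.ext_iff, h]
  exact h1

/-- Avoids index types that depend on the block. -/
theorem mem_unshuffles_iff {c : Composition n} {σ : Equiv.Perm (Fin n)} :
    σ ∈ unshuffles c ↔ ∀ i j, i < j → c.index i = c.index j → σ i < σ j := by
  constructor
  · intro h i j hij hindex
    have h1 := c.mem_range_embedding_iff'.2 hindex.symm
    have h2 := c.mem_range_embedding j
    generalize c.index j = m at h1 h2
    obtain ⟨a, rfl⟩ := h1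
    obtain ⟨b, rfl⟩ := h2
    exact h m ((c.embedding m).lt_iff_lt.1 hij)
  · intro h j a b hab
    exact h _ _ ((c.embedding j).strictMono hab) (by simp)

/-- The map that sends `σ i`, for `i` in the block number `j`, to `j`. -/
def unshuffleColoring (c : Composition n) (σ : Equiv.Perm (Fin n)) (i : Fin n) : Fin c.length :=
  c.index (σ.symm i)

theorem unshuffleColoring_surjective (c : Composition n) (σ : Equiv.Perm (Fin n)) :
    Function.Surjective (unshuffleColoring c σ) := fun j =>
  ⟨σ (c.embedding j ⟨0, c.one_le_blocksFun j⟩), by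
    rw [unshuffleColoring, Equiv.symm_apply_apply, c.index_embedding]⟩

/-- An unshuffle is the stable sort of its coloring: colors increase weakly along it, and ties keep
their order. Hence the coloring determines it. -/
theorem eq_sort_of_mem_unshuffles {c : Composition n} {σ : Equiv.Perm (Fin n)}
    (hσ : σ ∈ unshuffles c) :
    σ = Tuple.sort fun i => (unshuffleColoring c σ i : ℕ) := by
  rw [Tuple.eq_sort_iff]
  constructor
  · intro i j hij
    simpa [unshuffleColoring] using monotone_index c hij
  · intro i j hij h
    exact mem_unshuffles_iff.1 hσ i j hij (by simpa [unshuffleColoring, Fin.ext_iff] using h)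

/-- Within a block an unshuffle has no inversions, so its inversions are exactly the pairs whose
colors are out of order. -/
theorem colorSign_unshuffleColoring (p : Fin n → ℤ) {c : Composition n} {σ : Equiv.Perm (Fin n)}
    (hσ : σ ∈ unshuffles c) : GSym.colorSign p (unshuffleColoring c σ) = koszulSign p σ := by
  rw [GSym.colorSign, koszulSign, Finset.prod_comm, ← Equiv.prod_comp σ]
  refine Finset.prod_congr rfl fun a _ => ?_
  rw [← Equiv.prod_comp σ]
  refine Finset.prod_congr rfl fun b _ => ?_
  have h : σ b < σ a ∧ unshuffleColoring c σ (σ a) < unshuffleColoring c σ (σ b) ↔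
      a < b ∧ σ b < σ a := by
    simp only [unshuffleColoring, Equiv.symm_apply_apply]
    constructor
    · rintro ⟨h1, h2⟩
      exact ⟨(monotone_index c).reflect_lt h2, h1⟩
    · rintro ⟨h1, h2⟩
      refine ⟨h2, (monotone_index c h1.le).lt_of_ne fun h3 => ?_⟩
      exact (mem_unshuffles_iff.1 hσ a b h1 h3).asymm h2
  simp only [h, mul_comm (p (σ b))]

/-- Two strictly increasing lists of indices with the same members coincide. -/
theorem colorFactor_unshuffleColoring {K : Type*} [Field K] {V : Type*} [AddCommGroup V]
    [Module K V] {𝒱 : ℤ → Submodule K V} (x : Fin n → V) {c : Composition n}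
    {σ : Equiv.Perm (Fin n)} (hσ : σ ∈ unshuffles c) (j : Fin c.length) :
    GSym.colorFactor 𝒱 x (unshuffleColoring c σ) j =
      GSym.monomial 𝒱 fun l => x (σ (c.embedding j l)) := by
  have h : ((List.finRange n).filter fun i => unshuffleColoring c σ i = j) =
      List.ofFn fun l => σ (c.embedding j l) := by
    refine List.SortedLT.eq_of_mem_iff ?_ ?_ fun i => ?_
    · exact ((List.sortedLT_finRange n).pairwise.filter _).sortedLT
    · exact List.sortedLT_ofFn_iff.2 (hσ j)
    · have h1 := c.mem_range_embedding_iff' (j := σ.symm i) (i := j)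
      rw [List.mem_filter, decide_eq_true_iff, List.mem_ofFn, unshuffleColoring, eq_comm (b := j),
        ← h1]
      simp [Equiv.eq_symm_apply]
  rw [GSym.colorFactor, h, List.map_ofFn]
  rfl

theorem coloring_sigma_ext {k k' : ℕ} {c : Fin n → Fin k} {c' : Fin n → Fin k'} (hk : k = k')
    (h : ∀ i, (c i : ℕ) = c' i) :
    (⟨k, c⟩ : Σ k, Fin n → Fin k) = ⟨k', c'⟩ := by
  subst hk
  obtain rfl : c = c' := funext fun i => Fin.ext (h i)
  rfl

/-- Fiber sizes determine how many values lie below each bound, and a monotone function is recovered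
from these counts. -/
theorem eq_of_monotone_of_card_fiber {f g : Fin n → ℕ} (hf : Monotone f) (hg : Monotone g)
    (h : ∀ m, (Finset.univ.filter fun i => f i = m).card =
      (Finset.univ.filter fun i => g i = m).card) : f = g := by
  have h1 : ∀ (f : Fin n → ℕ) (a : ℕ), (Finset.univ.filter fun i => f i < a).card =
      ∑ m ∈ Finset.range a, (Finset.univ.filter fun i => f i = m).card := by
    intro f a
    rw [Finset.card_eq_sum_card_fiberwise (t := Finset.range a) (f := f)
      fun i hi => by simpa using hi]
    refine Finset.sum_congr rfl fun m hm => ?_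
    congr 1
    ext i
    have := Finset.mem_range.1 hm
    simp only [Finset.mem_filter, Finset.mem_univ, true_and]
    constructor
    · exact fun h => h.2
    · rintro rfl
      exact ⟨this, rfl⟩
  have h2 : ∀ i a, f i < a ↔ g i < a := fun i a => by
    rw [← Tuple.lt_card_lt_iff_apply_lt_of_monotone hf,
      ← Tuple.lt_card_lt_iff_apply_lt_of_monotone hg, h1, h1]
    simp only [h]
  funext i
  have h3 := (h2 i (g i)).not
  have h4 := (h2 i (f i)).not
  simp only [lt_irrefl, not_false_iff, true_iff, iff_true, not_lt] at h3 h4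
  omega

/-- The composition of `n` by the sizes of the fibers of a surjective map. -/
def fiberComposition {k : ℕ} (γ : Fin n → Fin k) (hγ : Function.Surjective γ) : Composition n where
  blocks := List.ofFn fun j => (Finset.univ.filter fun i => γ i = j).card
  blocks_pos := by
    intro m hm
    obtain ⟨j, rfl⟩ := (List.mem_ofFn).1 hm
    obtain ⟨i, hi⟩ := hγ j
    exact Finset.card_pos.2 ⟨i, by simp [hi]⟩
  blocks_sum := by
    rw [List.sum_ofFn, ← Finset.card_eq_sum_card_fiberwise (fun i _ => Finset.mem_univ (γ i)),
      Finset.card_univ, Fintype.card_fin]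

/-- Take the fiber sizes as blocks and the stable sort of γ as permutation. Both the block index and
the sorted γ are monotone with the same fiber sizes. -/
theorem exists_unshuffleColoring_eq {k : ℕ} (γ : Fin n → Fin k) (hγ : Function.Surjective γ) :
    ∃ c : Composition n, ∃ σ ∈ unshuffles c, c.length = k ∧
      ∀ i, (unshuffleColoring c σ i : ℕ) = γ i := by
  set c := fiberComposition γ hγ with hcdef
  have hl : c.length = k := by simp [hcdef, fiberComposition, Composition.length]
  have hsort := (Tuple.eq_sort_iff (f := γ)).1 rfl
  have hindex : (fun i => (c.index i : ℕ)) = fun i => (γ (Tuple.sort γ i) : ℕ) := by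
    refine eq_of_monotone_of_card_fiber (fun i j hij => monotone_index c hij)
      (fun i j hij => hsort.1 hij) fun m => ?_
    by_cases hm : m < k
    · have h1 := card_index_eq c ⟨m, hl.symm ▸ hm⟩
      have h2 : c.blocksFun ⟨m, hl.symm ▸ hm⟩ =
          (Finset.univ.filter fun i => γ i = ⟨m, hm⟩).card := by
        simp [Composition.blocksFun, hcdef, fiberComposition]
      have h3 : (Finset.univ.filter fun i => γ i = ⟨m, hm⟩).card =
          (Finset.univ.filter fun i => γ (Tuple.sort γ i) = ⟨m, hm⟩).card :=
        (Finset.card_equiv (Tuple.sort γ) fun i => by simp).symm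
      rw [h2, h3] at h1
      simpa only [Fin.ext_iff] using h1
    · have h1 : ∀ i, (c.index i : ℕ) ≠ m := fun i => by have := (c.index i).2; omega
      have h2 : ∀ i, (γ (Tuple.sort γ i) : ℕ) ≠ m := fun i => by
        have := (γ (Tuple.sort γ i)).2; omega
      simp [h1, h2]
  have hindex' : ∀ i, (c.index i : ℕ) = γ (Tuple.sort γ i) := fun i => congrFun hindex i
  refine ⟨c, Tuple.sort γ, mem_unshuffles_iff.2 fun i j hij h => ?_, hl, fun i => ?_⟩
  · refine hsort.2 i j hij (Fin.ext ?_)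
    rw [← hindex', ← hindex', h]
  · rw [unshuffleColoring, hindex', Equiv.apply_symm_apply]

open Classical in
/-- Unshuffles correspond to surjective maps, by the images of the blocks. -/
theorem sum_unshuffles {M : Type*} [AddCommMonoid M] (W : ∀ k, (Fin n → Fin k) → M)
    (s : ℕ → Prop) :
    (∑ c : Composition n with s c.length, ∑ σ : Equiv.Perm (Fin n) with σ ∈ unshuffles c,
      W c.length (unshuffleColoring c σ)) =
    ∑ k ∈ Finset.range (n + 1) with s k, ∑ γ : Fin n → Fin k with Function.Surjective γ, W k γ := by
  rw [Finset.sum_sigma', Finset.sum_sigma']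
  refine Finset.sum_bij (fun a _ => ⟨a.1.length, unshuffleColoring a.1 a.2⟩) ?_ ?_ ?_ ?_
  · rintro ⟨c, σ⟩ h
    simp only [Finset.mem_sigma, Finset.mem_filter, Finset.mem_univ, true_and,
      Finset.mem_range] at h ⊢
    exact ⟨⟨Nat.lt_succ_of_le c.length_le, h.1⟩, unshuffleColoring_surjective c σ⟩
  · rintro ⟨c, σ⟩ h ⟨d, τ⟩ h' heq
    simp only [Finset.mem_sigma, Finset.mem_filter, Finset.mem_univ, true_and] at h h'
    have hl : c.length = d.length := congrArg (fun a => a.1) heq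
    have hcol : ∀ i, (unshuffleColoring c σ i : ℕ) = unshuffleColoring d τ i := fun i =>
      congrArg (fun a : Σ k, Fin n → Fin k => (a.2 i : ℕ)) heq
    have hσ : σ = τ := by
      rw [eq_sort_of_mem_unshuffles h.2, eq_sort_of_mem_unshuffles h'.2]
      simp only [hcol]
    subst hσ
    have hcd : c = d := composition_ext_of_index hl fun i => by
      simpa [unshuffleColoring] using hcol (σ i)
    rw [hcd]
  · rintro ⟨k, γ⟩ h
    simp only [Finset.mem_sigma, Finset.mem_filter, Finset.mem_univ, true_and] at h
    obtain ⟨c, σ, hσ, hl, hcol⟩ := exists_unshuffleColoring_eq γ h.2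
    refine ⟨⟨c, σ⟩, ?_, coloring_sigma_ext hl hcol⟩
    simp only [Finset.mem_sigma, Finset.mem_filter, Finset.mem_univ, true_and]
    exact ⟨hl.symm ▸ h.1.2, hσ⟩
  · rintro ⟨c, σ⟩ _
    rfl

end Unshuffle

/-! ### The recursion for the Taylor coefficients -/

section Recursion

variable {K : Type*} [Field K] {U V : Type*} [AddCommGroup U] [Module K U]
  [AddCommGroup V] [Module K V]
  {𝒰 : ℤ → Submodule K U} {𝒱 : ℤ → Submodule K V}

theorem GSym.proj_monomial_eq_zero {n : ℕ} (hn : 2 ≤ n) (x : Fin n → V) :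
    proj 𝒱 (monomial 𝒱 x) = 0 := by
  obtain ⟨n, rfl⟩ : ∃ m, n = m + 1 + 1 := ⟨n - 2, by omega⟩
  rw [monomial_succ, proj_ι_mul, monomial_succ]
  simp

theorem GSym.monomial_mem_filt {n : ℕ} (x : Fin n → V) : monomial 𝒱 x ∈ filt 𝒱 n := by
  induction n with
  | zero => rw [monomial_zero]; exact one_mem_filt 0
  | succ n ih => rw [monomial_succ]; exact ι_mul_mem_filt _ (ih _)

theorem taylor_eq_zero (Q : GSym 𝒰 →ₗ[K] GSym 𝒱) {n : ℕ} {x : Fin n → U} {j : Fin n}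
    (hj : x j = 0) : taylor Q x = 0 := by
  rw [taylor, monomial_eq_zero 𝒰 hj, map_zero, map_zero]

variable [DirectSum.Decomposition 𝒰] [DirectSum.Decomposition 𝒱]

omit [DirectSum.Decomposition 𝒱] in
-- Subtracting the linear coderivation removes exactly the linear coefficient of `Q`, whence the
-- restriction k ≥ 2 in the recursion.
theorem proj_sub_monomial {Q D : GSym 𝒰 →ₗ[K] GSym 𝒰} {d : U →ₗ[K] U}
    (hD : IsDerivationExtending 𝒰 1 d D) (hδ : IsReducedCoderivation (Q - D)) {k : ℕ}
    (y : Fin k → U) : proj 𝒰 ((Q - D) (monomial 𝒰 y)) = if 2 ≤ k then taylor Q y else 0 := by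
  by_cases hk : 2 ≤ k
  · rw [if_pos hk, LinearMap.sub_apply, map_sub, hD.proj_apply, proj_monomial_eq_zero hk, map_zero,
      sub_zero, taylor]
  · rw [if_neg hk]
    obtain rfl | rfl : k = 0 ∨ k = 1 := by omega
    · rw [monomial_zero, hδ.map_one, map_zero]
    · rw [monomial_succ, monomial_zero, mul_one, hδ.proj_ι]

/-- Expanding F in `hrec` as an exponential and evaluating on a monomial gives a sum over colorings
weighted by 1/k!. -/
theorem taylor_eq_transferRecursion [CharZero K] {Q D : GSym 𝒰 →ₗ[K] GSym 𝒰} {d h : U →ₗ[K] U}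
    {f : V →ₗ[K] U} (hD : IsDerivationExtending 𝒰 1 d D) (hδ : IsReducedCoderivation (Q - D))
    {F : GSym 𝒱 →ₗ[K] GSym 𝒰} (hF : IsCoalgebraMorphism 𝒱 𝒰 F)
    (hrec : ∀ b, proj 𝒰 (F b) = f (proj 𝒱 b) + h (proj 𝒰 ((Q - D) (F b)))) {n : ℕ} (hn : 2 ≤ n)
    {p : Fin n → ℤ} {x : Fin n → V} (hx : ∀ i, x i ∈ 𝒱 (p i)) :
    taylor F x = transferRecursion h Q F p x := by
  classical
  set W : ∀ k, (Fin n → Fin k) → U := fun k γ => colorSign p γ • (k.factorial : K)⁻¹ •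
    h (taylor Q fun j => proj 𝒰 (F (colorFactor 𝒱 x γ j))) with hW
  have h1 : transferRecursion h Q F p x =
      ∑ c : Composition n with 2 ≤ c.length, ∑ σ : Equiv.Perm (Fin n) with σ ∈ unshuffles c,
        W c.length (unshuffleColoring c σ) := by
    rw [transferRecursion]
    refine Finset.sum_congr (by congr) fun c _ => ?_
    refine Finset.sum_congr (by congr) fun σ hσ => ?_
    have hσ' := (Finset.mem_filter.1 hσ).2
    simp only [hW, colorSign_unshuffleColoring p hσ', colorFactor_unshuffleColoring x hσ', taylor]
  -- An unused color contributes the empty product 1, and pF(1) = 0 makes the whole term vanish.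
  have h2 : ∀ k (γ : Fin n → Fin k), ¬ Function.Surjective γ → W k γ = 0 := by
    intro k γ hγ
    obtain ⟨j, hj⟩ := not_forall.1 hγ
    have h3 : colorFactor 𝒱 x γ j = 1 := by
      rw [colorFactor, List.filter_eq_nil_iff.2 fun i _ => by
        simpa using fun h => hj ⟨i, h⟩]
      rfl
    simp only [hW]
    rw [taylor_eq_zero (j := j) Q (by rw [h3, hF.map_one, proj_one]), map_zero, smul_zero,
      smul_zero]
  have h3 := sum_unshuffles W fun k => 2 ≤ k
  have h4 : taylor F x = ∑ k ∈ Finset.range (n + 1) with 2 ≤ k,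
      ∑ γ : Fin n → Fin k with Function.Surjective γ, W k γ := by
    -- As n ≥ 2 the term fp vanishes; the exponential stops at k = n because the monomial has length
    -- n.
    rw [taylor, hrec, proj_monomial_eq_zero hn, map_zero, zero_add,
      hF.eq_sum le_rfl (monomial_mem_filt x), map_sum, map_sum, map_sum, Finset.sum_filter]
    refine Finset.sum_congr rfl fun k _ => ?_
    rw [Finset.sum_filter_of_ne fun γ _ h => by by_contra h'; exact h (h2 k γ h'),
      corestrictionPow, multiConv_monomial _ hx]
    simp only [map_smul, map_sum, Finset.smul_sum]
    have h5 : ∀ γ : Fin n → Fin k, h (proj 𝒰 ((Q - D) (colorSign p γ • (List.ofFn fun j =>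
        (ι 𝒰 ∘ₗ proj 𝒰 ∘ₗ F) (colorFactor 𝒱 x γ j)).prod))) = colorSign p γ • h (if 2 ≤ k then
          taylor Q (fun j => proj 𝒰 (F (colorFactor 𝒱 x γ j))) else 0) := fun γ => by
      rw [← proj_sub_monomial hD hδ]
      simp only [Units.smul_def, map_zsmul]
      rfl
    simp only [h5]
    split_ifs with hk
    · exact Finset.sum_congr rfl fun γ _ => smul_comm _ _ _
    · simp
  rw [h1, h4]
  convert h3.symm

end Recursion

end HomotopyTransfer

end

/-! ### The homotopy transfer theorem -/

theorem mainTheorem4 {K : Type*} [Field K] [CharZero K]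
    {U V : Type*} [AddCommGroup U] [Module K U] [AddCommGroup V] [Module K V]
    (𝒰 : ℤ → Submodule K U) [DirectSum.Decomposition 𝒰]
    (𝒱 : ℤ → Submodule K V) [DirectSum.Decomposition 𝒱]
    (dU : U →ₗ[K] U) (dV : V →ₗ[K] V) (g : U →ₗ[K] V) (f : V →ₗ[K] U) (h : U →ₗ[K] U)
    (hc : IsContraction 𝒰 𝒱 dU dV g f h)
    (Q : GSym 𝒰 →ₗ[K] GSym 𝒰)
    (hQ : IsLInftyStructure 𝒰 Q)
    (hQ1 : ∀ x : U, taylor Q ![x] = dU x)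
    (DU : GSym 𝒰 →ₗ[K] GSym 𝒰)
    (hDU : DU = GSym.linearExt 𝒰 dU hc.dA_deg)
    (DV : GSym 𝒱 →ₗ[K] GSym 𝒱)
    (hDV : DV = GSym.linearExt 𝒱 dV hc.dB_deg)
    (Sg : GSym 𝒰 →ₗ[K] GSym 𝒱)
    (hSg : Sg = (GSym.map g hc.σ_deg).toLinearMap)
    (Sf : GSym 𝒱 →ₗ[K] GSym 𝒰)
    (hSf : Sf = (GSym.map f hc.τ_deg).toLinearMap)
    (hHat : GSym 𝒰 →ₗ[K] GSym 𝒰)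
    (hhHat : hHat = GSym.symTrick 𝒰 (f ∘ₗ g) h)
    (R : GSym 𝒱 →ₗ[K] GSym 𝒱)
    (hR : R = perturbedDifferential DV Sg Sf hHat (Q - DU))
    (G : GSym 𝒰 →ₗ[K] GSym 𝒱)
    (hG : G = perturbedProjection Sg hHat (Q - DU))
    (F : GSym 𝒱 →ₗ[K] GSym 𝒰)
    (hF : F = perturbedInclusion Sf hHat (Q - DU))
    (H : GSym 𝒰 →ₗ[K] GSym 𝒰)
    (hH : H = perturbedHomotopy hHat (Q - DU)) :
    -- the symmetrized tensor trick gives a semifull DG bialgebra contraction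
    IsSemifullDGAlgebraContraction (GSym.degree 𝒰)
      (GSym.degree 𝒱) DU DV Sg Sf hHat ∧
    IsSemifullDGCoalgebraContraction 𝒰 𝒱 DU DV Sg Sf hHat ∧
    -- the perturbation series converge, to a contraction of `(S(U), Q)` onto `(S(V), R)`
    PerturbationConverges hHat (Q - DU) ∧
    IsContraction (GSym.degree 𝒰)
      (GSym.degree 𝒱) Q R G F H ∧
    -- the transferred structure, with linear part `dV`
    IsLInftyStructure 𝒱 R ∧
    (∀ x : V, taylor R ![x] = dV x) ∧
    -- the `L∞[1]` morphisms, with linear parts `g` and `f`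
    IsLInftyMorphism 𝒰 𝒱 Q R G ∧
    (∀ x : U, taylor G ![x] = g x) ∧
    IsLInftyMorphism 𝒱 𝒰 R Q F ∧
    (∀ x : V, taylor F ![x] = f x) ∧
    -- the recursion for the Taylor coefficients of `F`
    (∀ n : ℕ, 2 ≤ n → ∀ (p : Fin n → ℤ) (x : Fin n → V), (∀ i, x i ∈ 𝒱 (p i)) →
      taylor F x = transferRecursion h Q F p x) := by
  have hD := GSym.isDerivationExtending_linearExt hc.dA_deg
  have hE := GSym.isDerivationExtending_linearExt hc.dB_deg
  rw [← hDU] at hD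
  rw [← hDV] at hE
  obtain ⟨P, hP⟩ := hc.isWeightFiltration.exists_isPseudoInverse
  -- From here on the symmetrized tensor trick is used only in the form PL.
  rw [hc.symTrick_eq_comp hP] at hhHat
  have hsym := hc.isContraction_sym hD hE hP
  have hδ := hQ.isReducedCoderivation_sub hQ1 hD
  have hconv := hc.perturbationConverges hP hδ
  have hpert := isContraction_perturbed hsym hconv hδ.coderivation.deg
    (by rw [add_sub_cancel]; exact hQ.sq_zero)
  rw [add_sub_cancel] at hpert
  have hGm := hc.isCoalgebraMorphism_perturbedProjection hP hδ hsym hpert.σ_deg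
  have hFm := hc.isCoalgebraMorphism_perturbedInclusion hP hδ hsym hpert.τ_deg
  have hmul : ∀ a b, DU (a * b) = DU a * b + signOp (GSym.degree 𝒰) 1 a * DU b := hD.map_mul
  subst hSg hSf hhHat hR hG hF hH
  exact ⟨hc.isSemifullDGAlgebraContraction_sym hP hmul hE.map_one hD.map_one hsym,
    hc.isSemifullDGCoalgebraContraction_sym hD hE hP, hconv, hpert,
    isLInftyStructure_transfer hQ hpert hGm hFm, hc.taylor_perturbedDifferential hP hδ hE,
    ⟨hGm, hpert.σ_comm⟩, hc.taylor_perturbedProjection hP hδ, ⟨hFm, hpert.τ_comm⟩,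
    hc.taylor_perturbedInclusion hP hδ, fun n hn p x hx =>
      taylor_eq_transferRecursion hD hδ hFm (hc.proj_perturbedInclusion hP hδ) hn hx⟩
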